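/- Let $-\infty\le a<b\le\infty$, $I=(a,b)$, $m\ge 0$, let $q_{\rm sc},q_{\rm el},q_{\rm am}\in L^1_{\rm loc}(I)$ be real-valued and let $$\tau=\frac1{\mathrm i}\sigma_2\frac{d}{dx}+Q(x),\qquad Q=q_{\rm el}\,1+q_{\rm am}\sigma_1+(m+q_{\rm sc})\sigma_3,$$ with the Pauli matrices $\sigma_j$. Let $W_x(f,g)=f_1(x)g_2(x)-f_2(x)g_1(x)$, let $W_{a},W_b$ denote its limits as $x\to a,b$, and write $W(f,g)$ when it does not depend on $x$. Let $H$ be the self-adjoint operator in $L^2(I,\mathbb C^2)$ associated with $\tau$ and a boundary condition $W_a(w_a,f)=0$, respectively $W_b(w_b,f)=0$, at those endpoints where $\tau$ is in the limit circle case, where $w_a$ (respectively $w_b$) is a real non-trivial solution of $\tau w=\mu w$ for some real $\mu$. A function is in the domain of $H$ near $a$ (near $b$) if it is locally absolutely continuous, it and its image under $\tau$ are square integrable near $a$ (near $b$), and it satisfies the boundary condition there, if any; a Weyl solution at $a$ (at $b$) is a non-trivial solution of $\tau u=zu$ in the domain of $H$ near $a$ (near $b$). Let $\Phi(z,x),\Theta(z,x)$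 be real entire solutions of $\tau u=zu$ such that $W(\Theta(z),\Phi(z))=1$ and $\Phi(z,\cdot)$ is non-trivial and in the domain of $H$ near $a$ for every $z\in\mathbb C$. The singular Weyl function of $H$ (with respect to $\Phi,\Theta$) is $$M(z)=-\frac{W(\Theta(z),u_+(z))}{W(\Phi(z),u_+(z))},$$ where $u_+(z)$ is a Weyl solution at $b$; it is defined for all $z$ for which such a solution exists and the denominator does not vanish. Let $\Psi(z,x)=\Theta(z,x)+M(z)\Phi(z,x)$. Let $\lambda\in\mathbb R$ be such that $\Theta(\lambda,\cdot)$ is in the domain of $H$ near $b$ and $\Theta(\lambda,\cdot)\notin L^2(I,\mathbb C^2)$. Let $\gamma\in(0,\infty]$ (with $\infty^{-1}=0$) and set $$\widetilde\Theta_\gamma(\lambda,x)=\frac{\Theta(\lambda,x)}{c_\gamma(\lambda,x)},\qquad c_\gamma(\lambda,x)=-\frac1\gamma-\int_x^b\Theta(\lambda,y)^\top\Theta(\lambda,y)\,dy,$$ $$\tau_\gamma=\tau+\frac{\Theta_1(\lambda,x)^2-\Theta_2(\lambda,x)^2}{c_\gamma(\lambda,x)}\sigma_1-2\,\frac{\Theta_1(\lambda,x)\Theta_2(\lambda,x)}{c_\gamma(\lambda,x)}\sigma_3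 .$$ Let $H_\gamma$ be the operator associated with $\tau_\gamma$ and the boundary conditions $W_a(\widetilde\Theta_\gamma(\lambda),f)=0$, $W_b(\widetilde\Theta_\gamma(\lambda),f)=0$, imposed at those endpoints where $\tau_\gamma$ is in the limit circle case. Let the dot denote the derivative with respect to $z$. Then the following hold. 1. The potentials of $\tau_\gamma$ satisfy the assumptions made on those of $\tau$, $\widetilde\Theta_\gamma(\lambda,\cdot)$ is a real non-trivial solution of $\tau_\gamma u=\lambda u$ whenever it is used to generate a boundary condition, and the limit $W_b(\Theta(\lambda),\dot\Theta(\lambda))$ exists. 2. There are real entire solutions $\Phi_\gamma,\Theta_\gamma$ of $\tau_\gamma u=zu$ with $W(\Theta_\gamma(z),\Phi_\gamma(z))=1$ for all $z\in\mathbb C$, such that $\Phi_\gamma(z,\cdot)$ is a Weyl solution of $H_\gamma$ at $a$ for every $z\in\mathbb C$, and such that for $z\ne\lambda$ $$\Phi_\gamma(z,x)=(z-\lambda)\Big(\Phi(z,x)+\frac1{z-\lambda}\widetilde\Theta_\gamma(\lambda,x)W_x(\Theta(\lambda),\Phi(z))\Big),$$ $$\Theta_\gamma(z,x)=\frac1{z-\lambda}\Big[\Theta(z,x)+\frac1{z-\lambda}\widetilde\Theta_\gamma(\lambda,x)W_x(\Theta(\lambda),\Theta(z))+\Big(\frac1\gamma-W_b(\Theta(\lambda),\dot\Theta(\lambda))\Big)\Phi_\gamma(z,x)\Big],$$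 while $\Phi_\gamma(\lambda,x)=\widetilde\Theta_\gamma(\lambda,x)$. 3. For every $c\in(a,b)$ the operator obtained by restricting $H_\gamma$ to $(a,c)$ with the Dirichlet condition $f_1(c)=0$ has purely discrete spectrum. 4. The singular Weyl function $M_\gamma$ of $H_\gamma$ with respect to $\Phi_\gamma,\Theta_\gamma$ is defined for all $z\in\mathbb C\setminus\mathbb R$ and all $z\in\mathbb C\setminus\sigma(H_\gamma)$. For $z\neq\lambda$, $M_\gamma(z)$ is defined if and only if $M(z)$ is, and in this case $$M_\gamma(z)=\frac{M(z)+W_b(\Theta(\lambda),\dot\Theta(\lambda))(z-\lambda)}{(z-\lambda)^2}-\frac{\gamma^{-1}}{z-\lambda},$$ and $$\Psi_\gamma(z,x)=\frac1{z-\lambda}\Big[\Psi(z,x)+\frac1{z-\lambda}\widetilde\Theta_\gamma(\lambda,x)W_x(\Theta(\lambda),\Psi(z))\Big]=\Theta_\gamma(z,x)+M_\gamma(z)\Phi_\gamma(z,x)$$ is a Weyl solution of $H_\gamma$ at $b$. -/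

import Mathlib

open MeasureTheory Filter Topology
open scoped ENNReal

noncomputable section

/-- The fibre `ℂ²` with its Euclidean norm. -/
abbrev Spinor : Type := EuclideanSpace ℂ (Fin 2)

/-- The Wronskian `W_x(f, g) = f₁(x) g₂(x) - f₂(x) g₁(x)`. -/
def wronskian (f g : ℝ → Spinor) (x : ℝ) : ℂ := f x 0 * g x 1 - f x 1 * g x 0

/-- `f` is absolutely continuous on every compact interval with endpoints in `S`. -/
def ACLoc (S : Set ℝ) (f : ℝ → Spinor) : Prop :=
  ∀ x ∈ S, ∀ y ∈ S, AbsolutelyContinuousOnInterval f x y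

/-! ### Spectrum of an unbounded operator, given through its graph -/

section Spectrum

variable {X : Type*} [NormedAddCommGroup X] [NormedSpace ℂ X]

/-- `z` belongs to the resolvent set of the operator `A` with graph `G` iff `A - z` is a bijection
from the domain of `A` onto `X` with a bounded inverse `R`. -/
def graphResolventSet (G : Set (X × X)) : Set ℂ :=
  {z | ∃ R : X →L[ℂ] X, ∀ f g : X, (f, g) ∈ G ↔ R (g - z • f) = f}

/-- The spectrum of the operator with graph `G`. -/
def graphSpectrum (G : Set (X × X)) : Set ℂ := (graphResolventSet G)ᶜ

/-- The spectrum is purely discrete: it consists of isolated points, each of which is an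
eigenvalue of finite multiplicity. -/
def PurelyDiscreteSpectrum (G : Set (X × X)) : Prop :=
  ∀ z ∈ graphSpectrum G,
    (∃ U ∈ 𝓝 z, U ∩ graphSpectrum G ⊆ {z}) ∧
    (∃ f : X, f ≠ 0 ∧ (f, z • f) ∈ G) ∧
    FiniteDimensional ℂ (Submodule.span ℂ {f : X | (f, z • f) ∈ G})

end Spectrum

/-- The data of a differential expression `τ = (1/i) σ₂ d/dx + Q(x)` on the interval `(a, b)`,
with `Q = q_el 1 + q_am σ₁ + (m + q_sc) σ₃`. -/
structure DiracExpr where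
  a : EReal
  b : EReal
  m : ℝ
  qsc : ℝ → ℝ
  qel : ℝ → ℝ
  qam : ℝ → ℝ

namespace DiracExpr

variable (T : DiracExpr)

/-- The open interval `(a, b)` in `ℝ`. -/
def I : Set ℝ := {x : ℝ | T.a < (x : EReal) ∧ (x : EReal) < T.b}

/-- The part `(a, c)` of the interval to the left of `c`. -/
def leftPart (c : ℝ) : Set ℝ := {x : ℝ | T.a < (x : EReal) ∧ x < c}

/-- The part `(c, b)` of the interval to the right of `c`. -/
def rightPart (c : ℝ) : Set ℝ := {x : ℝ | c < x ∧ (x : EReal) < T.b}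

/-- The filter `x → a`, `x > a` (which is `atBot` if `a = -∞`). -/
def nearA : Filter ℝ := comap (fun x : ℝ => (x : EReal)) (𝓝[>] T.a)

/-- The filter `x → b`, `x < b` (which is `atTop` if `b = ∞`). -/
def nearB : Filter ℝ := comap (fun x : ℝ => (x : EReal)) (𝓝[<] T.b)

/-- `τ f`; since `(1/i) σ₂ = !![0, -1; 1, 0]` its components are
`-f₂' + (q_el + m + q_sc) f₁ + q_am f₂` and `f₁' + q_am f₁ + (q_el - m - q_sc) f₂`. -/
def op (f : ℝ → Spinor) (x : ℝ) : Spinor :=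
  !₂[-(deriv f x 1) + ((T.qel x + (T.m + T.qsc x) : ℝ) : ℂ) * f x 0 + ((T.qam x : ℝ) : ℂ) * f x 1,
    deriv f x 0 + ((T.qam x : ℝ) : ℂ) * f x 0 + ((T.qel x - (T.m + T.qsc x) : ℝ) : ℂ) * f x 1]

/-- `u ∈ AC_loc(I, ℂ²)` and `τ u = z u` almost everywhere on `I`. -/
def IsSolution (z : ℂ) (u : ℝ → Spinor) : Prop :=
  ACLoc T.I u ∧ ∀ᵐ x ∂(volume.restrict T.I), T.op u x = z • u x

/-- `f` is square integrable near `a`. -/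
def L2NearA (f : ℝ → Spinor) : Prop :=
  ∃ c ∈ T.I, MemLp f 2 (volume.restrict (T.leftPart c))

/-- `f` is square integrable near `b`. -/
def L2NearB (f : ℝ → Spinor) : Prop :=
  ∃ c ∈ T.I, MemLp f 2 (volume.restrict (T.rightPart c))

/-- Limit circle case at `a`: all solutions of `τ u = z u` are square integrable near `a`. -/
def LimitCircleA : Prop := ∀ (z : ℂ) (u : ℝ → Spinor), T.IsSolution z u → T.L2NearA u

/-- Limit circle case at `b`. -/
def LimitCircleB : Prop := ∀ (z : ℂ) (u : ℝ → Spinor), T.IsSolution z u → T.L2NearB u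

/-- A real non-trivial solution of `τ w = μ w` for some real `μ`. -/
def IsRealNontrivialSolution (w : ℝ → Spinor) : Prop :=
  (∃ μ : ℝ, T.IsSolution (μ : ℂ) w) ∧ (∃ x ∈ T.I, w x ≠ 0) ∧
    ∀ x ∈ T.I, ∀ i, (starRingEnd ℂ) (w x i) = w x i

/-- A real entire solution `u(z, x)`: it solves `τ u = z u` for each `z ∈ ℂ`, is entire in `z` for
each `x`, and satisfies `u(z^*, x) = u(z, x)^*`. -/
def IsRealEntireSolution (u : ℂ → ℝ → Spinor) : Prop :=
  (∀ z, T.IsSolution z (u z)) ∧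
  (∀ x ∈ T.I, Differentiable ℂ (fun z => u z x)) ∧
  ∀ z, ∀ x ∈ T.I, ∀ i, u ((starRingEnd ℂ) z) x i = (starRingEnd ℂ) (u z x i)

end DiracExpr

/-- A differential expression together with the functions `wa`, `wb` that generate the boundary
conditions `W_a(wa, f) = 0` and `W_b(wb, f) = 0`; a zero function imposes no condition. -/
structure DiracOperator extends DiracExpr where
  wa : ℝ → Spinor
  wb : ℝ → Spinor

namespace DiracOperator

variable (H : DiracOperator)

/-- The standing assumptions: `-∞ ≤ a < b ≤ ∞`, `m ≥ 0`, the (real-valued) potentials are locally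
integrable on `(a, b)`, and at each endpoint a boundary condition is imposed exactly in the
limit circle case; it is generated by a real non-trivial solution of `τ w = μ w` with `μ` real
(`μ = 0` is the usual choice, other real `μ` yield the same class of operators). -/
def IsAdmissible : Prop :=
  H.a < H.b ∧ 0 ≤ H.m ∧
  LocallyIntegrableOn H.qsc H.I ∧ LocallyIntegrableOn H.qel H.I ∧ LocallyIntegrableOn H.qam H.I ∧
  (H.LimitCircleA → H.IsRealNontrivialSolution H.wa) ∧ (¬ H.LimitCircleA → H.wa = 0) ∧
  (H.LimitCircleB → H.IsRealNontrivialSolution H.wb) ∧ (¬ H.LimitCircleB → H.wb = 0)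

/-- The boundary condition `W_a(wa, f) = 0`. -/
def BCA (f : ℝ → Spinor) : Prop := Tendsto (wronskian H.wa f) H.nearA (𝓝 0)

/-- The boundary condition `W_b(wb, f) = 0`. -/
def BCB (f : ℝ → Spinor) : Prop := Tendsto (wronskian H.wb f) H.nearB (𝓝 0)

/-- `f` lies in the domain of `H` near `a`. -/
def InDomainNearA (f : ℝ → Spinor) : Prop :=
  ACLoc H.I f ∧ H.L2NearA f ∧ H.L2NearA (H.op f) ∧ H.BCA f

/-- `f` lies in the domain of `H` near `b`. -/
def InDomainNearB (f : ℝ → Spinor) : Prop :=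
  ACLoc H.I f ∧ H.L2NearB f ∧ H.L2NearB (H.op f) ∧ H.BCB f

/-- The graph of the operator `H` in `L²((a, b), ℂ²)`. -/
def graph : Set (Lp Spinor 2 (volume.restrict H.I) × Lp Spinor 2 (volume.restrict H.I)) :=
  {p | ∃ f : ℝ → Spinor, ACLoc H.I f ∧ H.BCA f ∧ H.BCB f ∧
    p.1 =ᵐ[volume.restrict H.I] f ∧ p.2 =ᵐ[volume.restrict H.I] H.op f}

/-- The spectrum of `H`. -/
def spec : Set ℂ := graphSpectrum H.graph

/-- The graph in `L²((a, c), ℂ²)` of the restriction of `H` to `(a, c)` with the Dirichlet boundary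
condition `f₁(c) = 0`. -/
def dirichletGraph (c : ℝ) :
    Set (Lp Spinor 2 (volume.restrict (H.leftPart c)) ×
      Lp Spinor 2 (volume.restrict (H.leftPart c))) :=
  {p | ∃ f : ℝ → Spinor, ACLoc {x : ℝ | H.a < (x : EReal) ∧ x ≤ c} f ∧ H.BCA f ∧ f c 0 = 0 ∧
    p.1 =ᵐ[volume.restrict (H.leftPart c)] f ∧ p.2 =ᵐ[volume.restrict (H.leftPart c)] H.op f}

/-- For every `c ∈ (a, b)` the operator on `(a, c)` with a Dirichlet condition at `c` has purely
discrete spectrum. -/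
def DiscreteNearA : Prop := ∀ c ∈ H.I, PurelyDiscreteSpectrum (H.dirichletGraph c)

/-- `u` is a Weyl solution at `a`: a non-trivial solution of `τ u = z u` which lies in the domain of
`H` near `a`. -/
def IsWeylSolutionA (z : ℂ) (u : ℝ → Spinor) : Prop :=
  H.IsSolution z u ∧ (∃ x ∈ H.I, u x ≠ 0) ∧ H.InDomainNearA u

/-- `u` is a Weyl solution at `b`: a non-trivial solution of `τ u = z u` which lies in the domain of
`H` near `b`. -/
def IsWeylSolutionB (z : ℂ) (u : ℝ → Spinor) : Prop :=
  H.IsSolution z u ∧ (∃ x ∈ H.I, u x ≠ 0) ∧ H.InDomainNearB u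

/-- A system of real entire solutions `Φ`, `Θ` with `W(Θ(z), Φ(z)) = 1` such that `Φ(z)` is
non-trivial and lies in the domain of `H` near `a` for each `z`. -/
def IsFundamentalSystem (Φ Θ : ℂ → ℝ → Spinor) : Prop :=
  H.IsRealEntireSolution Φ ∧ H.IsRealEntireSolution Θ ∧
  (∀ z, ∀ x ∈ H.I, wronskian (Θ z) (Φ z) x = 1) ∧
  ∀ z, H.IsWeylSolutionA z (Φ z)

/-- `w = - W(Θ(z), u₊(z)) / W(Φ(z), u₊(z))` for a Weyl solution `u₊(z)` at `b` for which the
denominator does not vanish (the Wronskians do not depend on `x`, and the quotient does not depend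
on the choice of `u₊(z)`, which is unique up to scalar multiples). -/
def IsWeylValue (Φ Θ : ℂ → ℝ → Spinor) (z w : ℂ) : Prop :=
  ∃ u, H.IsWeylSolutionB z u ∧
    ∀ x ∈ H.I, wronskian (Φ z) u x ≠ 0 ∧ w = -(wronskian (Θ z) u x) / wronskian (Φ z) u x

/-- The set of all `z` for which the singular Weyl function is defined. -/
def weylDomain (Φ Θ : ℂ → ℝ → Spinor) : Set ℂ := {z | ∃ w, H.IsWeylValue Φ Θ z w}

open Classical in
/-- The singular Weyl function `M(z) = - W(Θ(z), u₊(z)) / W(Φ(z), u₊(z))`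
(with the value `0` outside `weylDomain`). -/
def singularWeyl (Φ Θ : ℂ → ℝ → Spinor) (z : ℂ) : ℂ :=
  if h : ∃ w, H.IsWeylValue Φ Θ z w then h.choose else 0

/-- `c_γ(x) = - γ⁻¹ - ∫_x^b u(y)ᵀ u(y) dy`, with the convention `∞⁻¹ = 0`. -/
def cGamma (u : ℝ → Spinor) (γ : ℝ≥0∞) (x : ℝ) : ℂ :=
  -((γ⁻¹.toReal : ℝ) : ℂ) - ∫ y in H.rightPart x, (u y 0 ^ 2 + u y 1 ^ 2)

/-- `u_γ = u / c_γ`. -/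
def uGamma (u : ℝ → Spinor) (γ : ℝ≥0∞) (x : ℝ) : Spinor := (H.cGamma u γ x)⁻¹ • u x

/-- The expression `τ_γ = τ + Q_γ` with
`Q_γ = ((u₁² - u₂²) / c_γ) σ₁ - (2 u₁ u₂ / c_γ) σ₃`, for a real function `u`. -/
def dcExpr (u : ℝ → Spinor) (γ : ℝ≥0∞) : DiracExpr where
  a := H.a
  b := H.b
  m := H.m
  qsc := fun x => H.qsc x - (2 * (u x 0 * u x 1) / H.cGamma u γ x).re
  qel := H.qel
  qam := fun x => H.qam x + ((u x 0 ^ 2 - u x 1 ^ 2) / H.cGamma u γ x).re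

open Classical in
/-- The double commutation `H_γ` of `H` from the right endpoint, with the real Weyl solution
`u = u₊(λ)` at `b`: the expression is `τ_γ`, and the boundary conditions `W_a(u_γ, f) = 0`,
`W_b(u_γ, f) = 0` are imposed at those endpoints where `τ_γ` is in the limit circle case. -/
def doubleCommutation (u : ℝ → Spinor) (γ : ℝ≥0∞) : DiracOperator where
  toDiracExpr := H.dcExpr u γ
  wa := if (H.dcExpr u γ).LimitCircleA then H.uGamma u γ else 0
  wb := if (H.dcExpr u γ).LimitCircleB then H.uGamma u γ else 0

end DiracOperator

end

/-! ### Absolutely continuous complex functions with a prescribed derivative -/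

/-! Put u = Θ(λ): a real solution without zeros, square integrable near b. Then c = c_γ is negative
and c' = u·u. The map v ↦ v + (z-λ)⁻¹ W(u,v) u/c takes solutions of τv = zv to solutions of τ_γ w =
zw; this is a pointwise computation from c' = u·u and the Lagrange identity W(u,v)' = (λ-z) u·v
(`IsSeed.isSolution_transform`). Since u/c is parallel to u, the map leaves W(u,·) unchanged, so
boundary conditions on the two sides can be compared.

The analytic point is the square integrability of the correction term W(u,v) u/c. It follows from a
Hardy type inequality, obtained by integrating the derivative of |W|²/c (`integral_sq_div_mul_le`).
Near a the boundary term has a favourable sign. Near b it is controlled by W_b(u,v) = 0 and the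
Cauchy–Schwarz inequality, and the same inequality for u/c and 1/c in place of u and c inverts the
map. Since u is not in L²(I), |c| tends to infinity at a; this forces W(u/c, Φ_γ(z)) → 0 there,
which is the boundary condition.

The formula for Θ_γ has an apparent double pole at λ. One order disappears because W(u,Θ(z))
vanishes at z = λ. What remains is a multiple of u/c with factor c + W_x(u,Θ̇) + 1/γ - W_b(u,Θ̇),
and this is zero because c + W_x(u,Θ̇) does not depend on x (`exists_boundary_wronskian`,
`preThetaGamma_lam`).

A number w is the value of M at z exactly when Θ + wΦ lies in the domain near b (`isWeylValue_iff`).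
The map sends Θ + wΦ to (z-λ)(Θ_γ + w_γ Φ_γ), where w_γ is the asserted expression in w, and it
preserves and reflects membership in the domain near b. This gives the formula for M_γ.

The remaining claims hold for every admissible operator with a fundamental system, hence for H_γ.
For nonreal z, W(Φ̄,Φ)/(z̄-z) is the energy of Φ on (a,x); it vanishes at a and increases, so Φ(z)
is never in the domain near b, while a compactness argument gives a Weyl solution there
(`mem_weylDomain_of_im_ne_zero`). Off the spectrum, the resolvent applied to a compactly supported
function gives one (`mem_weylDomain_of_notMem_spec`). Finally, the spectrum on (a,c) lies in the
zero set of the entire function z ↦ Φ₁(z,c). Where this function is nonzero, a Green function is the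
resolvent; its L² bound comes from the energy estimate for nonreal z, and from the maximum principle
on a small disc for real z (`exists_truncGreen_bound`). -/

theorem AbsolutelyContinuousOnInterval.comp_lipschitzOn {X Y : Type*} [PseudoMetricSpace X]
    [PseudoMetricSpace Y] {f : ℝ → X} {x y : ℝ} (hf : AbsolutelyContinuousOnInterval f x y)
    {φ : X → Y} {K : NNReal} (hφ : LipschitzOnWith K φ (f '' Set.uIcc x y)) :
    AbsolutelyContinuousOnInterval (fun t => φ (f t)) x y := by
  rw [absolutelyContinuousOnInterval_iff] at hf ⊢
  intro ε hε
  obtain ⟨δ, hδ, h⟩ := hf (ε / (K + 1)) (by positivity)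
  refine ⟨δ, hδ, fun E hE hs => ?_⟩
  have h1 := h E hE hs
  calc ∑ i ∈ Finset.range E.1, dist (φ (f (E.2 i).1)) (φ (f (E.2 i).2))
      ≤ ∑ i ∈ Finset.range E.1, (K : ℝ) * dist (f (E.2 i).1) (f (E.2 i).2) := by
        refine Finset.sum_le_sum fun i hi => ?_
        exact hφ.dist_le_mul _ ⟨_, (hE.1 i hi).1, rfl⟩ _ ⟨_, (hE.1 i hi).2, rfl⟩
    _ = K * ∑ i ∈ Finset.range E.1, dist (f (E.2 i).1) (f (E.2 i).2) := by rw [Finset.mul_sum]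
    _ ≤ (K + 1) * ∑ i ∈ Finset.range E.1, dist (f (E.2 i).1) (f (E.2 i).2) := by
        have : 0 ≤ ∑ i ∈ Finset.range E.1, dist (f (E.2 i).1) (f (E.2 i).2) :=
          Finset.sum_nonneg fun _ _ => dist_nonneg
        nlinarith
    _ < (K + 1) * (ε / (K + 1)) := by gcongr
    _ = ε := by field_simp

theorem AbsolutelyContinuousOnInterval.comp_lipschitz {X Y : Type*} [PseudoMetricSpace X]
    [PseudoMetricSpace Y] {f : ℝ → X} {x y : ℝ} (hf : AbsolutelyContinuousOnInterval f x y)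
    {φ : X → Y} {K : NNReal} (hφ : LipschitzWith K φ) :
    AbsolutelyContinuousOnInterval (fun t => φ (f t)) x y :=
  hf.comp_lipschitzOn hφ.lipschitzOnWith

/-- `f` is absolutely continuous between `x` and `y` with almost everywhere derivative `f'`. -/
def HasACDeriv (f f' : ℝ → ℂ) (x y : ℝ) : Prop :=
  AbsolutelyContinuousOnInterval f x y ∧ ∀ᵐ t, t ∈ Set.uIcc x y → HasDerivAt f (f' t) t

namespace HasACDeriv

variable {f f' g g' : ℝ → ℂ} {x y : ℝ}

theorem continuousOn (hf : HasACDeriv f f' x y) : ContinuousOn f (Set.uIcc x y) :=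
  hf.1.continuousOn

theorem mono {v w : ℝ} (hf : HasACDeriv f f' x y) (h : Set.uIcc v w ⊆ Set.uIcc x y) :
    HasACDeriv f f' v w :=
  ⟨hf.1.mono h, hf.2.mono fun _ ht hm => ht (h hm)⟩

theorem symm (hf : HasACDeriv f f' x y) : HasACDeriv f f' y x :=
  hf.mono (by rw [Set.uIcc_comm])

theorem congr_deriv (hf : HasACDeriv f f' x y) (h : ∀ t ∈ Set.uIcc x y, f' t = g' t) :
    HasACDeriv f g' x y :=
  ⟨hf.1, hf.2.mono fun t ht hm => h t hm ▸ ht hm⟩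

theorem add (hf : HasACDeriv f f' x y) (hg : HasACDeriv g g' x y) :
    HasACDeriv (fun t => f t + g t) (fun t => f' t + g' t) x y :=
  ⟨hf.1.add hg.1, by filter_upwards [hf.2, hg.2] with t h1 h2 hm using (h1 hm).add (h2 hm)⟩

theorem sub (hf : HasACDeriv f f' x y) (hg : HasACDeriv g g' x y) :
    HasACDeriv (fun t => f t - g t) (fun t => f' t - g' t) x y :=
  ⟨hf.1.sub hg.1, by filter_upwards [hf.2, hg.2] with t h1 h2 hm using (h1 hm).sub (h2 hm)⟩

theorem mul (hf : HasACDeriv f f' x y) (hg : HasACDeriv g g' x y) :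
    HasACDeriv (fun t => f t * g t) (fun t => f' t * g t + f t * g' t) x y :=
  ⟨hf.1.smul hg.1, by filter_upwards [hf.2, hg.2] with t h1 h2 hm using (h1 hm).mul (h2 hm)⟩

theorem const_mul (c : ℂ) (hf : HasACDeriv f f' x y) :
    HasACDeriv (fun t => c * f t) (fun t => c * f' t) x y :=
  ⟨hf.1.const_smul c, by filter_upwards [hf.2] with t h1 hm using (h1 hm).const_mul c⟩

theorem neg (hf : HasACDeriv f f' x y) :
    HasACDeriv (fun t => - f t) (fun t => - f' t) x y :=
  ⟨hf.1.neg, by filter_upwards [hf.2] with t h1 hm using (h1 hm).neg⟩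

theorem const (c : ℂ) (x y : ℝ) : HasACDeriv (fun _ => c) (fun _ => 0) x y :=
  ⟨(LipschitzWith.const c).lipschitzOnWith.absolutelyContinuousOnInterval,
    Eventually.of_forall fun _ _ => hasDerivAt_const _ _⟩

theorem conj (hf : HasACDeriv f f' x y) :
    HasACDeriv (fun t => (starRingEnd ℂ) (f t)) (fun t => (starRingEnd ℂ) (f' t)) x y :=
  ⟨hf.1.comp_lipschitz (φ := starRingEnd ℂ) Complex.isometry_conj.lipschitz, by
    filter_upwards [hf.2] with t h1 hm using
      (Complex.conjCLE.toContinuousLinearMap.hasFDerivAt.comp_hasDerivAt t (h1 hm))⟩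

/-- By compactness |f| has a positive minimum m on the interval, and inversion is m⁻²-Lipschitz on
{|w| ≥ m}. -/
theorem inv (hf : HasACDeriv f f' x y) (h0 : ∀ t ∈ Set.uIcc x y, f t ≠ 0) :
    HasACDeriv (fun t => (f t)⁻¹) (fun t => - f' t / f t ^ 2) x y := by
  refine ⟨?_, by filter_upwards [hf.2] with t h1 hm using (h1 hm).inv (h0 t hm)⟩
  obtain ⟨t₀, ht₀, hmin⟩ := isCompact_uIcc.exists_isMinOn Set.nonempty_uIcc hf.continuousOn.norm
  have hpos : 0 < ‖f t₀‖ := norm_pos_iff.2 (h0 t₀ ht₀)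
  refine hf.1.comp_lipschitzOn (φ := fun z : ℂ => z⁻¹) (K := Real.toNNReal (‖f t₀‖ ^ 2)⁻¹) ?_
  refine LipschitzOnWith.of_dist_le_mul ?_
  rintro _ ⟨s, hs, rfl⟩ _ ⟨t, ht, rfl⟩
  have h1 : ‖f t₀‖ ≤ ‖f s‖ := hmin hs
  have h2 : ‖f t₀‖ ≤ ‖f t‖ := hmin ht
  have hs0 := h0 s hs
  have ht0 := h0 t ht
  rw [dist_inv_inv₀ hs0 ht0, Real.coe_toNNReal _ (by positivity),
    inv_mul_eq_div]
  gcongr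
  nlinarith

/-- Reduction to real functions, to which the fundamental theorem of calculus is applied. -/
theorem re_im (hf : HasACDeriv f f' x y) :
    (AbsolutelyContinuousOnInterval (fun t => (f t).re) x y ∧
      ∀ᵐ t, t ∈ Set.uIcc x y → HasDerivAt (fun t => (f t).re) (f' t).re t) ∧
    (AbsolutelyContinuousOnInterval (fun t => (f t).im) x y ∧
      ∀ᵐ t, t ∈ Set.uIcc x y → HasDerivAt (fun t => (f t).im) (f' t).im t) := by
  refine ⟨⟨hf.1.comp_lipschitz (φ := Complex.re) (K := 1) ?_, ?_⟩,
    ⟨hf.1.comp_lipschitz (φ := Complex.im) (K := 1) ?_, ?_⟩⟩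
  · exact LipschitzWith.of_dist_le_mul fun a b => by
      simpa [Real.dist_eq, dist_eq_norm] using Complex.abs_re_le_norm (a - b)
  · filter_upwards [hf.2] with t h1 hm using
      (Complex.reCLM.hasFDerivAt.comp_hasDerivAt t (h1 hm))
  · exact LipschitzWith.of_dist_le_mul fun a b => by
      simpa [Real.dist_eq, dist_eq_norm] using Complex.abs_im_le_norm (a - b)
  · filter_upwards [hf.2] with t h1 hm using
      (Complex.imCLM.hasFDerivAt.comp_hasDerivAt t (h1 hm))

theorem _root_.AbsolutelyContinuousOnInterval.integral_of_hasDerivAt {f f' : ℝ → ℝ} {x y : ℝ}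
    (hf : AbsolutelyContinuousOnInterval f x y)
    (hd : ∀ᵐ t, t ∈ Set.uIcc x y → HasDerivAt f (f' t) t) :
    IntervalIntegrable f' volume x y ∧ ∫ t in x..y, f' t = f y - f x := by
  have he : ∀ᵐ t, t ∈ Set.uIoc x y → deriv f t = f' t := by
    filter_upwards [hd] with t ht hm using (ht (Set.uIoc_subset_uIcc hm)).deriv
  refine ⟨hf.intervalIntegrable_deriv.congr_ae ?_, ?_⟩
  · rwa [Filter.EventuallyEq, ae_restrict_iff' measurableSet_uIoc]
  · rw [← hf.integral_deriv_eq_sub]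
    exact (intervalIntegral.integral_congr_ae he).symm

theorem intervalIntegrable (hf : HasACDeriv f f' x y) : IntervalIntegrable f' volume x y := by
  obtain ⟨⟨h1, h2⟩, ⟨h3, h4⟩⟩ := hf.re_im
  have a := (h1.integral_of_hasDerivAt h2).1
  have b := (h3.integral_of_hasDerivAt h4).1
  have a' : IntervalIntegrable (fun t => ((f' t).re : ℂ)) volume x y := ⟨a.1.ofReal, a.2.ofReal⟩
  have b' : IntervalIntegrable (fun t => ((f' t).im : ℂ)) volume x y := ⟨b.1.ofReal, b.2.ofReal⟩
  refine (a'.add (b'.mul_const Complex.I)).congr_ae (Eventually.of_forall fun t => ?_)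
  simp [Complex.re_add_im]

theorem integral_eq (hf : HasACDeriv f f' x y) : ∫ t in x..y, f' t = f y - f x := by
  have hi := hf.intervalIntegrable
  obtain ⟨⟨h1, h2⟩, ⟨h3, h4⟩⟩ := hf.re_im
  have a := (h1.integral_of_hasDerivAt h2).2
  have b := (h3.integral_of_hasDerivAt h4).2
  have hr := Complex.reCLM.intervalIntegral_comp_comm hi
  have him := Complex.imCLM.intervalIntegral_comp_comm hi
  simp only [Complex.reCLM_apply, Complex.imCLM_apply] at hr him
  apply Complex.ext
  · rw [← hr, a, Complex.sub_re]
  · rw [← him, b, Complex.sub_im]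

theorem of_integral (hi : IntervalIntegrable f' volume x y)
    (h : ∀ t ∈ Set.uIcc x y, f t = f x + ∫ s in x..t, f' s) : HasACDeriv f f' x y := by
  have hx : x ∈ Set.uIcc x y := Set.left_mem_uIcc
  have hre : IntervalIntegrable (fun t => (f' t).re) volume x y :=
    ⟨hi.1.re, hi.2.re⟩
  have him : IntervalIntegrable (fun t => (f' t).im) volume x y :=
    ⟨hi.1.im, hi.2.im⟩
  have hsub : ∀ t ∈ Set.uIcc x y, IntervalIntegrable f' volume x t := fun t ht =>
    hi.mono_set (Set.uIcc_subset_uIcc_left ht)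
  have key : ∀ t ∈ Set.uIcc x y, f t = f x + ((∫ s in x..t, (f' s).re : ℝ) : ℂ)
      + ((∫ s in x..t, (f' s).im : ℝ) : ℂ) * Complex.I := by
    intro t ht
    have hr := Complex.reCLM.intervalIntegral_comp_comm (hsub t ht)
    have hm := Complex.imCLM.intervalIntegral_comp_comm (hsub t ht)
    simp only [Complex.reCLM_apply, Complex.imCLM_apply] at hr hm
    rw [hr, hm, add_assoc, Complex.re_add_im]
    exact h t ht
  have ac := ((const (f x) x y).1.add
    ((hre.absolutelyContinuousOnInterval_intervalIntegral hx).comp_lipschitz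
      (φ := fun r : ℝ => (r : ℂ)) Complex.isometry_ofReal.lipschitz)).add
    ((him.absolutelyContinuousOnInterval_intervalIntegral hx).comp_lipschitz
      (φ := fun r : ℝ => (r : ℂ) * Complex.I) (K := 1)
        (LipschitzWith.of_dist_le_mul fun a b => by
          rw [dist_eq_norm, ← sub_mul, ← Complex.ofReal_sub, norm_mul]
          simp [Real.dist_eq, -Complex.ofReal_sub]))
  constructor
  · rw [absolutelyContinuousOnInterval_iff] at ac ⊢
    intro ε hε
    obtain ⟨δ, hδ, hac⟩ := ac ε hε
    refine ⟨δ, hδ, fun E hE hs => lt_of_eq_of_lt ?_ (hac E hE hs)⟩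
    refine Finset.sum_congr rfl fun i hi => ?_
    rw [key _ (hE.1 i hi).1, key _ (hE.1 i hi).2]
    rfl
  -- The two endpoints are discarded so that the integral formula for f holds in a full
  -- neighbourhood of t.
  · have hne : ∀ᵐ t : ℝ, t ≠ x ∧ t ≠ y := by
      have h₁ : ∀ᵐ t : ℝ, t ≠ x := by simp [ae_iff, measure_singleton]
      have h₂ : ∀ᵐ t : ℝ, t ≠ y := by simp [ae_iff, measure_singleton]
      exact h₁.and h₂
    filter_upwards [hi.ae_hasDerivAt_integral, hne] with t ht hne hm
    have h1 := (ht hm x hx).const_add (f x)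
    refine h1.congr_of_eventuallyEq ?_
    have hmem : Set.uIcc x y ∈ 𝓝 t := by
      rw [Set.uIcc, Set.mem_Icc] at hm
      refine Icc_mem_nhds (lt_of_le_of_ne hm.1 ?_) (lt_of_le_of_ne hm.2 ?_)
      · rcases min_choice x y with h | h <;> rw [h] <;> [exact hne.1.symm; exact hne.2.symm]
      · rcases max_choice x y with h | h <;> rw [h] <;> [exact hne.1; exact hne.2]
    filter_upwards [hmem] with s hs using h s hs

/-- Agreement on the closed interval says nothing about two-sided derivatives at its endpoints;
passing through the integral formula avoids them. -/
theorem congr (hf : HasACDeriv f f' x y) (h : ∀ t ∈ Set.uIcc x y, f t = g t) :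
    HasACDeriv g f' x y := by
  refine of_integral hf.intervalIntegrable fun t ht => ?_
  have := (hf.mono (Set.uIcc_subset_uIcc Set.left_mem_uIcc ht)).integral_eq
  rw [this, ← h t ht, ← h x Set.left_mem_uIcc]
  ring

end HasACDeriv

/-! ### Spinor-valued functions -/

/-- The bilinear product `v₁ w₁ + v₂ w₂`. -/
def spinorDot (v w : Spinor) : ℂ := v 0 * w 0 + v 1 * w 1

theorem Spinor.ext' {v w : Spinor} (h0 : v 0 = w 0) (h1 : v 1 = w 1) : v = w := by
  ext i; fin_cases i <;> assumption

theorem Spinor.norm_sq (v : Spinor) : ‖v‖ ^ 2 = ‖v 0‖ ^ 2 + ‖v 1‖ ^ 2 := by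
  rw [EuclideanSpace.norm_sq_eq, Fin.sum_univ_two]

theorem Spinor.norm_apply_le (v : Spinor) (i : Fin 2) : ‖v i‖ ≤ ‖v‖ := PiLp.norm_apply_le v i

theorem Spinor.norm_le (v : Spinor) : ‖v‖ ≤ ‖v 0‖ + ‖v 1‖ := by
  have := Spinor.norm_sq v
  nlinarith [norm_nonneg (v 0), norm_nonneg (v 1), norm_nonneg v,
    mul_nonneg (norm_nonneg (v 0)) (norm_nonneg (v 1))]

theorem norm_spinorDot_le (v w : Spinor) : ‖spinorDot v w‖ ≤ ‖v‖ * ‖w‖ := by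
  have hv := Spinor.norm_sq v
  have hw := Spinor.norm_sq w
  have h : ‖spinorDot v w‖ ≤ ‖v 0‖ * ‖w 0‖ + ‖v 1‖ * ‖w 1‖ := by
    unfold spinorDot
    exact (norm_add_le _ _).trans (by rw [norm_mul, norm_mul])
  refine h.trans (abs_le_of_sq_le_sq' ?_ (by positivity)).2
  rw [mul_pow, hv, hw]
  nlinarith [sq_nonneg (‖v 0‖ * ‖w 1‖ - ‖v 1‖ * ‖w 0‖)]

theorem norm_wronskian_le (f g : ℝ → Spinor) (x : ℝ) : ‖wronskian f g x‖ ≤ ‖f x‖ * ‖g x‖ := by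
  have hv := Spinor.norm_sq (f x)
  have hw := Spinor.norm_sq (g x)
  have h : ‖wronskian f g x‖ ≤ ‖f x 0‖ * ‖g x 1‖ + ‖f x 1‖ * ‖g x 0‖ := by
    unfold wronskian
    exact (norm_sub_le _ _).trans (by rw [norm_mul, norm_mul])
  refine h.trans (abs_le_of_sq_le_sq' ?_ (by positivity)).2
  rw [mul_pow, hv, hw]
  nlinarith [sq_nonneg (‖f x 0‖ * ‖g x 0‖ - ‖f x 1‖ * ‖g x 1‖)]

/-- Componentwise complex conjugation. -/
noncomputable def Spinor.conj (v : Spinor) : Spinor :=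
  !₂[(starRingEnd ℂ) (v 0), (starRingEnd ℂ) (v 1)]

@[simp] theorem Spinor.conj_zero (v : Spinor) : v.conj 0 = (starRingEnd ℂ) (v 0) := rfl
@[simp] theorem Spinor.conj_one (v : Spinor) : v.conj 1 = (starRingEnd ℂ) (v 1) := rfl

theorem Spinor.norm_conj (v : Spinor) : ‖v.conj‖ = ‖v‖ := by
  have h : ‖v.conj‖ ^ 2 = ‖v‖ ^ 2 := by
    rw [Spinor.norm_sq, Spinor.norm_sq]; simp
  exact (sq_eq_sq₀ (norm_nonneg _) (norm_nonneg _)).1 h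

theorem spinorDot_conj_self (v : Spinor) : spinorDot v.conj v = ((‖v‖ ^ 2 : ℝ) : ℂ) := by
  rw [Spinor.norm_sq, spinorDot]
  simp [Complex.conj_mul']

theorem AbsolutelyContinuousOnInterval.spinor_apply {u : ℝ → Spinor} {x y : ℝ}
    (h : AbsolutelyContinuousOnInterval u x y) (i : Fin 2) :
    AbsolutelyContinuousOnInterval (fun t => u t i) x y :=
  h.comp_lipschitz (φ := fun v : Spinor => v i) (K := 1) <|
    LipschitzWith.of_dist_le_mul fun a b => by
      simpa [dist_eq_norm] using Spinor.norm_apply_le (a - b) i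

theorem AbsolutelyContinuousOnInterval.spinor_mk {u : ℝ → Spinor} {x y : ℝ}
    (h0 : AbsolutelyContinuousOnInterval (fun t => u t 0) x y)
    (h1 : AbsolutelyContinuousOnInterval (fun t => u t 1) x y) :
    AbsolutelyContinuousOnInterval u x y := by
  rw [absolutelyContinuousOnInterval_iff] at h0 h1 ⊢
  intro ε hε
  obtain ⟨δ, hδ, h⟩ := h0 (ε / 2) (by positivity)
  obtain ⟨δ', hδ', h'⟩ := h1 (ε / 2) (by positivity)
  refine ⟨min δ δ', lt_min hδ hδ', fun E hE hs => ?_⟩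
  have e0 := h E hE (hs.trans_le (min_le_left _ _))
  have e1 := h' E hE (hs.trans_le (min_le_right _ _))
  calc _ ≤ ∑ i ∈ Finset.range E.1, (dist (u (E.2 i).1 0) (u (E.2 i).2 0)
        + dist (u (E.2 i).1 1) (u (E.2 i).2 1)) := by
        refine Finset.sum_le_sum fun i _ => ?_
        simpa [dist_eq_norm] using Spinor.norm_le (u (E.2 i).1 - u (E.2 i).2)
    _ < ε := by rw [Finset.sum_add_distrib]; linarith

theorem hasDerivAt_spinor {u : ℝ → Spinor} {v : Spinor} {t : ℝ} :
    HasDerivAt u v t ↔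
      HasDerivAt (fun s => u s 0) (v 0) t ∧ HasDerivAt (fun s => u s 1) (v 1) t := by
  rw [← hasDerivWithinAt_univ, ← hasDerivWithinAt_univ, ← hasDerivWithinAt_univ]
  rw [hasDerivWithinAt_iff_hasFDerivWithinAt, hasFDerivWithinAt_piLp 2, Fin.forall_fin_two,
    hasDerivWithinAt_iff_hasFDerivWithinAt, hasDerivWithinAt_iff_hasFDerivWithinAt]
  have e (i : Fin 2) : (PiLp.proj 2 (fun _ : Fin 2 => ℂ) i : Spinor →L[ℝ] ℂ).comp
      (ContinuousLinearMap.toSpanSingleton ℝ v) = ContinuousLinearMap.toSpanSingleton ℝ (v i) := by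
    ext; simp
  rw [e, e]

namespace DiracExpr

variable (T : DiracExpr)

/-- `u` is locally absolutely continuous on `S` and `τ u = F` almost everywhere on `S`. -/
def IsSolOn (S : Set ℝ) (F u : ℝ → Spinor) : Prop :=
  ACLoc S u ∧ ∀ᵐ t, t ∈ S → T.op u t = F t

/-- The right hand side of the first component of the equation `τ u = F`. -/
noncomputable def rhs0 (F u : ℝ → Spinor) (t : ℝ) : ℂ :=
  F t 1 - (T.qam t : ℂ) * u t 0 - ((T.qel t - (T.m + T.qsc t) : ℝ) : ℂ) * u t 1

/-- The right hand side of the second component of the equation `τ u = F`. -/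
noncomputable def rhs1 (F u : ℝ → Spinor) (t : ℝ) : ℂ :=
  - F t 0 + ((T.qel t + (T.m + T.qsc t) : ℝ) : ℂ) * u t 0 + (T.qam t : ℂ) * u t 1

variable {T}

theorem ordConnected_I : (T.I).OrdConnected :=
  ⟨fun _ hx _ hy _ ht => ⟨hx.1.trans_le (EReal.coe_le_coe_iff.2 ht.1),
    (EReal.coe_le_coe_iff.2 ht.2).trans_lt hy.2⟩⟩

theorem isOpen_I : IsOpen T.I :=
  (isOpen_lt continuous_const continuous_coe_real_ereal).inter
    (isOpen_lt continuous_coe_real_ereal continuous_const)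

theorem measurableSet_I : MeasurableSet T.I := isOpen_I.measurableSet

theorem uIcc_subset_I {x y : ℝ} (hx : x ∈ T.I) (hy : y ∈ T.I) : Set.uIcc x y ⊆ T.I :=
  ordConnected_I.uIcc_subset hx hy

theorem isSolution_iff {z : ℂ} {u : ℝ → Spinor} :
    T.IsSolution z u ↔ T.IsSolOn T.I (fun t => z • u t) u := by
  unfold IsSolution IsSolOn
  rw [ae_restrict_iff' measurableSet_I]

theorem IsSolOn.mono {S S' : Set ℝ} {F u : ℝ → Spinor} (h : T.IsSolOn S F u) (hS : S' ⊆ S) :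
    T.IsSolOn S' F u :=
  ⟨fun x hx y hy => h.1 x (hS hx) y (hS hy), h.2.mono fun _ ht hm => ht (hS hm)⟩

/-- `op` is written with `deriv`, which is 0 where the function is not differentiable; hence the
explicit differentiability on the left. -/
theorem hasDerivAt_iff_op {u : ℝ → Spinor} {F : ℝ → Spinor} {t : ℝ} :
    (DifferentiableAt ℝ u t ∧ T.op u t = F t) ↔
      HasDerivAt (fun s => u s 0) (T.rhs0 F u t) t ∧
      HasDerivAt (fun s => u s 1) (T.rhs1 F u t) t := by
  constructor
  · rintro ⟨hd, hop⟩
    have h := hasDerivAt_spinor.1 hd.hasDerivAt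
    have h0 : T.op u t 0 = F t 0 := by rw [hop]
    have h1 : T.op u t 1 = F t 1 := by rw [hop]
    simp only [op, PiLp.toLp_apply, Matrix.cons_val_zero, Matrix.cons_val_one] at h0 h1
    refine ⟨?_, ?_⟩
    · convert h.1 using 1
      rw [rhs0, ← h1]; ring
    · convert h.2 using 1
      rw [rhs1, ← h0]; ring
  · rintro ⟨h0, h1⟩
    have h : HasDerivAt u (!₂[T.rhs0 F u t, T.rhs1 F u t] : Spinor) t :=
      hasDerivAt_spinor.2 ⟨by simpa using h0, by simpa using h1⟩
    refine ⟨h.differentiableAt, Spinor.ext' ?_ ?_⟩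
    · simp only [op, h.deriv, PiLp.toLp_apply, Matrix.cons_val_zero, Matrix.cons_val_one, rhs1]
      ring
    · simp only [op, h.deriv, PiLp.toLp_apply, Matrix.cons_val_zero, Matrix.cons_val_one, rhs0]
      ring

theorem IsSolOn.hasACDeriv {S : Set ℝ} (hS : S.OrdConnected) {F u : ℝ → Spinor}
    (h : T.IsSolOn S F u) {x y : ℝ} (hx : x ∈ S) (hy : y ∈ S) :
    HasACDeriv (fun t => u t 0) (T.rhs0 F u) x y ∧
    HasACDeriv (fun t => u t 1) (T.rhs1 F u) x y := by
  have hac := h.1 x hx y hy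
  -- Lebesgue's theorem for the four real components. Only with it does the equation for `op`
  -- determine the derivatives.
  have hd : ∀ᵐ t, t ∈ Set.uIcc x y → DifferentiableAt ℝ u t := by
    have a0 := hac.spinor_apply 0
    have a1 := hac.spinor_apply 1
    have r (i : Fin 2) : AbsolutelyContinuousOnInterval (fun t => (u t i).re) x y :=
      (hac.spinor_apply i).comp_lipschitz (φ := Complex.re) (K := 1) <|
        LipschitzWith.of_dist_le_mul fun a b => by
          simpa [Real.dist_eq, dist_eq_norm] using Complex.abs_re_le_norm (a - b)
    have m (i : Fin 2) : AbsolutelyContinuousOnInterval (fun t => (u t i).im) x y :=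
      (hac.spinor_apply i).comp_lipschitz (φ := Complex.im) (K := 1) <|
        LipschitzWith.of_dist_le_mul fun a b => by
          simpa [Real.dist_eq, dist_eq_norm] using Complex.abs_im_le_norm (a - b)
    filter_upwards [(r 0).ae_differentiableAt, (r 1).ae_differentiableAt,
      (m 0).ae_differentiableAt, (m 1).ae_differentiableAt] with t r0 r1 m0 m1 ht
    have c (i : Fin 2) (hr : DifferentiableAt ℝ (fun t => (u t i).re) t)
        (hm : DifferentiableAt ℝ (fun t => (u t i).im) t) :
        HasDerivAt (fun t => u t i) (((deriv (fun t => (u t i).re) t : ℝ) : ℂ)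
          + ((deriv (fun t => (u t i).im) t : ℝ) : ℂ) * Complex.I) t := by
      have := hr.hasDerivAt.ofReal_comp.add (hm.hasDerivAt.ofReal_comp.mul_const Complex.I)
      refine this.congr_of_eventuallyEq (Eventually.of_forall fun s => ?_)
      simp [Complex.re_add_im]
    exact (hasDerivAt_spinor (v := !₂[_, _]).2
      ⟨by simpa using c 0 (r0 ht) (m0 ht), by simpa using c 1 (r1 ht) (m1 ht)⟩).differentiableAt
  have hsub : Set.uIcc x y ⊆ S := hS.uIcc_subset hx hy
  have key : ∀ᵐ t, t ∈ Set.uIcc x y → HasDerivAt (fun s => u s 0) (T.rhs0 F u t) t ∧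
      HasDerivAt (fun s => u s 1) (T.rhs1 F u t) t := by
    filter_upwards [hd, h.2] with t h1 h2 ht
    exact hasDerivAt_iff_op.1 ⟨h1 ht, h2 (hsub ht)⟩
  exact ⟨⟨hac.spinor_apply 0, key.mono fun t ht hm => (ht hm).1⟩,
    ⟨hac.spinor_apply 1, key.mono fun t ht hm => (ht hm).2⟩⟩

/-- Every point of the open set has a compact interval around it on which the exceptional set is
null, and a locally null set is null. -/
theorem ae_of_forall_uIcc {S : Set ℝ} (hS : IsOpen S) {p : ℝ → Prop}
    (h : ∀ x ∈ S, ∀ y ∈ S, Set.uIcc x y ⊆ S → ∀ᵐ t, t ∈ Set.uIcc x y → p t) :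
    ∀ᵐ t, t ∈ S → p t := by
  have : volume (S ∩ {t | ¬ p t}) = 0 := by
    refine measure_null_of_locally_null _ fun t ht => ?_
    obtain ⟨ε, hε, hb⟩ := Metric.isOpen_iff.1 hS t ht.1
    have hI : Set.uIcc (t - ε / 2) (t + ε / 2) ⊆ S := by
      rw [Set.uIcc_of_le (by linarith)]
      intro s hs
      refine hb ?_
      rw [Metric.mem_ball, Real.dist_eq, abs_lt]
      constructor <;> linarith [hs.1, hs.2]
    have h1 := h _ (hI Set.left_mem_uIcc) _ (hI Set.right_mem_uIcc) hI
    refine ⟨Set.uIcc (t - ε / 2) (t + ε / 2) ∩ {t | ¬ p t}, ?_, ?_⟩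
    · rw [nhdsWithin_inter', Set.inter_comm]
      refine inter_mem (mem_inf_of_right (mem_principal_self _)) ?_
      refine mem_inf_of_left (mem_nhdsWithin_of_mem_nhds ?_)
      rw [Set.uIcc_of_le (by linarith)]
      exact Icc_mem_nhds (by linarith) (by linarith)
    · rw [ae_iff] at h1
      convert h1 using 2
      ext s
      simp [Classical.not_imp]
  rw [ae_iff]
  convert this using 2
  ext s
  simp [Classical.not_imp]

theorem IsSolOn.of_hasACDeriv {F u : ℝ → Spinor}
    (h : ∀ x ∈ T.I, ∀ y ∈ T.I, HasACDeriv (fun t => u t 0) (T.rhs0 F u) x y ∧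
      HasACDeriv (fun t => u t 1) (T.rhs1 F u) x y) : T.IsSolOn T.I F u := by
  refine ⟨fun x hx y hy => .spinor_mk (h x hx y hy).1.1 (h x hx y hy).2.1,
    ae_of_forall_uIcc isOpen_I fun x hx y hy _ => ?_⟩
  filter_upwards [(h x hx y hy).1.2, (h x hx y hy).2.2] with t h0 h1 ht
  exact (hasDerivAt_iff_op.2 ⟨h0 ht, h1 ht⟩).2

/-- Lagrange identity: Q is a symmetric matrix, so the potentials cancel and only the right hand
sides remain. -/
theorem IsSolOn.wronskian {S : Set ℝ} (hS : S.OrdConnected) {F G f g : ℝ → Spinor}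
    (hf : T.IsSolOn S F f) (hg : T.IsSolOn S G g) {x y : ℝ} (hx : x ∈ S) (hy : y ∈ S) :
    HasACDeriv (wronskian f g) (fun t => spinorDot (F t) (g t) - spinorDot (f t) (G t)) x y := by
  obtain ⟨f0, f1⟩ := hf.hasACDeriv hS hx hy
  obtain ⟨g0, g1⟩ := hg.hasACDeriv hS hx hy
  refine ((f0.mul g1).sub (f1.mul g0)).congr_deriv fun t _ => ?_
  simp only [rhs0, rhs1, spinorDot]
  push_cast
  ring

theorem IsSolution.wronskian {z z' : ℂ} {f g : ℝ → Spinor}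
    (hf : T.IsSolution z f) (hg : T.IsSolution z' g) {x y : ℝ} (hx : x ∈ T.I) (hy : y ∈ T.I) :
    HasACDeriv (wronskian f g) (fun t => (z - z') * spinorDot (f t) (g t)) x y := by
  refine ((isSolution_iff.1 hf).wronskian ordConnected_I (isSolution_iff.1 hg) hx hy).congr_deriv
    fun t _ => ?_
  simp only [spinorDot, PiLp.smul_apply, smul_eq_mul]
  ring

theorem IsSolOn.wronskian_eq_of_eq {S : Set ℝ} (hS : S.OrdConnected) {f g : ℝ → Spinor} {z : ℂ}
    (hf : T.IsSolOn S (fun t => z • f t) f) (hg : T.IsSolOn S (fun t => z • g t) g)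
    {x y : ℝ} (hx : x ∈ S) (hy : y ∈ S) : _root_.wronskian f g x = _root_.wronskian f g y := by
  have := (hf.wronskian hS hg hx hy).integral_eq
  have h0 : ∀ t, spinorDot (z • f t) (g t) - spinorDot (f t) (z • g t) = 0 := fun t => by
    simp only [spinorDot, PiLp.smul_apply, smul_eq_mul]; ring
  simp only [h0, intervalIntegral.integral_zero] at this
  exact (sub_eq_zero.1 this.symm).symm

theorem IsSolution.wronskian_eq {z : ℂ} {f g : ℝ → Spinor}
    (hf : T.IsSolution z f) (hg : T.IsSolution z g) {x y : ℝ} (hx : x ∈ T.I) (hy : y ∈ T.I) :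
    _root_.wronskian f g x = _root_.wronskian f g y :=
  (isSolution_iff.1 hf).wronskian_eq_of_eq ordConnected_I (isSolution_iff.1 hg) hx hy

theorem continuousOn_of_acLoc {S : Set ℝ} (hS : IsOpen S) {u : ℝ → Spinor} (h : ACLoc S u) :
    ContinuousOn u S := by
  intro t ht
  obtain ⟨ε, hε, hb⟩ := Metric.isOpen_iff.1 hS t ht
  have hI : Set.uIcc (t - ε / 2) (t + ε / 2) ⊆ S := by
    rw [Set.uIcc_of_le (by linarith)]
    intro s hs
    refine hb ?_
    rw [Metric.mem_ball, Real.dist_eq, abs_lt]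
    constructor <;> linarith [hs.1, hs.2]
  have h1 := (h _ (hI Set.left_mem_uIcc) _ (hI Set.right_mem_uIcc)).continuousOn
  refine (h1.continuousAt ?_).continuousWithinAt
  rw [Set.uIcc_of_le (by linarith)]
  exact Icc_mem_nhds (by linarith) (by linarith)

theorem IsSolution.continuousOn {z : ℂ} {u : ℝ → Spinor} (h : T.IsSolution z u) :
    ContinuousOn u T.I := continuousOn_of_acLoc isOpen_I h.1

theorem IsSolution.linear {z : ℂ} {u v : ℝ → Spinor} (hu : T.IsSolution z u)
    (hv : T.IsSolution z v) (α β : ℂ) : T.IsSolution z (fun t => α • u t + β • v t) := by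
  rw [isSolution_iff] at *
  refine IsSolOn.of_hasACDeriv fun x hx y hy => ?_
  obtain ⟨f0, f1⟩ := hu.hasACDeriv ordConnected_I hx hy
  obtain ⟨g0, g1⟩ := hv.hasACDeriv ordConnected_I hx hy
  refine ⟨((f0.const_mul α).add (g0.const_mul β)).congr_deriv fun t _ => ?_,
    ((f1.const_mul α).add (g1.const_mul β)).congr_deriv fun t _ => ?_⟩ <;>
  simp only [rhs0, rhs1, PiLp.smul_apply, PiLp.add_apply, smul_eq_mul] <;> ring

theorem IsSolOn.conj {F u : ℝ → Spinor} (hu : T.IsSolOn T.I F u) :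
    T.IsSolOn T.I (fun t => (F t).conj) (fun t => (u t).conj) := by
  refine IsSolOn.of_hasACDeriv fun x hx y hy => ?_
  obtain ⟨f0, f1⟩ := hu.hasACDeriv ordConnected_I hx hy
  refine ⟨f0.conj.congr_deriv fun t _ => ?_, f1.conj.congr_deriv fun t _ => ?_⟩ <;>
  simp [rhs0, rhs1]

theorem IsSolution.conj {z : ℂ} {u : ℝ → Spinor} (hu : T.IsSolution z u) :
    T.IsSolution ((starRingEnd ℂ) z) (fun t => (u t).conj) := by
  rw [isSolution_iff] at *
  convert hu.conj using 2
  exact Spinor.ext' (by simp) (by simp)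

theorem IsSolution.congr {z : ℂ} {u v : ℝ → Spinor} (hu : T.IsSolution z u)
    (h : ∀ x ∈ T.I, u x = v x) : T.IsSolution z v := by
  rw [isSolution_iff] at *
  refine IsSolOn.of_hasACDeriv fun x hx y hy => ?_
  obtain ⟨f0, f1⟩ := hu.hasACDeriv ordConnected_I hx hy
  have hs := uIcc_subset_I hx hy
  refine ⟨(f0.congr fun t ht => by rw [h t (hs ht)]).congr_deriv fun t ht => ?_,
    (f1.congr fun t ht => by rw [h t (hs ht)]).congr_deriv fun t ht => ?_⟩ <;>
  simp only [rhs0, rhs1, h t (hs ht)]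

end DiracExpr

/-! ### Wronskian identities -/

/-- Plücker relation in dimension two. It turns boundary conditions of f and g relative to w into
one for the pair f, g. -/
theorem wronskian_plucker (f g w s : ℝ → Spinor) (x : ℝ) :
    wronskian f g x * wronskian w s x =
      wronskian w g x * wronskian f s x - wronskian w f x * wronskian g s x := by
  simp only [wronskian]; ring

/-- Cramer's rule in ℂ². It expands a solution in two others and bounds it once the Wronskians are
bounded. -/
theorem wronskian_smul_eq (f g v : ℝ → Spinor) (x : ℝ) :
    wronskian f g x • v x = wronskian v g x • f x + wronskian f v x • g x := by
  refine Spinor.ext' ?_ ?_ <;>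
  simp only [wronskian, PiLp.smul_apply, PiLp.add_apply, smul_eq_mul] <;> ring

theorem wronskian_self (f : ℝ → Spinor) (x : ℝ) : wronskian f f x = 0 := by
  simp only [wronskian]; ring

theorem wronskian_comm (f g : ℝ → Spinor) (x : ℝ) : wronskian f g x = - wronskian g f x := by
  simp only [wronskian]; ring

/-- Grönwall's inequality on a short interval: at a maximum point of N the integral is at most half
the maximum and is absorbed. -/
theorem le_two_mul_of_le_add_integral {N k : ℝ → ℝ} {c x N₀ : ℝ}
    (hN : ContinuousOn N (Set.uIcc c x)) (hN0 : ∀ t ∈ Set.uIcc c x, 0 ≤ N t)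
    (hk : IntegrableOn k (Set.uIoc c x)) (hk0 : ∀ t, 0 ≤ k t)
    (hk1 : ∫ t in Set.uIoc c x, k t ≤ 1 / 2)
    (h : ∀ t ∈ Set.uIcc c x, N t ≤ N₀ + ∫ s in Set.uIoc c t, k s * N s) :
    ∀ t ∈ Set.uIcc c x, N t ≤ 2 * N₀ := by
  obtain ⟨ξ, hξ, hmax⟩ := isCompact_uIcc.exists_isMaxOn Set.nonempty_uIcc hN
  have hsub : Set.uIoc c ξ ⊆ Set.uIoc c x := Set.uIoc_subset_uIoc_of_uIcc_subset_uIcc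
    (Set.uIcc_subset_uIcc_left hξ)
  have h1 : ∫ s in Set.uIoc c ξ, k s * N s ≤ ∫ s in Set.uIoc c x, k s * N ξ := by
    calc _ ≤ ∫ s in Set.uIoc c ξ, k s * N ξ := by
          refine integral_mono_of_nonneg ?_ ((hk.mono_set hsub).mul_const _) ?_
          · refine (ae_restrict_iff' measurableSet_uIoc).2 (Eventually.of_forall fun s hs => ?_)
            exact mul_nonneg (hk0 s) (hN0 s (Set.uIoc_subset_uIcc (hsub hs)))
          · refine (ae_restrict_iff' measurableSet_uIoc).2 (Eventually.of_forall fun s hs => ?_)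
            exact mul_le_mul_of_nonneg_left (hmax (Set.uIoc_subset_uIcc (hsub hs))) (hk0 s)
      _ ≤ _ := by
          refine setIntegral_mono_set (hk.mul_const _) ?_ hsub.eventuallyLE
          exact Eventually.of_forall fun s => mul_nonneg (hk0 s) (hN0 ξ hξ)
  rw [integral_mul_const] at h1
  have h2 : (∫ t in Set.uIoc c x, k t) * N ξ ≤ 1 / 2 * N ξ :=
    mul_le_mul_of_nonneg_right hk1 (hN0 ξ hξ)
  have h3 := h ξ hξ
  intro t ht
  have := hmax ht
  simp only [Set.mem_ofPred_eq] at this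
  linarith

theorem HasACDeriv.norm_sub_le {f f' : ℝ → ℂ} {c x : ℝ} (h : HasACDeriv f f' c x) :
    ‖f x‖ ≤ ‖f c‖ + ∫ s in Set.uIoc c x, ‖f' s‖ := by
  have h1 : f x = f c + ∫ s in c..x, f' s := by rw [h.integral_eq]; ring
  rw [h1]
  exact (norm_add_le _ _).trans
    (add_le_add le_rfl intervalIntegral.norm_integral_le_integral_norm_uIoc)

/-! ### Endpoints, square integrability near them, and a criterion for the limit circle case -/

namespace DiracExpr

variable {T : DiracExpr}

/-- The common properties of the two endpoints of `I`: `S c` is the part of the interval between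
`c` and the endpoint, and `l` is the filter of punctured neighbourhoods of the endpoint. -/
structure IsEnd (T : DiracExpr) (S : ℝ → Set ℝ) (l : Filter ℝ) : Prop where
  neBot : l.NeBot
  cg : l.IsCountablyGenerated
  mem : ∀ c ∈ T.I, S c ∈ l
  meas : ∀ c, MeasurableSet (S c)
  sub : ∀ c ∈ T.I, S c ⊆ T.I
  seg : ∀ c x, x ∈ S c → Set.uIoc c x ⊆ insert c (S c)
  between : ∀ c x t, t ∈ S c → x ∈ S t → t ∈ Set.uIoc c x
  mono : ∀ c x, x ∈ S c → S x ⊆ S c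
  nested : ∀ c x x', x ∈ S c → x' ∈ S x → Set.uIoc c x ⊆ Set.uIoc c x'
  cover : ∀ c ∈ T.I, ∀ d ∈ T.I, S d ⊆ S c ∪ Set.uIcc c d
  basis : ∀ c ∈ T.I, ∀ s ∈ l, ∃ d ∈ S c, S d ⊆ s
  sign : ∃ ε : ℝ, ∀ c x, x ∈ S c → ∀ k : ℝ → ℂ,
    ∫ t in c..x, k t = (ε : ℂ) * ∫ t in Set.uIoc c x, k t

theorem isEnd_left (hab : T.a < T.b) : T.IsEnd T.leftPart T.nearA where
  neBot := by
    refine comap_neBot fun s hs => ?_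
    obtain ⟨u, hu, hs⟩ := (mem_nhdsGT_iff_exists_Ioo_subset' hab).1 hs
    obtain ⟨r, h1, h2⟩ := EReal.lt_iff_exists_real_btwn.1 hu
    exact ⟨r, hs ⟨h1, h2⟩⟩
  cg := by unfold nearA; infer_instance
  mem := fun c hc => by
    refine mem_of_superset (preimage_mem_comap (Ioo_mem_nhdsGT hc.1)) fun x hx => ?_
    exact ⟨hx.1, EReal.coe_lt_coe_iff.1 hx.2⟩
  meas := fun c => (measurableSet_lt measurable_const measurable_coe_real_ereal).inter
    measurableSet_Iio
  sub := fun c hc x hx => ⟨hx.1, (EReal.coe_lt_coe_iff.2 hx.2).trans hc.2⟩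
  seg := fun c x hx t ht => by
    rw [Set.uIoc_of_ge hx.2.le] at ht
    rcases ht.2.eq_or_lt with h | h
    · exact Or.inl h
    · exact Or.inr ⟨hx.1.trans (EReal.coe_lt_coe_iff.2 ht.1), h⟩
  between := fun c x t ht hx => by
    rw [Set.uIoc_of_ge (hx.2.trans ht.2).le]
    exact ⟨hx.2, ht.2.le⟩
  mono := fun c x hx t ht => ⟨ht.1, ht.2.trans hx.2⟩
  nested := fun c x x' hx hx' => by
    rw [Set.uIoc_of_ge hx.2.le, Set.uIoc_of_ge (hx'.2.trans hx.2).le]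
    exact Set.Ioc_subset_Ioc_left hx'.2.le
  cover := fun c hc d hd t ht => by
    by_cases h : t < c
    · exact Or.inl ⟨ht.1, h⟩
    · exact Or.inr (Set.mem_uIcc.2 (Or.inl ⟨not_lt.1 h, ht.2.le⟩))
  basis := fun c hc s hs => by
    obtain ⟨t, ht, hts⟩ := mem_comap.1 hs
    obtain ⟨u, hu, ht⟩ := (mem_nhdsGT_iff_exists_Ioo_subset' hab).1 ht
    obtain ⟨r, h1, h2⟩ := EReal.lt_iff_exists_real_btwn.1 (lt_min (Set.mem_Ioi.1 hu) hc.1)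
    refine ⟨r, ⟨h1, EReal.coe_lt_coe_iff.1 (h2.trans_le (min_le_right _ _))⟩, fun x hx => ?_⟩
    exact hts (ht ⟨hx.1, (EReal.coe_lt_coe_iff.2 hx.2).trans (h2.trans_le (min_le_left _ _))⟩)
  sign := ⟨-1, fun c x hx k => by
    rw [intervalIntegral.integral_of_ge hx.2.le, Set.uIoc_of_ge hx.2.le]; simp⟩

theorem isEnd_right (hab : T.a < T.b) : T.IsEnd T.rightPart T.nearB where
  neBot := by
    refine comap_neBot fun s hs => ?_
    obtain ⟨u, hu, hs⟩ := (mem_nhdsLT_iff_exists_Ioo_subset' hab).1 hs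
    obtain ⟨r, h1, h2⟩ := EReal.lt_iff_exists_real_btwn.1 hu
    exact ⟨r, hs ⟨h1, h2⟩⟩
  cg := by unfold nearB; infer_instance
  mem := fun c hc => by
    refine mem_of_superset (preimage_mem_comap (Ioo_mem_nhdsLT hc.2)) fun x hx => ?_
    exact ⟨EReal.coe_lt_coe_iff.1 hx.1, hx.2⟩
  meas := fun c => measurableSet_Ioi.inter
    (measurableSet_lt measurable_coe_real_ereal measurable_const)
  sub := fun c hc x hx => ⟨hc.1.trans (EReal.coe_lt_coe_iff.2 hx.1), hx.2⟩
  seg := fun c x hx t ht => by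
    rw [Set.uIoc_of_le hx.1.le] at ht
    exact Or.inr ⟨ht.1, (EReal.coe_le_coe_iff.2 ht.2).trans_lt hx.2⟩
  between := fun c x t ht hx => by
    rw [Set.uIoc_of_le (ht.1.trans hx.1).le]
    exact ⟨ht.1, hx.1.le⟩
  mono := fun c x hx t ht => ⟨hx.1.trans ht.1, ht.2⟩
  nested := fun c x x' hx hx' => by
    rw [Set.uIoc_of_le hx.1.le, Set.uIoc_of_le (hx.1.trans hx'.1).le]
    exact Set.Ioc_subset_Ioc_right hx'.1.le
  cover := fun c hc d hd t ht => by
    by_cases h : c < t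
    · exact Or.inl ⟨h, ht.2⟩
    · exact Or.inr (Set.mem_uIcc.2 (Or.inr ⟨ht.1.le, not_lt.1 h⟩))
  basis := fun c hc s hs => by
    obtain ⟨t, ht, hts⟩ := mem_comap.1 hs
    obtain ⟨u, hu, ht⟩ := (mem_nhdsLT_iff_exists_Ioo_subset' hab).1 ht
    obtain ⟨r, h1, h2⟩ := EReal.lt_iff_exists_real_btwn.1 (max_lt (Set.mem_Iio.1 hu) hc.2)
    refine ⟨r, ⟨EReal.coe_lt_coe_iff.1 ((le_max_right _ _).trans_lt h1), h2⟩, fun x hx => ?_⟩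
    exact hts (ht ⟨((le_max_left _ _).trans_lt h1).trans (EReal.coe_lt_coe_iff.2 hx.1), hx.2⟩)
  sign := ⟨1, fun c x hx k => by
    rw [intervalIntegral.integral_of_le hx.1.le, Set.uIoc_of_le hx.1.le]; simp⟩

theorem memLp_iff {u : ℝ → Spinor} (hu : ContinuousOn u T.I) {S : Set ℝ} (hS : S ⊆ T.I)
    (hm : MeasurableSet S) :
    MemLp u 2 (volume.restrict S) ↔ IntegrableOn (fun t => ‖u t‖ ^ 2) S :=
  memLp_two_iff_integrable_sq_norm ((hu.mono hS).aestronglyMeasurable hm)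

theorem integrableOn_mul_norm {S : Set ℝ} {u v : ℝ → Spinor}
    (hu : MemLp u 2 (volume.restrict S)) (hv : MemLp v 2 (volume.restrict S)) :
    IntegrableOn (fun t => ‖u t‖ * ‖v t‖) S := hu.norm.integrable_mul hv.norm

theorem aestronglyMeasurable_spinor_apply {μ : Measure ℝ} {u : ℝ → Spinor}
    (hu : AEStronglyMeasurable u μ) (i : Fin 2) : AEStronglyMeasurable (fun t => u t i) μ :=
  (PiLp.continuous_apply 2 (fun _ : Fin 2 => ℂ) i).comp_aestronglyMeasurable hu

theorem aestronglyMeasurable_spinorDot {μ : Measure ℝ} {u v : ℝ → Spinor}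
    (hu : AEStronglyMeasurable u μ) (hv : AEStronglyMeasurable v μ) :
    AEStronglyMeasurable (fun t => spinorDot (u t) (v t)) μ :=
  ((aestronglyMeasurable_spinor_apply hu 0).mul (aestronglyMeasurable_spinor_apply hv 0)).add
    ((aestronglyMeasurable_spinor_apply hu 1).mul (aestronglyMeasurable_spinor_apply hv 1))

theorem integrableOn_spinorDot {S : Set ℝ} {u v : ℝ → Spinor}
    (hu : MemLp u 2 (volume.restrict S)) (hv : MemLp v 2 (volume.restrict S)) :
    IntegrableOn (fun t => spinorDot (u t) (v t)) S :=
  (integrableOn_mul_norm hu hv).mono'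
    (aestronglyMeasurable_spinorDot hu.aestronglyMeasurable hv.aestronglyMeasurable)
    (Eventually.of_forall fun _ => norm_spinorDot_le _ _)

theorem memLp_uIcc {u : ℝ → Spinor} (hu : ContinuousOn u T.I) {x y : ℝ} (hx : x ∈ T.I)
    (hy : y ∈ T.I) : MemLp u 2 (volume.restrict (Set.uIcc x y)) := by
  have hs := uIcc_subset_I hx hy
  rw [memLp_iff hu hs measurableSet_uIcc]
  exact ((hu.mono hs).norm.pow 2).integrableOn_compact isCompact_uIcc

/-- `u` is square integrable near the endpoint described by `S`. -/
def L2NearEnd (T : DiracExpr) (S : ℝ → Set ℝ) (u : ℝ → Spinor) : Prop :=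
  ∃ c ∈ T.I, MemLp u 2 (volume.restrict (S c))

namespace IsEnd

variable {S : ℝ → Set ℝ} {l : Filter ℝ}

theorem mem_I (h : T.IsEnd S l) {c : ℝ} (hc : c ∈ T.I) : ∀ᶠ x in l, x ∈ T.I :=
  mem_of_superset (h.mem c hc) (h.sub c hc)

theorem aecover (h : T.IsEnd S l) {c : ℝ} (hc : c ∈ T.I) :
    AECover (volume.restrict (S c)) l (fun x => Set.uIoc c x) where
  ae_eventually_mem := (ae_restrict_iff' (h.meas c)).2 <| Eventually.of_forall fun t ht =>
    mem_of_superset (h.mem t (h.sub c hc ht)) fun x hx => h.between c x t ht hx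
  measurableSet := fun _ => measurableSet_uIoc

theorem integrableOn_uIoc (h : T.IsEnd S l) {c x : ℝ} (hx : x ∈ S c) {E : Type*}
    [NormedAddCommGroup E] {k : ℝ → E} (hk : IntegrableOn k (S c)) :
    IntegrableOn k (Set.uIoc c x) :=
  ((integrableOn_congr_set_ae (insert_ae_eq_self c (S c))).2 hk).mono_set (h.seg c x hx)

theorem restrict_uIoc (h : T.IsEnd S l) {c x : ℝ} (hx : x ∈ S c) :
    (volume.restrict (S c)).restrict (Set.uIoc c x) = volume.restrict (Set.uIoc c x) := by
  rw [Measure.restrict_restrict measurableSet_uIoc]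
  refine Measure.restrict_congr_set ?_
  have h1 : (Set.uIoc c x ∩ S c : Set ℝ) =ᵐ[volume] (Set.uIoc c x ∩ insert c (S c) : Set ℝ) :=
    (ae_eq_refl _).inter (insert_ae_eq_self c (S c)).symm
  rwa [Set.inter_eq_left.2 (h.seg c x hx)] at h1

theorem integral_uIoc_le (h : T.IsEnd S l) {c x : ℝ} (hx : x ∈ S c) {k : ℝ → ℝ}
    (hk : IntegrableOn k (S c)) (hk0 : ∀ t, 0 ≤ k t) :
    ∫ t in Set.uIoc c x, k t ≤ ∫ t in S c, k t := by
  rw [← h.restrict_uIoc hx]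
  exact integral_mono_measure Measure.restrict_le_self (Eventually.of_forall hk0) hk

theorem tendsto_integral (h : T.IsEnd S l) {c : ℝ} (hc : c ∈ T.I) {k : ℝ → ℂ}
    (hk : IntegrableOn k (S c)) : ∃ L, Tendsto (fun x => ∫ t in c..x, k t) l (𝓝 L) := by
  obtain ⟨ε, hε⟩ := h.sign
  have := h.cg
  have h1 := (h.aecover hc).integral_tendsto_of_countably_generated hk
  refine ⟨_, Tendsto.congr' ?_ (h1.const_mul (ε : ℂ))⟩
  filter_upwards [h.mem c hc] with x hx
  rw [hε c x hx k, h.restrict_uIoc hx]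

theorem integrableOn_of_bounded (h : T.IsEnd S l) {c M : ℝ} (hc : c ∈ T.I) {k : ℝ → ℝ}
    (hk : ContinuousOn k T.I) (hk0 : ∀ t, 0 ≤ k t)
    (hM : ∀ᶠ x in l, ∫ t in Set.uIoc c x, k t ≤ M) : IntegrableOn k (S c) := by
  classical
  have := h.cg
  have := h.neBot
  -- For x outside `S c` the segment may leave the interval, so the cover is set to ∅ there; such x
  -- do not matter in the limit.
  have hcov : AECover (volume.restrict (S c)) l
      (fun x => if x ∈ S c then Set.uIoc c x else ∅) :=
    ⟨by
      filter_upwards [(h.aecover hc).ae_eventually_mem] with t ht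
      filter_upwards [ht, h.mem c hc] with x hx hxS
      rwa [if_pos hxS], fun x => by split_ifs; exacts [measurableSet_uIoc, .empty]⟩
  refine hcov.integrable_of_integral_norm_bounded M (fun x => ?_) ?_
  · split_ifs with hx
    · rw [IntegrableOn, h.restrict_uIoc hx]
      exact ((hk.mono (uIcc_subset_I hc (h.sub c hc hx))).integrableOn_compact
        isCompact_uIcc).mono_set Set.uIoc_subset_uIcc
    · simp
  · filter_upwards [hM, h.mem c hc] with x hx hxS
    rw [if_pos hxS, h.restrict_uIoc hxS]
    simpa only [Real.norm_of_nonneg (hk0 _)] using hx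

/-- Dominated convergence: each fixed point of `S c` lies outside `S x` once x is close to the
endpoint. -/
theorem tail (h : T.IsEnd S l) {c : ℝ} (hc : c ∈ T.I) {k : ℝ → ℝ} (hk : IntegrableOn k (S c))
    {ε : ℝ} (hε : 0 < ε) : ∀ᶠ x in l, ∫ t in S x, k t < ε := by
  have := h.cg
  have h1 : Tendsto (fun x => ∫ t in S c, (S x).indicator k t) l (𝓝 (∫ t in S c, (0 : ℝ))) := by
    refine tendsto_integral_filter_of_dominated_convergence (fun t => ‖k t‖) ?_ ?_ hk.norm ?_
    · exact Eventually.of_forall fun x => hk.aestronglyMeasurable.indicator (h.meas x)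
    · exact Eventually.of_forall fun x => Eventually.of_forall fun t => norm_indicator_le_norm_self _ _
    · refine (ae_restrict_iff' (h.meas c)).2 (Eventually.of_forall fun t ht => ?_)
      refine tendsto_const_nhds.congr' ?_
      filter_upwards [h.mem t (h.sub c hc ht)] with x hx
      rw [Set.indicator_of_notMem]
      intro hx'
      simpa using h.between x x t hx' hx
  rw [integral_zero] at h1
  filter_upwards [h1.eventually (gt_mem_nhds hε), h.mem c hc] with x hx hxS
  rwa [setIntegral_indicator (h.meas x), Set.inter_eq_right.2 (h.mono c x hxS)] at hx

theorem memLp_of_memLp (h : T.IsEnd S l) {u : ℝ → Spinor} (hu : ContinuousOn u T.I) {c d : ℝ}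
    (hc : c ∈ T.I) (hd : d ∈ T.I) (hL : MemLp u 2 (volume.restrict (S c))) :
    MemLp u 2 (volume.restrict (S d)) := by
  rw [memLp_iff hu (h.sub _ ‹_›) (h.meas _)] at hL ⊢
  refine IntegrableOn.mono_set (hL.union ?_) (h.cover c hc d hd)
  rw [← memLp_iff hu (uIcc_subset_I hc hd) measurableSet_uIcc]
  exact memLp_uIcc hu hc hd

theorem memLp (h : T.IsEnd S l) {u : ℝ → Spinor} (hu : ContinuousOn u T.I)
    (hL : T.L2NearEnd S u) {d : ℝ} (hd : d ∈ T.I) : MemLp u 2 (volume.restrict (S d)) :=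
  have ⟨_, hc, hc'⟩ := hL
  h.memLp_of_memLp hu hc hd hc'

theorem memLp_of_bounded (h : T.IsEnd S l) {u : ℝ → Spinor} (hu : ContinuousOn u T.I)
    {c M : ℝ} (hc : c ∈ T.I) (hM : ∀ᶠ x in l, ∫ t in Set.uIoc c x, ‖u t‖ ^ 2 ≤ M) :
    MemLp u 2 (volume.restrict (S c)) := by
  rw [memLp_iff hu (h.sub c hc) (h.meas c)]
  exact h.integrableOn_of_bounded hc (hu.norm.pow 2) (fun _ => by positivity) hM

theorem memLp_of_norm_le (h : T.IsEnd S l) {u v w : ℝ → Spinor} (hw : ContinuousOn w T.I)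
    {c : ℝ} (hc : c ∈ T.I) (hu : MemLp u 2 (volume.restrict (S c)))
    (hv : MemLp v 2 (volume.restrict (S c))) {K : ℝ}
    (hle : ∀ t ∈ S c, ‖w t‖ ≤ K * (‖u t‖ + ‖v t‖)) : MemLp w 2 (volume.restrict (S c)) := by
  refine ((hu.norm.add hv.norm).const_mul K).mono'
    ((hw.mono (h.sub c hc)).aestronglyMeasurable (h.meas c)) ?_
  exact (ae_restrict_iff' (h.meas c)).2 (Eventually.of_forall hle)

theorem l2NearEnd_linear (h : T.IsEnd S l) {u v : ℝ → Spinor} (hv : ContinuousOn v T.I)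
    (hu' : T.L2NearEnd S u) (hv' : T.L2NearEnd S v) (α β : ℂ) :
    T.L2NearEnd S (fun t => α • u t + β • v t) := by
  obtain ⟨c, hc, hcu⟩ := hu'
  exact ⟨c, hc, (hcu.const_smul α).add ((h.memLp hv hv' hc).const_smul β)⟩

/-- The derivative (z - z') f·g of the Wronskian is integrable up to the endpoint. -/
theorem tendsto_wronskian (h : T.IsEnd S l) {z z' : ℂ} {f g : ℝ → Spinor}
    (hf : T.IsSolution z f) (hg : T.IsSolution z' g) (hf' : T.L2NearEnd S f)
    (hg' : T.L2NearEnd S g) : ∃ L, Tendsto (wronskian f g) l (𝓝 L) := by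
  obtain ⟨c, hc, hcf⟩ := hf'
  have hcg := h.memLp hg.continuousOn hg' hc
  obtain ⟨L, hL⟩ := h.tendsto_integral hc ((integrableOn_spinorDot hcf hcg).const_mul (z - z'))
  refine ⟨L + wronskian f g c, Tendsto.congr' ?_ (hL.add_const _)⟩
  filter_upwards [h.mem c hc] with x hx
  rw [(hf.wronskian hg hc (h.sub c hc hx)).integral_eq]
  ring

end IsEnd

/-- All solutions are square integrable near the endpoint described by `S`. -/
def LimitCircleEnd (T : DiracExpr) (S : ℝ → Set ℝ) : Prop :=
  ∀ (z : ℂ) (u : ℝ → Spinor), T.IsSolution z u → T.L2NearEnd S u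

/-- For every `z` there are two solutions with Wronskian one. -/
def HasSolutionPairs (T : DiracExpr) : Prop :=
  ∀ z : ℂ, ∃ θ φ : ℝ → Spinor, T.IsSolution z θ ∧ T.IsSolution z φ ∧
    ∀ x ∈ T.I, wronskian θ φ x = 1

theorem ContinuousOn.wronskian {f g : ℝ → Spinor} {s : Set ℝ} (hf : ContinuousOn f s)
    (hg : ContinuousOn g s) : ContinuousOn (_root_.wronskian f g) s := by
  have hi (i : Fin 2) {u : ℝ → Spinor} (hu : ContinuousOn u s) :
      ContinuousOn (fun t => u t i) s :=
    (PiLp.continuous_apply 2 (fun _ : Fin 2 => ℂ) i).comp_continuousOn hu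
  exact ((hi 0 hf).mul (hi 1 hg)).sub ((hi 1 hf).mul (hi 0 hg))

namespace IsEnd

variable {S : ℝ → Set ℝ} {l : Filter ℝ}

/-- Variation of constants with two spectral parameters. For a further solution v, W(f,g) v = W(v,g)
f + W(f,v) g, so N = |W(v,g)| + |W(f,v)| satisfies a Grönwall inequality with kernel a constant
times (|f| + |g|)², which is integrable. Hence N is bounded and |v| is at most a constant times |f|
+ |g|. -/
theorem limitCircleEnd (h : T.IsEnd S l) {z₁ z₂ : ℂ} {f g : ℝ → Spinor}
    (hf : T.IsSolution z₁ f) (hg : T.IsSolution z₂ g) (hf' : T.L2NearEnd S f)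
    (hg' : T.L2NearEnd S g) {δ : ℝ} (hδ : 0 < δ)
    (hW : ∀ᶠ x in l, δ ≤ ‖wronskian f g x‖) : T.LimitCircleEnd S := by
  intro z v hv
  have := h.neBot
  obtain ⟨c₀, hc₀, hcf⟩ := hf'
  have hcg := h.memLp hg.continuousOn hg' hc₀
  obtain ⟨c₁, hc₁, hWc⟩ : ∃ c₁ ∈ S c₀, ∀ x ∈ S c₁, δ ≤ ‖wronskian f g x‖ :=
    h.basis c₀ hc₀ _ hW
  set K : ℝ := (‖z - z₂‖ + ‖z₁ - z‖) / δ with hK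
  have hK0 : 0 ≤ K := by positivity
  set k : ℝ → ℝ := fun t => K * (‖f t‖ + ‖g t‖) ^ 2 with hk
  have hk0 : ∀ t, 0 ≤ k t := fun t => by positivity
  have hkint : IntegrableOn k (S c₀) := by
    refine Integrable.const_mul ?_ K
    have := (hcf.norm.add hcg.norm).integrable_sq
    simpa using this
  -- The point c is so close to the endpoint that the kernel has integral below 1/2 and the
  -- Wronskian of f and g is bounded below beyond c.
  obtain ⟨c, ⟨hct, hcS⟩, hcd⟩ := (((h.tail hc₀ hkint (ε := 1 / 2) (by norm_num)).and
    (h.mem c₀ hc₀)).and (h.mem c₁ (h.sub _ hc₀ hc₁))).exists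
  have hc : c ∈ T.I := h.sub _ hc₀ hcS
  set N : ℝ → ℝ := fun t => ‖wronskian v g t‖ + ‖wronskian f v t‖ with hN
  have hNc : ContinuousOn N T.I :=
    (ContinuousOn.wronskian hv.continuousOn hg.continuousOn).norm.add
      (ContinuousOn.wronskian hf.continuousOn hv.continuousOn).norm
  have hvle : ∀ t ∈ S c₁, ‖v t‖ ≤ N t / δ * (‖f t‖ + ‖g t‖) := by
    intro t ht
    have h1 := hWc t ht
    have h2 : ‖wronskian f g t‖ * ‖v t‖ ≤ N t * (‖f t‖ + ‖g t‖) := by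
      rw [← norm_smul, wronskian_smul_eq]
      refine (norm_add_le _ _).trans ?_
      rw [norm_smul, norm_smul]
      simp only [hN]
      nlinarith [norm_nonneg (f t), norm_nonneg (g t), norm_nonneg (wronskian v g t),
        norm_nonneg (wronskian f v t), mul_nonneg (norm_nonneg (f t)) (norm_nonneg (wronskian f v t)),
        mul_nonneg (norm_nonneg (g t)) (norm_nonneg (wronskian v g t))]
    rw [div_mul_eq_mul_div, le_div_iff₀ hδ]
    nlinarith [norm_nonneg (v t)]
  have hScc₁ : insert c (S c) ⊆ S c₁ := Set.insert_subset hcd (h.mono _ _ hcd)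
  have hb : ∀ x ∈ S c, N x ≤ 2 * N c := by
    intro x hx
    have hxI := h.sub c hc hx
    have hsubI := uIcc_subset_I hc hxI
    refine le_two_mul_of_le_add_integral (k := k) (hNc.mono hsubI)
      (fun t _ => by positivity) ?_ hk0 ?_ ?_ x Set.right_mem_uIcc
    · exact h.integrableOn_uIoc hx (hkint.mono_set (h.mono _ _ hcS))
    · exact (h.integral_uIoc_le hx (hkint.mono_set (h.mono _ _ hcS)) hk0).trans hct.le
    · intro t ht
      have htI := hsubI ht
      have a1 := hv.wronskian hg hc htI
      have a2 := hf.wronskian hv hc htI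
      have b1 := a1.norm_sub_le
      have b2 := a2.norm_sub_le
      have hseg : Set.uIoc c t ⊆ S c₁ := by
        refine (Set.uIoc_subset_uIoc_of_uIcc_subset_uIcc (Set.uIcc_subset_uIcc_left ht)).trans ?_
        exact (h.seg c x hx).trans hScc₁
      have i1 : IntegrableOn (fun s => ‖(z - z₂) * spinorDot (v s) (g s)‖) (Set.uIoc c t) :=
        (intervalIntegrable_iff.1 a1.intervalIntegrable).norm
      have i2 : IntegrableOn (fun s => ‖(z₁ - z) * spinorDot (f s) (v s)‖) (Set.uIoc c t) :=
        (intervalIntegrable_iff.1 a2.intervalIntegrable).norm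
      have i3 : IntegrableOn (fun s => k s * N s) (Set.uIoc c t) := by
        refine IntegrableOn.mono_set (ContinuousOn.integrableOn_compact isCompact_uIcc ?_)
          Set.uIoc_subset_uIcc
        refine ContinuousOn.mul ?_ hNc |>.mono (uIcc_subset_I hc htI)
        exact continuousOn_const.mul ((hf.continuousOn.norm.add hg.continuousOn.norm).pow 2)
      have hle : (∫ s in Set.uIoc c t, ‖(z - z₂) * spinorDot (v s) (g s)‖) +
          ∫ s in Set.uIoc c t, ‖(z₁ - z) * spinorDot (f s) (v s)‖ ≤
          ∫ s in Set.uIoc c t, k s * N s := by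
        rw [← integral_add i1 i2]
        refine setIntegral_mono_on (i1.add i2) i3 measurableSet_uIoc fun s hs => ?_
        have hs1 := hvle s (hseg hs)
        have e1 := norm_spinorDot_le (v s) (g s)
        have e2 := norm_spinorDot_le (f s) (v s)
        rw [norm_mul, norm_mul]
        have hN0 : 0 ≤ N s := by positivity
        calc _ ≤ ‖z - z₂‖ * (‖v s‖ * (‖f s‖ + ‖g s‖)) + ‖z₁ - z‖ * (‖v s‖ * (‖f s‖ + ‖g s‖)) := by
              gcongr
              · refine e1.trans ?_
                nlinarith [norm_nonneg (f s), norm_nonneg (v s)]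
              · refine e2.trans ?_
                nlinarith [norm_nonneg (g s), norm_nonneg (v s)]
          _ = (‖z - z₂‖ + ‖z₁ - z‖) * (‖f s‖ + ‖g s‖) * ‖v s‖ := by ring
          _ ≤ (‖z - z₂‖ + ‖z₁ - z‖) * (‖f s‖ + ‖g s‖) * (N s / δ * (‖f s‖ + ‖g s‖)) := by gcongr
          _ = k s * N s := by simp only [hk, hK]; ring
      simp only [hN] at *
      linarith
  refine ⟨c, hc, h.memLp_of_norm_le hv.continuousOn hc (K := 2 * N c / δ)
    (h.memLp_of_memLp hf.continuousOn hc₀ hc hcf) (h.memLp_of_memLp hg.continuousOn hc₀ hc hcg)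
    fun t ht => ?_⟩
  refine (hvle t (hScc₁ (Or.inr ht))).trans ?_
  have := hb t ht
  gcongr

end IsEnd

end DiracExpr

/-! ### Boundary Wronskians and uniqueness of the Weyl value -/

namespace DiracExpr

variable {T : DiracExpr}

namespace IsEnd

variable {S : ℝ → Set ℝ} {l : Filter ℝ}

/-- The boundary Wronskian of two square integrable solutions vanishes in the limit point case. -/
theorem tendsto_wronskian_zero_of_not_limitCircle (h : T.IsEnd S l) (hlc : ¬ T.LimitCircleEnd S)
    {z z' : ℂ} {f g : ℝ → Spinor}
    (hf : T.IsSolution z f) (hg : T.IsSolution z' g) (hf' : T.L2NearEnd S f)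
    (hg' : T.L2NearEnd S g) : Tendsto (wronskian f g) l (𝓝 0) := by
  obtain ⟨L, hL⟩ := h.tendsto_wronskian hf hg hf' hg'
  by_cases h0 : L = 0
  · rwa [h0] at hL
  refine absurd (h.limitCircleEnd hf hg hf' hg' (δ := ‖L‖ / 2) (by positivity) ?_) hlc
  have : ‖L‖ / 2 < ‖L‖ := half_lt_self (norm_pos_iff.2 h0)
  exact (hL.norm.eventually (lt_mem_nhds this)).mono fun _ h => h.le

/-- In the limit circle case the boundary Wronskian of two functions satisfying the same boundary
condition vanishes. -/
theorem tendsto_wronskian_zero_of_limitCircle (h : T.IsEnd S l) (hlc : T.LimitCircleEnd S)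
    (hT : T.HasSolutionPairs) {w : ℝ → Spinor} (hw : T.IsRealNontrivialSolution w)
    {z z' : ℂ} {f g : ℝ → Spinor} (hf : T.IsSolution z f) (hg : T.IsSolution z' g)
    (hfw : Tendsto (wronskian w f) l (𝓝 0)) (hgw : Tendsto (wronskian w g) l (𝓝 0)) :
    Tendsto (wronskian f g) l (𝓝 0) := by
  obtain ⟨⟨μ, hμ⟩, ⟨x₀, hx₀, hne⟩, -⟩ := hw
  -- A solution independent of w: if both members of the pair had zero Wronskian with w, Cramer's
  -- rule would give w(x₀) = 0.
  obtain ⟨s, hs, hs0⟩ : ∃ s, T.IsSolution (μ : ℂ) s ∧ wronskian w s x₀ ≠ 0 := by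
    obtain ⟨θ, φ, hθ, hφ, hW⟩ := hT μ
    by_contra! hcon
    refine hne ?_
    have := wronskian_smul_eq θ φ w x₀
    rwa [hW x₀ hx₀, hcon φ hφ, wronskian_comm, hcon θ hθ, neg_zero, zero_smul, zero_smul,
      add_zero, one_smul] at this
  obtain ⟨L₁, h₁⟩ := h.tendsto_wronskian hf hs (hlc z f hf) (hlc _ s hs)
  obtain ⟨L₂, h₂⟩ := h.tendsto_wronskian hg hs (hlc z' g hg) (hlc _ s hs)
  -- Plücker relation for f, g, w, s, divided by the constant W(w,s). The Wronskians with s only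
  -- need to converge.
  have key := (((hgw.mul h₁).sub (hfw.mul h₂)).div_const (wronskian w s x₀))
  simp only [zero_mul, sub_zero, zero_div] at key
  refine key.congr' ?_
  filter_upwards [h.mem_I hx₀] with x hx
  rw [hμ.wronskian_eq hs hx₀ hx] at hs0 ⊢
  rw [← wronskian_plucker, mul_div_cancel_right₀ _ hs0]

theorem tendsto_wronskian_zero (h : T.IsEnd S l) (hT : T.HasSolutionPairs) {w : ℝ → Spinor}
    (hw : T.LimitCircleEnd S → T.IsRealNontrivialSolution w)
    {z z' : ℂ} {f g : ℝ → Spinor} (hf : T.IsSolution z f) (hg : T.IsSolution z' g)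
    (hf' : T.L2NearEnd S f) (hg' : T.L2NearEnd S g)
    (hfw : Tendsto (wronskian w f) l (𝓝 0)) (hgw : Tendsto (wronskian w g) l (𝓝 0)) :
    Tendsto (wronskian f g) l (𝓝 0) := by
  by_cases hlc : T.LimitCircleEnd S
  · exact h.tendsto_wronskian_zero_of_limitCircle hlc hT (hw hlc) hf hg hfw hgw
  · exact h.tendsto_wronskian_zero_of_not_limitCircle hlc hf hg hf' hg'

end IsEnd

theorem L2NearEnd.congr_ae {S : ℝ → Set ℝ} {u v : ℝ → Spinor} (hS : ∀ c ∈ T.I, S c ⊆ T.I)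
    (hm : ∀ c, MeasurableSet (S c)) (h : T.L2NearEnd S u)
    (huv : ∀ᵐ t, t ∈ T.I → u t = v t) : T.L2NearEnd S v := by
  obtain ⟨c, hc, hu⟩ := h
  refine ⟨c, hc, hu.ae_eq ((ae_restrict_iff' (hm c)).2 ?_)⟩
  exact huv.mono fun t ht htc => ht (hS c hc htc)

theorem L2NearEnd.op {S : ℝ → Set ℝ} {l : Filter ℝ} (h : T.IsEnd S l) {z : ℂ} {u : ℝ → Spinor}
    (hu : T.IsSolution z u) (hL : T.L2NearEnd S u) : T.L2NearEnd S (T.op u) := by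
  have h1 : T.L2NearEnd S (fun t => z • u t) := by
    obtain ⟨c, hc, hc'⟩ := hL
    exact ⟨c, hc, hc'.const_smul z⟩
  exact h1.congr_ae h.sub h.meas ((isSolution_iff.1 hu).2.mono fun t ht htI => (ht htI).symm)

/-- Every solution is a linear combination of the two solutions of a fundamental pair. -/
theorem IsSolution.eq_combination {z : ℂ} {θ φ v : ℝ → Spinor} (hθ : T.IsSolution z θ)
    (hφ : T.IsSolution z φ) (hW : ∀ x ∈ T.I, _root_.wronskian θ φ x = 1) (hv : T.IsSolution z v)
    {x₀ : ℝ} (hx₀ : x₀ ∈ T.I) :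
    ∀ x ∈ T.I, v x = _root_.wronskian v φ x₀ • θ x + _root_.wronskian θ v x₀ • φ x := by
  intro x hx
  rw [hv.wronskian_eq hφ hx₀ hx, hθ.wronskian_eq hv hx₀ hx, ← wronskian_smul_eq, hW x hx,
    one_smul]

theorem nonempty_I (hab : T.a < T.b) : T.I.Nonempty := by
  obtain ⟨r, h1, h2⟩ := EReal.lt_iff_exists_real_btwn.1 hab
  exact ⟨r, h1, h2⟩

end DiracExpr

namespace DiracOperator

variable {H : DiracOperator} {Φ Θ : ℂ → ℝ → Spinor}

theorem IsFundamentalSystem.hasSolutionPairs (h : H.IsFundamentalSystem Φ Θ) :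
    H.HasSolutionPairs := fun z => ⟨Θ z, Φ z, h.2.1.1 z, h.1.1 z, h.2.2.1 z⟩

theorem inDomainNearA_of (hH : H.IsAdmissible) {z : ℂ} {u : ℝ → Spinor} (hu : H.IsSolution z u)
    (hL : H.L2NearA u) (hBC : H.BCA u) : H.InDomainNearA u :=
  ⟨hu.1, hL, DiracExpr.L2NearEnd.op (DiracExpr.isEnd_left hH.1) hu hL, hBC⟩

theorem inDomainNearB_of (hH : H.IsAdmissible) {z : ℂ} {u : ℝ → Spinor} (hu : H.IsSolution z u)
    (hL : H.L2NearB u) (hBC : H.BCB u) : H.InDomainNearB u :=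
  ⟨hu.1, hL, DiracExpr.L2NearEnd.op (DiracExpr.isEnd_right hH.1) hu hL, hBC⟩

theorem tendsto_wronskian_nearA (hH : H.IsAdmissible) (hT : H.HasSolutionPairs) {z z' : ℂ}
    {f g : ℝ → Spinor} (hf : H.IsSolution z f) (hg : H.IsSolution z' g)
    (hf' : H.InDomainNearA f) (hg' : H.InDomainNearA g) :
    Tendsto (wronskian f g) H.nearA (𝓝 0) :=
  (DiracExpr.isEnd_left hH.1).tendsto_wronskian_zero hT (w := H.wa) hH.2.2.2.2.2.1 hf hg
    hf'.2.1 hg'.2.1 hf'.2.2.2 hg'.2.2.2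

theorem tendsto_wronskian_nearB (hH : H.IsAdmissible) (hT : H.HasSolutionPairs) {z z' : ℂ}
    {f g : ℝ → Spinor} (hf : H.IsSolution z f) (hg : H.IsSolution z' g)
    (hf' : H.InDomainNearB f) (hg' : H.InDomainNearB g) :
    Tendsto (wronskian f g) H.nearB (𝓝 0) :=
  (DiracExpr.isEnd_right hH.1).tendsto_wronskian_zero hT (w := H.wb) hH.2.2.2.2.2.2.2.1 hf hg
    hf'.2.1 hg'.2.1 hf'.2.2.2 hg'.2.2.2

/-- Two Weyl solutions at `b` for the same `z` have vanishing Wronskian. -/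
theorem IsWeylSolutionB.wronskian_eq_zero (hH : H.IsAdmissible) (hT : H.HasSolutionPairs) {z : ℂ}
    {u v : ℝ → Spinor} (hu : H.IsSolution z u) (hu' : H.InDomainNearB u) (hv : H.IsSolution z v)
    (hv' : H.InDomainNearB v) {x : ℝ} (hx : x ∈ H.I) : wronskian u v x = 0 := by
  have h := DiracExpr.isEnd_right hH.1
  have := h.neBot
  refine tendsto_nhds_unique (Tendsto.congr' ?_ tendsto_const_nhds)
    (tendsto_wronskian_nearB hH hT hu hv hu' hv')
  filter_upwards [h.mem_I hx] with y hy using hu.wronskian_eq hv hx hy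

theorem IsWeylSolutionA.wronskian_eq_zero (hH : H.IsAdmissible) (hT : H.HasSolutionPairs) {z : ℂ}
    {u v : ℝ → Spinor} (hu : H.IsSolution z u) (hu' : H.InDomainNearA u) (hv : H.IsSolution z v)
    (hv' : H.InDomainNearA v) {x : ℝ} (hx : x ∈ H.I) : wronskian u v x = 0 := by
  have h := DiracExpr.isEnd_left hH.1
  have := h.neBot
  refine tendsto_nhds_unique (Tendsto.congr' ?_ tendsto_const_nhds)
    (tendsto_wronskian_nearA hH hT hu hv hu' hv')
  filter_upwards [h.mem_I hx] with y hy using hu.wronskian_eq hv hx hy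

theorem IsWeylValue.unique (hH : H.IsAdmissible) (hT : H.HasSolutionPairs) {z w w' : ℂ}
    (h : H.IsWeylValue Φ Θ z w) (h' : H.IsWeylValue Φ Θ z w') : w = w' := by
  obtain ⟨u, ⟨hu, -, hud⟩, hw⟩ := h
  obtain ⟨v, ⟨hv, -, hvd⟩, hw'⟩ := h'
  obtain ⟨x, hx⟩ := DiracExpr.nonempty_I hH.1
  obtain ⟨h1, e1⟩ := hw x hx
  obtain ⟨h2, e2⟩ := hw' x hx
  have h0 := IsWeylSolutionB.wronskian_eq_zero hH hT hu hud hv hvd hx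
  have hp : wronskian (Θ z) u x * wronskian (Φ z) v x
      = wronskian (Θ z) v x * wronskian (Φ z) u x := by
    have : wronskian (Θ z) u x * wronskian (Φ z) v x - wronskian (Θ z) v x * wronskian (Φ z) u x
        = - wronskian (Θ z) (Φ z) x * wronskian u v x * (-1) := by
      simp only [wronskian]; ring
    rw [h0, mul_zero, zero_mul] at this
    exact sub_eq_zero.1 this
  rw [e1, e2, neg_div, neg_div, (div_eq_div_iff h1 h2).2 hp]

theorem IsWeylValue.singularWeyl_eq (hH : H.IsAdmissible) (hT : H.HasSolutionPairs) {z w : ℂ}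
    (h : H.IsWeylValue Φ Θ z w) : H.singularWeyl Φ Θ z = w := by
  have hex : ∃ w, H.IsWeylValue Φ Θ z w := ⟨w, h⟩
  rw [singularWeyl, dif_pos hex]
  exact hex.choose_spec.unique hH hT h

end DiracOperator

/-! ### The function c_γ and the transformation of solutions -/

namespace DiracOperator

/-- The hypotheses on the function `u` which generates the double commutation. -/
structure IsSeed (H : DiracOperator) (lam : ℝ) (u : ℝ → Spinor) : Prop where
  lt : H.a < H.b
  sol : H.IsSolution (lam : ℂ) u
  real : ∀ x ∈ H.I, ∀ i, (starRingEnd ℂ) (u x i) = u x i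
  ne_zero : ∀ x ∈ H.I, u x ≠ 0
  l2 : H.L2NearB u

namespace IsSeed

variable {H : DiracOperator} {lam : ℝ} {u : ℝ → Spinor} {γ : ℝ≥0∞}

theorem memLp_right (h : H.IsSeed lam u) {x : ℝ} (hx : x ∈ H.I) :
    MemLp u 2 (volume.restrict (H.rightPart x)) :=
  (DiracExpr.isEnd_right h.lt).memLp h.sol.continuousOn h.l2 hx

theorem conj_eq (h : H.IsSeed lam u) {x : ℝ} (hx : x ∈ H.I) : (u x).conj = u x :=
  Spinor.ext' (h.real x hx 0) (h.real x hx 1)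

theorem spinorDot_self (h : H.IsSeed lam u) {x : ℝ} (hx : x ∈ H.I) :
    spinorDot (u x) (u x) = ((‖u x‖ ^ 2 : ℝ) : ℂ) := by
  rw [← spinorDot_conj_self, h.conj_eq hx]

theorem integrableOn_sq (h : H.IsSeed lam u) {x : ℝ} (hx : x ∈ H.I) :
    IntegrableOn (fun t => ‖u t‖ ^ 2) (H.rightPart x) :=
  (h.memLp_right hx).norm.integrable_sq

theorem integral_pos (h : H.IsSeed lam u) {x : ℝ} (hx : x ∈ H.I) :
    0 < ∫ t in H.rightPart x, ‖u t‖ ^ 2 := by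
  have hE := DiracExpr.isEnd_right h.lt
  have := hE.neBot
  obtain ⟨y, hy⟩ := (hE.mem x hx |> Filter.nonempty_of_mem)
  rw [setIntegral_pos_iff_support_of_nonneg_ae (Eventually.of_forall fun t => by positivity)
    (h.integrableOn_sq hx)]
  have hsub : Set.Ioo x y ⊆ (Function.support fun t => ‖u t‖ ^ 2) ∩ H.rightPart x := by
    intro t ht
    have htr : t ∈ H.rightPart x := ⟨ht.1, (EReal.coe_lt_coe_iff.2 ht.2).trans hy.2⟩
    refine ⟨?_, htr⟩
    have := h.ne_zero t (hE.sub x hx htr)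
    simpa using this
  refine lt_of_lt_of_le ?_ (measure_mono hsub)
  rw [Real.volume_Ioo, ENNReal.ofReal_pos]
  linarith [hy.1]

/-- The positive function `-c_γ`. -/
noncomputable def _root_.DiracOperator.rGamma (H : DiracOperator) (u : ℝ → Spinor) (γ : ℝ≥0∞)
    (x : ℝ) : ℝ := γ⁻¹.toReal + ∫ t in H.rightPart x, ‖u t‖ ^ 2

theorem cGamma_eq (h : H.IsSeed lam u) {x : ℝ} (hx : x ∈ H.I) :
    H.cGamma u γ x = ((-H.rGamma u γ x : ℝ) : ℂ) := by
  have hE := DiracExpr.isEnd_right h.lt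
  have h1 : ∫ y in H.rightPart x, (u y 0 ^ 2 + u y 1 ^ 2)
      = ((∫ t in H.rightPart x, ‖u t‖ ^ 2 : ℝ) : ℂ) := by
    rw [← integral_complex_ofReal]
    refine setIntegral_congr_fun (hE.meas x) fun t ht => ?_
    simp only
    rw [← h.spinorDot_self (hE.sub x hx ht), spinorDot]
    ring
  rw [cGamma, h1, rGamma]
  push_cast
  ring

theorem rGamma_pos (h : H.IsSeed lam u) {x : ℝ} (hx : x ∈ H.I) : 0 < H.rGamma u γ x :=
  add_pos_of_nonneg_of_pos ENNReal.toReal_nonneg (h.integral_pos hx)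

theorem cGamma_ne_zero (h : H.IsSeed lam u) {x : ℝ} (hx : x ∈ H.I) : H.cGamma u γ x ≠ 0 := by
  rw [h.cGamma_eq hx, Complex.ofReal_ne_zero]
  exact neg_ne_zero.2 (h.rGamma_pos hx).ne'

theorem rGamma_sub (h : H.IsSeed lam u) {x y : ℝ} (hx : x ∈ H.I) (hy : y ∈ H.I) (hxy : x ≤ y) :
    H.rGamma u γ x = H.rGamma u γ y + ∫ t in Set.Ioc x y, ‖u t‖ ^ 2 := by
  have hE := DiracExpr.isEnd_right h.lt
  have hun : H.rightPart x = Set.Ioc x y ∪ H.rightPart y := by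
    ext t
    constructor
    · intro ht
      by_cases hty : t ≤ y
      · exact Or.inl ⟨ht.1, hty⟩
      · exact Or.inr ⟨not_le.1 hty, ht.2⟩
    · rintro (ht | ht)
      · exact ⟨ht.1, (EReal.coe_le_coe_iff.2 ht.2).trans_lt hy.2⟩
      · exact ⟨hxy.trans_lt ht.1, ht.2⟩
  have hdis : Disjoint (Set.Ioc x y) (H.rightPart y) :=
    Set.disjoint_left.2 fun t ht ht' => absurd ht'.1 (not_lt.2 ht.2)
  have hi := h.integrableOn_sq hx
  rw [rGamma, rGamma, hun, setIntegral_union hdis (hE.meas y)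
    (hi.mono_set (hun ▸ Set.subset_union_left)) (h.integrableOn_sq hy)]
  ring

/-- The identity c' = u·u, from which all properties of the transformation are derived. -/
theorem hasACDeriv_cGamma (h : H.IsSeed lam u) {x y : ℝ} (hx : x ∈ H.I) (hy : y ∈ H.I) :
    HasACDeriv (H.cGamma u γ) (fun t => spinorDot (u t) (u t)) x y := by
  have key : ∀ x ∈ H.I, ∀ y ∈ H.I, x ≤ y →
      HasACDeriv (H.cGamma u γ) (fun t => spinorDot (u t) (u t)) x y := by
    intro x hx y hy hxy
    have hs := DiracExpr.uIcc_subset_I hx hy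
    refine HasACDeriv.of_integral ?_ fun t ht => ?_
    · rw [intervalIntegrable_iff]
      have := DiracExpr.memLp_uIcc h.sol.continuousOn hx hy
      exact (DiracExpr.integrableOn_spinorDot this this).mono_set Set.uIoc_subset_uIcc
    · have hxt : x ≤ t := by rw [Set.uIcc_of_le hxy] at ht; exact ht.1
      rw [h.cGamma_eq hx, h.cGamma_eq (hs ht), h.rGamma_sub hx (hs ht) hxt,
        intervalIntegral.integral_of_le hxt]
      have : ∫ s in Set.Ioc x t, spinorDot (u s) (u s)
          = ((∫ s in Set.Ioc x t, ‖u s‖ ^ 2 : ℝ) : ℂ) := by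
        rw [← integral_complex_ofReal]
        refine setIntegral_congr_fun measurableSet_Ioc fun s hs' => ?_
        exact h.spinorDot_self (hs (Set.uIcc_subset_uIcc_left ht
          (Set.Icc_subset_uIcc (Set.Ioc_subset_Icc_self hs'))))
      rw [this]
      push_cast
      ring
  rcases le_total x y with hxy | hxy
  · exact key x hx y hy hxy
  · exact (key y hy x hx hxy).symm

theorem uGamma_apply (H : DiracOperator) (u : ℝ → Spinor) (γ : ℝ≥0∞) (x : ℝ) (i : Fin 2) :
    H.uGamma u γ x i = (H.cGamma u γ x)⁻¹ * u x i := rfl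

theorem norm_uGamma (h : H.IsSeed lam u) {x : ℝ} (hx : x ∈ H.I) :
    ‖H.uGamma u γ x‖ = ‖u x‖ / H.rGamma u γ x := by
  rw [uGamma, norm_smul, norm_inv, h.cGamma_eq hx, Complex.norm_real, norm_neg,
    Real.norm_of_nonneg (h.rGamma_pos hx).le, inv_mul_eq_div]

theorem uGamma_real (h : H.IsSeed lam u) {x : ℝ} (hx : x ∈ H.I) (i : Fin 2) :
    (starRingEnd ℂ) (H.uGamma u γ x i) = H.uGamma u γ x i := by
  rw [uGamma_apply, map_mul, h.real x hx i, map_inv₀, h.cGamma_eq hx, Complex.conj_ofReal]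

theorem uGamma_ne_zero (h : H.IsSeed lam u) {x : ℝ} (hx : x ∈ H.I) : H.uGamma u γ x ≠ 0 :=
  smul_ne_zero (inv_ne_zero (h.cGamma_ne_zero hx)) (h.ne_zero x hx)

theorem qam_eq (h : H.IsSeed lam u) {x : ℝ} (hx : x ∈ H.I) :
    (((H.dcExpr u γ).qam x : ℝ) : ℂ) =
      H.qam x + (u x 0 ^ 2 - u x 1 ^ 2) / H.cGamma u γ x := by
  have : (starRingEnd ℂ) ((u x 0 ^ 2 - u x 1 ^ 2) / H.cGamma u γ x) =
      (u x 0 ^ 2 - u x 1 ^ 2) / H.cGamma u γ x := by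
    simp only [map_div₀, map_sub, map_pow, h.real x hx, h.cGamma_eq hx, Complex.conj_ofReal]
  rw [dcExpr, Complex.ofReal_add, Complex.conj_eq_iff_re.1 this]

theorem qsc_eq (h : H.IsSeed lam u) {x : ℝ} (hx : x ∈ H.I) :
    (((H.dcExpr u γ).qsc x : ℝ) : ℂ) =
      H.qsc x - 2 * (u x 0 * u x 1) / H.cGamma u γ x := by
  have : (starRingEnd ℂ) (2 * (u x 0 * u x 1) / H.cGamma u γ x) =
      2 * (u x 0 * u x 1) / H.cGamma u γ x := by
    simp only [map_div₀, map_mul, h.real x hx, h.cGamma_eq hx, Complex.conj_ofReal, map_ofNat]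
  rw [dcExpr, Complex.ofReal_sub, Complex.conj_eq_iff_re.1 this]

/-- The derivatives of W(u,v) and of 1/c produce exactly the terms that Q_γ contributes. The
condition on α and κ is the homogeneous form of κ = 1/(z-λ): α = 1 gives the usual transformation
for z ≠ λ, while κ = 1, α = z - λ also makes sense at z = λ and gives Φ_γ. -/
theorem isSolution_transform (h : H.IsSeed lam u) {z κ : ℂ} {α : ℂ} (hκ : κ * (z - lam) = α)
    {v : ℝ → Spinor} (hv : H.IsSolution z v) :
    (H.dcExpr u γ).IsSolution z
      (fun x => α • v x + κ • (wronskian u v x • H.uGamma u γ x)) := by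
  rw [DiracExpr.isSolution_iff]
  refine DiracExpr.IsSolOn.of_hasACDeriv fun x hx y hy => ?_
  replace hx : x ∈ H.I := hx
  replace hy : y ∈ H.I := hy
  have hs := DiracExpr.uIcc_subset_I hx hy
  obtain ⟨u0, u1⟩ := (DiracExpr.isSolution_iff.1 h.sol).hasACDeriv DiracExpr.ordConnected_I hx hy
  obtain ⟨v0, v1⟩ := (DiracExpr.isSolution_iff.1 hv).hasACDeriv DiracExpr.ordConnected_I hx hy
  have hW := h.sol.wronskian hv hx hy
  have hc := (h.hasACDeriv_cGamma (γ := γ) hx hy).inv fun t ht => h.cGamma_ne_zero (hs ht)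
  refine ⟨((v0.const_mul α).add ((hW.mul (hc.mul u0)).const_mul κ)).congr_deriv fun t ht => ?_,
    ((v1.const_mul α).add ((hW.mul (hc.mul u1)).const_mul κ)).congr_deriv fun t ht => ?_⟩
  all_goals
    have hct := h.cGamma_ne_zero (γ := γ) (hs ht)
    have e1 := h.qam_eq (γ := γ) (hs ht)
    have e2 := h.qsc_eq (γ := γ) (hs ht)
    simp only [DiracExpr.rhs0, DiracExpr.rhs1, PiLp.smul_apply, PiLp.add_apply, smul_eq_mul,
      uGamma_apply, Complex.ofReal_sub, Complex.ofReal_add, e1, e2]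
    simp only [dcExpr, spinorDot, ← hκ, wronskian]
    field_simp
    ring

theorem isSolution_uGamma (h : H.IsSeed lam u) :
    (H.dcExpr u γ).IsSolution (lam : ℂ) (H.uGamma u γ) := by
  rw [DiracExpr.isSolution_iff]
  refine DiracExpr.IsSolOn.of_hasACDeriv fun x hx y hy => ?_
  replace hx : x ∈ H.I := hx
  replace hy : y ∈ H.I := hy
  have hs := DiracExpr.uIcc_subset_I hx hy
  obtain ⟨u0, u1⟩ := (DiracExpr.isSolution_iff.1 h.sol).hasACDeriv DiracExpr.ordConnected_I hx hy
  have hc := (h.hasACDeriv_cGamma (γ := γ) hx hy).inv fun t ht => h.cGamma_ne_zero (hs ht)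
  refine ⟨(hc.mul u0).congr_deriv fun t ht => ?_, (hc.mul u1).congr_deriv fun t ht => ?_⟩
  all_goals
    have hct := h.cGamma_ne_zero (γ := γ) (hs ht)
    have e1 := h.qam_eq (γ := γ) (hs ht)
    have e2 := h.qsc_eq (γ := γ) (hs ht)
    simp only [DiracExpr.rhs0, DiracExpr.rhs1, PiLp.smul_apply, smul_eq_mul,
      uGamma_apply, Complex.ofReal_sub, Complex.ofReal_add, e1, e2]
    simp only [dcExpr, spinorDot]
    field_simp
    ring

theorem isRealNontrivialSolution_uGamma (h : H.IsSeed lam u) :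
    (H.dcExpr u γ).IsRealNontrivialSolution (H.uGamma u γ) := by
  obtain ⟨x, hx⟩ := DiracExpr.nonempty_I h.lt
  exact ⟨⟨lam, h.isSolution_uGamma⟩, ⟨x, hx, h.uGamma_ne_zero hx⟩,
    fun x hx i => h.uGamma_real hx i⟩

theorem continuousOn_cGamma (h : H.IsSeed lam u) : ContinuousOn (H.cGamma u γ) H.I := by
  intro t ht
  obtain ⟨ε, hε, hb⟩ := Metric.isOpen_iff.1 (DiracExpr.isOpen_I (T := H.toDiracExpr)) t ht
  have hI : Set.Icc (t - ε / 2) (t + ε / 2) ⊆ H.I := fun s hs => hb <| by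
    rw [Metric.mem_ball, Real.dist_eq, abs_lt]
    constructor <;> linarith [hs.1, hs.2]
  have h1 := (h.hasACDeriv_cGamma (γ := γ) (hI ⟨le_rfl, by linarith⟩)
    (hI ⟨by linarith, le_rfl⟩)).continuousOn
  rw [Set.uIcc_of_le (by linarith)] at h1
  exact (h1.continuousAt (Icc_mem_nhds (by linarith) (by linarith))).continuousWithinAt

/-- The added potentials are continuous on the open interval, since u and c are continuous and c has
no zeros. -/
theorem isAdmissible (h : H.IsSeed lam u) (hH : H.IsAdmissible) :
    (H.doubleCommutation u γ).IsAdmissible := by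
  have hui (i : Fin 2) : ContinuousOn (fun t => u t i) H.I :=
    (PiLp.continuous_apply 2 (fun _ : Fin 2 => ℂ) i).comp_continuousOn h.sol.continuousOn
  have hcont {f : ℝ → ℂ} (hf : ContinuousOn f H.I) :
      LocallyIntegrableOn (fun x => (f x / H.cGamma u γ x).re) H.I :=
    (Complex.continuous_re.comp_continuousOn (hf.div h.continuousOn_cGamma
      fun t ht => h.cGamma_ne_zero ht)).locallyIntegrableOn DiracExpr.measurableSet_I
  refine ⟨hH.1, hH.2.1, hH.2.2.1.sub (hcont ?_), hH.2.2.2.1, hH.2.2.2.2.1.add (hcont ?_),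
    fun hlc => ?_, fun hlc => if_neg hlc, fun hlc => ?_, fun hlc => if_neg hlc⟩
  · exact continuousOn_const.mul ((hui 0).mul (hui 1))
  · exact ((hui 0).pow 2).sub ((hui 1).pow 2)
  · exact (show (H.doubleCommutation u γ).wa = H.uGamma u γ from if_pos hlc) ▸
      h.isRealNontrivialSolution_uGamma
  · exact (show (H.doubleCommutation u γ).wb = H.uGamma u γ from if_pos hlc) ▸
      h.isRealNontrivialSolution_uGamma

end IsSeed

end DiracOperator

/-! ### Limits and local bounds of solutions with respect to the spectral parameter -/

theorem HasACDeriv.of_tendsto {ι : Type*} {l : Filter ι} [l.NeBot] [l.IsCountablyGenerated]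
    {F F' : ι → ℝ → ℂ} {f f' : ℝ → ℂ} {x y : ℝ} {k : ℝ → ℝ} (hk : IntegrableOn k (Set.uIoc x y))
    (hF : ∀ᶠ i in l, HasACDeriv (F i) (F' i) x y)
    (hb : ∀ᶠ i in l, ∀ t ∈ Set.uIcc x y, ‖F' i t‖ ≤ k t)
    (hf : ∀ t ∈ Set.uIcc x y, Tendsto (fun i => F i t) l (𝓝 (f t)))
    (hf' : ∀ t ∈ Set.uIcc x y, Tendsto (fun i => F' i t) l (𝓝 (f' t))) :
    HasACDeriv f f' x y := by
  classical
  -- The hypothesis holds only eventually along l, so for the remaining indices the approximating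
  -- function is replaced by 0 to keep it measurable.
  have hmeas : AEStronglyMeasurable f' (volume.restrict (Set.uIoc x y)) := by
    refine aestronglyMeasurable_of_tendsto_ae l
      (f := fun i => if HasACDeriv (F i) (F' i) x y then F' i else 0) (fun i => ?_) ?_
    · split_ifs with h
      · exact (intervalIntegrable_iff.1 h.intervalIntegrable).aestronglyMeasurable
      · exact aestronglyMeasurable_const
    · refine (ae_restrict_iff' measurableSet_uIoc).2 (Eventually.of_forall fun t ht => ?_)
      refine (hf' t (Set.uIoc_subset_uIcc ht)).congr' ?_
      filter_upwards [hF] with i hi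
      rw [if_pos hi]
  have hi : IntervalIntegrable f' volume x y := by
    rw [intervalIntegrable_iff]
    refine hk.mono' hmeas ((ae_restrict_iff' measurableSet_uIoc).2 (Eventually.of_forall
      fun t ht => ?_))
    exact le_of_tendsto (hf' t (Set.uIoc_subset_uIcc ht)).norm
      (hb.mono fun i hi => hi t (Set.uIoc_subset_uIcc ht))
  refine HasACDeriv.of_integral hi fun t ht => ?_
  have hsub : Set.uIcc x t ⊆ Set.uIcc x y := Set.uIcc_subset_uIcc_left ht
  have hsub' : Set.uIoc x t ⊆ Set.uIoc x y := Set.uIoc_subset_uIoc_of_uIcc_subset_uIcc hsub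
  have c3 : Tendsto (fun i => ∫ s in x..t, F' i s) l (𝓝 (∫ s in x..t, f' s)) := by
    refine intervalIntegral.tendsto_integral_filter_of_dominated_convergence k ?_ ?_ ?_ ?_
    · filter_upwards [hF] with i hi
      exact (intervalIntegrable_iff.1 (hi.mono hsub).intervalIntegrable).aestronglyMeasurable
    · filter_upwards [hb] with i hi
      exact Eventually.of_forall fun s hs' => hi s (hsub (Set.uIoc_subset_uIcc hs'))
    · exact intervalIntegrable_iff.2 (hk.mono_set hsub')
    · exact Eventually.of_forall fun s hs' => hf' s (hsub (Set.uIoc_subset_uIcc hs'))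
  refine tendsto_nhds_unique (hf t ht) (((hf x Set.left_mem_uIcc).add c3).congr' ?_)
  filter_upwards [hF] with i hi
  rw [(hi.mono hsub).integral_eq]
  ring

namespace DiracExpr

variable {T : DiracExpr}

/-- The potentials are locally integrable. -/
def LocInt (T : DiracExpr) : Prop :=
  LocallyIntegrableOn T.qsc T.I ∧ LocallyIntegrableOn T.qel T.I ∧ LocallyIntegrableOn T.qam T.I

/-- A locally integrable bound for the coefficients of `τ u = z u` for `‖z‖ ≤ R`. -/
noncomputable def coeffBound (T : DiracExpr) (R : ℝ) (t : ℝ) : ℝ :=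
  R + |T.m| + |T.qsc t| + |T.qel t| + |T.qam t|

theorem coeffBound_nonneg {R : ℝ} (hR : 0 ≤ R) (t : ℝ) : 0 ≤ T.coeffBound R t := by
  unfold coeffBound; positivity

theorem LocInt.integrableOn_coeffBound (hT : T.LocInt) (R : ℝ) {x y : ℝ} (hx : x ∈ T.I)
    (hy : y ∈ T.I) : IntegrableOn (T.coeffBound R) (Set.uIcc x y) := by
  have hs := uIcc_subset_I hx hy
  have hc : IntegrableOn (fun _ : ℝ => R + |T.m|) (Set.uIcc x y) :=
    continuousOn_const.integrableOn_compact isCompact_uIcc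
  exact ((hc.add (hT.1.integrableOn_compact_subset hs isCompact_uIcc).norm).add
    (hT.2.1.integrableOn_compact_subset hs isCompact_uIcc).norm).add
    (hT.2.2.integrableOn_compact_subset hs isCompact_uIcc).norm

theorem norm_rhs_add_le {z : ℂ} {R : ℝ} (hz : ‖z‖ ≤ R) (u : ℝ → Spinor) (t : ℝ) :
    ‖T.rhs0 (fun t => z • u t) u t‖ + ‖T.rhs1 (fun t => z • u t) u t‖ ≤
      T.coeffBound R t * (‖u t 0‖ + ‖u t 1‖) := by
  have h0 : ‖T.rhs0 (fun t => z • u t) u t‖ ≤ R * ‖u t 1‖ + |T.qam t| * ‖u t 0‖ +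
      (|T.qel t| + (|T.m| + |T.qsc t|)) * ‖u t 1‖ := by
    unfold rhs0
    refine (norm_sub_le _ _).trans (add_le_add ((norm_sub_le _ _).trans (add_le_add ?_ ?_)) ?_)
    · rw [PiLp.smul_apply, smul_eq_mul, norm_mul]; gcongr
    · rw [norm_mul, Complex.norm_real, Real.norm_eq_abs]
    · rw [norm_mul, Complex.norm_real, Real.norm_eq_abs]
      gcongr
      exact (abs_sub _ _).trans (by gcongr; exact abs_add_le _ _)
  have h1 : ‖T.rhs1 (fun t => z • u t) u t‖ ≤ R * ‖u t 0‖ +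
      (|T.qel t| + (|T.m| + |T.qsc t|)) * ‖u t 0‖ + |T.qam t| * ‖u t 1‖ := by
    unfold rhs1
    refine (norm_add_le _ _).trans (add_le_add ((norm_add_le _ _).trans (add_le_add ?_ ?_)) ?_)
    · rw [norm_neg, PiLp.smul_apply, smul_eq_mul, norm_mul]; gcongr
    · rw [norm_mul, Complex.norm_real, Real.norm_eq_abs]
      gcongr
      exact (abs_add_le _ _).trans (by gcongr; exact abs_add_le _ _)
    · rw [norm_mul, Complex.norm_real, Real.norm_eq_abs]
  refine (add_le_add h0 h1).trans (le_of_eq ?_)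
  unfold coeffBound
  ring

theorem IsSolution.norm_add_le {z : ℂ} {u : ℝ → Spinor} (hu : T.IsSolution z u) (hT : T.LocInt)
    {R : ℝ} (hR : 0 ≤ R) (hz : ‖z‖ ≤ R) {c x : ℝ} (hc : c ∈ T.I) (hx : x ∈ T.I)
    (hk : ∫ t in Set.uIoc c x, T.coeffBound R t ≤ 1 / 2) :
    ‖u x 0‖ + ‖u x 1‖ ≤ 2 * (‖u c 0‖ + ‖u c 1‖) := by
  have hs := uIcc_subset_I hc hx
  have hi (i : Fin 2) : ContinuousOn (fun t => ‖u t i‖) T.I :=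
    ((PiLp.continuous_apply 2 (fun _ : Fin 2 => ℂ) i).comp_continuousOn hu.continuousOn).norm
  have hcont : ContinuousOn (fun t => ‖u t 0‖ + ‖u t 1‖) T.I := (hi 0).add (hi 1)
  refine le_two_mul_of_le_add_integral (N := fun t => ‖u t 0‖ + ‖u t 1‖) (k := T.coeffBound R)
    (hcont.mono hs) (fun t _ => by positivity)
    ((hT.integrableOn_coeffBound R hc hx).mono_set Set.uIoc_subset_uIcc)
    (coeffBound_nonneg hR) hk (fun t ht => ?_) x Set.right_mem_uIcc
  obtain ⟨u0, u1⟩ := (isSolution_iff.1 hu).hasACDeriv ordConnected_I hc (hs ht)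
  have e0 := u0.norm_sub_le
  have e1 := u1.norm_sub_le
  have i0 := (intervalIntegrable_iff.1 u0.intervalIntegrable).norm
  have i1 := (intervalIntegrable_iff.1 u1.intervalIntegrable).norm
  have i2 : IntegrableOn (fun s => T.coeffBound R s * (‖u s 0‖ + ‖u s 1‖)) (Set.uIoc c t) := by
    refine IntegrableOn.mono_set ?_ Set.uIoc_subset_uIcc
    exact (hT.integrableOn_coeffBound R hc (hs ht)).mul_continuousOn
      (hcont.mono (uIcc_subset_I hc (hs ht))) isCompact_uIcc
  have hle := integral_mono (i0.add i1) i2 fun s => norm_rhs_add_le hz u s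
  simp only [Pi.add_apply] at hle
  rw [integral_add i0 i1] at hle
  linarith

/-- A pointwise bounded family of solutions is locally uniformly bounded. -/
theorem exists_bound_of_isSolution (hT : T.LocInt) {Z : Set ℂ} {R : ℝ} (hR : 0 ≤ R)
    (hZ : ∀ z ∈ Z, ‖z‖ ≤ R) {U : ℂ → ℝ → Spinor} (hU : ∀ z ∈ Z, T.IsSolution z (U z))
    (hb : ∀ x ∈ T.I, ∃ M, ∀ z ∈ Z, ‖U z x‖ ≤ M) {K : Set ℝ} (hK : IsCompact K) (hKI : K ⊆ T.I) :
    ∃ M, ∀ z ∈ Z, ∀ t ∈ K, ‖U z t‖ ≤ M := by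
  refine hK.induction_on (p := fun K => ∃ M, ∀ z ∈ Z, ∀ t ∈ K, ‖U z t‖ ≤ M) ⟨0, by simp⟩
    (fun s t hst ⟨M, hM⟩ => ⟨M, fun z hz x hx => hM z hz x (hst hx)⟩)
    (fun s t ⟨M, hM⟩ ⟨M', hM'⟩ => ⟨max M M', fun z hz x hx => ?_⟩) fun x hx => ?_
  · rcases hx with hx | hx
    · exact (hM z hz x hx).trans (le_max_left _ _)
    · exact (hM' z hz x hx).trans (le_max_right _ _)
  have hxI := hKI hx
  obtain ⟨ε, hε, hball⟩ := Metric.isOpen_iff.1 isOpen_I x hxI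
  have hI : Set.Icc (x - ε / 2) (x + ε / 2) ⊆ T.I := fun s hs => hball <| by
    rw [Metric.mem_ball, Real.dist_eq, abs_lt]
    constructor <;> linarith [hs.1, hs.2]
  have hint : IntegrableOn (T.coeffBound R) (Set.uIcc (x - ε / 2) (x + ε / 2)) :=
    hT.integrableOn_coeffBound R (hI ⟨le_rfl, by linarith⟩) (hI ⟨by linarith, le_rfl⟩)
  have hnhds : Set.uIcc (x - ε / 2) (x + ε / 2) ∈ 𝓝 x := by
    rw [Set.uIcc_of_le (by linarith)]; exact Icc_mem_nhds (by linarith) (by linarith)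
  have hcont : ContinuousAt (fun t => ∫ s in x..t, T.coeffBound R s) x := by
    refine (intervalIntegral.continuousOn_primitive_interval' (a := x)
      (b₁ := x - ε / 2) (b₂ := x + ε / 2) ?_ (mem_of_mem_nhds hnhds)).continuousAt hnhds
    exact intervalIntegrable_iff.2 (hint.mono_set Set.uIoc_subset_uIcc)
  have hev : ∀ᶠ t in 𝓝 x, ‖∫ s in x..t, T.coeffBound R s‖ < 1 / 2 := by
    have := hcont.norm
    simp only [ContinuousAt, intervalIntegral.integral_same, norm_zero] at this
    exact this.eventually (gt_mem_nhds (by norm_num))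
  obtain ⟨M, hM⟩ := hb x hxI
  -- In `4 * M` one factor 2 is that of the Grönwall estimate and the other comes from adding two
  -- components, each bounded by M at x.
  refine ⟨{t | t ∈ T.I ∧ ‖∫ s in x..t, T.coeffBound R s‖ < 1 / 2},
    mem_nhdsWithin_of_mem_nhds (inter_mem (isOpen_I.mem_nhds hxI) hev), 4 * M, fun z hz t ht => ?_⟩
  have h1 := (hU z hz).norm_add_le hT hR (hZ z hz) hxI ht.1 ?_
  · have h2 := Spinor.norm_le (U z t)
    have h3 := Spinor.norm_apply_le (U z x) 0
    have h4 := Spinor.norm_apply_le (U z x) 1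
    have h5 := hM z hz
    linarith
  · have h2 := ht.2
    rw [intervalIntegral.norm_intervalIntegral_eq, Real.norm_eq_abs] at h2
    exact (le_abs_self _).trans h2.le

theorem exists_bound_of_continuous (hT : T.LocInt) {z₀ : ℂ} {r : ℝ} {Z : Set ℂ}
    (hZ : Z ⊆ Metric.closedBall z₀ r) {U : ℂ → ℝ → Spinor}
    (hU : ∀ z ∈ Z, T.IsSolution z (U z))
    (hb : ∀ x ∈ T.I, Continuous fun z => U z x) {K : Set ℝ} (hK : IsCompact K) (hKI : K ⊆ T.I) :
    ∃ M, ∀ z ∈ Z, ∀ t ∈ K, ‖U z t‖ ≤ M := by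
  refine exists_bound_of_isSolution hT (R := ‖z₀‖ + |r|) (by positivity) (fun z hz => ?_) hU
    (fun x hx => ?_) hK hKI
  · have h1 := hZ hz
    rw [Metric.mem_closedBall, dist_eq_norm] at h1
    calc ‖z‖ = ‖z₀ + (z - z₀)‖ := by ring_nf
      _ ≤ _ := (_root_.norm_add_le _ _).trans (by gcongr; exact h1.trans (le_abs_self r))
  · obtain ⟨M, hM⟩ := (isCompact_closedBall z₀ r).exists_bound_of_continuousOn (hb x hx).continuousOn
    exact ⟨M, fun z hz => hM z (hZ hz)⟩

/-- The limit of solutions of `τ u = z u` as `z → z₀` is a solution of `τ u = z₀ u`. -/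
theorem isSolution_of_continuous (hT : T.LocInt) {z₀ : ℂ} {U : ℂ → ℝ → Spinor}
    (hU : ∀ z ≠ z₀, T.IsSolution z (U z)) (hb : ∀ x ∈ T.I, Continuous fun z => U z x) :
    T.IsSolution z₀ (U z₀) := by
  rw [isSolution_iff]
  refine IsSolOn.of_hasACDeriv fun x hx y hy => ?_
  have hs := uIcc_subset_I hx hy
  set Z : Set ℂ := Metric.closedBall z₀ 1 \ {z₀} with hZdef
  obtain ⟨M, hM⟩ := exists_bound_of_continuous hT (Z := Z) (Set.sdiff_subset) (U := U)
    (fun z hz => hU z hz.2) hb isCompact_uIcc hs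
  have hZn : ∀ᶠ z in 𝓝[≠] z₀, z ∈ Z := by
    refine inter_mem (mem_nhdsWithin_of_mem_nhds (Metric.closedBall_mem_nhds z₀ one_pos))
      self_mem_nhdsWithin
  -- The local uniform bound M on the solutions gives a majorant of their derivatives that does not
  -- depend on z.
  have hdom : IntegrableOn (fun t => T.coeffBound (‖z₀‖ + 1) t * (2 * M)) (Set.uIoc x y) :=
    IntegrableOn.mono_set ((hT.integrableOn_coeffBound (‖z₀‖ + 1) hx hy).mul_const _)
      Set.uIoc_subset_uIcc
  have hzn : ∀ z ∈ Z, ‖z‖ ≤ ‖z₀‖ + 1 := fun z hz => by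
    have h1 := hz.1
    rw [Metric.mem_closedBall, dist_eq_norm] at h1
    calc ‖z‖ = ‖z₀ + (z - z₀)‖ := by ring_nf
      _ ≤ _ := (_root_.norm_add_le _ _).trans (by gcongr)
  have hsum : ∀ z ∈ Z, ∀ t ∈ Set.uIcc x y, ‖T.rhs0 (fun t => z • U z t) (U z) t‖ +
      ‖T.rhs1 (fun t => z • U z t) (U z) t‖ ≤ T.coeffBound (‖z₀‖ + 1) t * (2 * M) := by
    intro z hz t ht
    refine (norm_rhs_add_le (hzn z hz) _ t).trans ?_
    have h1 := hM z hz t ht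
    have h2 := Spinor.norm_apply_le (U z t) 0
    have h3 := Spinor.norm_apply_le (U z t) 1
    have h4 : 0 ≤ T.coeffBound (‖z₀‖ + 1) t := coeffBound_nonneg (by positivity) t
    exact mul_le_mul_of_nonneg_left (by linarith) h4
  have hti (i : Fin 2) {t : ℝ} (ht : t ∈ Set.uIcc x y) : Continuous fun z => U z t i :=
    (PiLp.continuous_apply 2 (fun _ : Fin 2 => ℂ) i).comp (hb t (hs ht))
  have hlim (i : Fin 2) (t : ℝ) (ht : t ∈ Set.uIcc x y) :
      Tendsto (fun z => U z t i) (𝓝[≠] z₀) (𝓝 (U z₀ t i)) :=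
    ((hti i ht).tendsto z₀).mono_left nhdsWithin_le_nhds
  have hid : Tendsto (fun z : ℂ => z) (𝓝[≠] z₀) (𝓝 z₀) := nhdsWithin_le_nhds
  have hsol := fun z (hz : z ∈ Z) =>
    (isSolution_iff.1 (hU z hz.2)).hasACDeriv ordConnected_I hx hy
  constructor
  · refine HasACDeriv.of_tendsto (l := 𝓝[≠] z₀) (F := fun z t => U z t 0)
      (F' := fun z => T.rhs0 (fun t => z • U z t) (U z)) hdom ?_ ?_ (hlim 0) ?_
    · filter_upwards [hZn] with z hz using (hsol z hz).1
    · filter_upwards [hZn] with z hz t ht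
      exact (le_add_of_nonneg_right (norm_nonneg _)).trans (hsum z hz t ht)
    · exact fun t ht => ((hid.mul (hlim 1 t ht)).sub ((hlim 0 t ht).const_mul _)).sub
        ((hlim 1 t ht).const_mul _)
  · refine HasACDeriv.of_tendsto (l := 𝓝[≠] z₀) (F := fun z t => U z t 1)
      (F' := fun z => T.rhs1 (fun t => z • U z t) (U z)) hdom ?_ ?_ (hlim 1) ?_
    · filter_upwards [hZn] with z hz using (hsol z hz).2
    · filter_upwards [hZn] with z hz t ht
      exact (le_add_of_nonneg_left (norm_nonneg _)).trans (hsum z hz t ht)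
    · exact fun t ht => ((hid.mul (hlim 0 t ht)).neg.add ((hlim 0 t ht).const_mul _)).add
        ((hlim 1 t ht).const_mul _)

end DiracExpr

theorem Differentiable.spinor_apply {f : ℂ → Spinor} (hf : Differentiable ℂ f) (i : Fin 2) :
    Differentiable ℂ (fun z => f z i) := fun z => (differentiableAt_piLp 2).1 (hf z) i

theorem Differentiable.wronskian_right {u : ℝ → Spinor} {V : ℂ → ℝ → Spinor} {x : ℝ}
    (hV : Differentiable ℂ fun z => V z x) : Differentiable ℂ fun z => wronskian u (V z) x :=
  ((hV.spinor_apply 1).const_mul _).sub ((hV.spinor_apply 0).const_mul _)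

/-- Riemann's removable singularity theorem; it is what makes `thetaGamma` entire across λ. -/
theorem Differentiable.dslope {E : Type*} [NormedAddCommGroup E] [NormedSpace ℂ E]
    [CompleteSpace E] {f : ℂ → E} (hf : Differentiable ℂ f) (c : ℂ) :
    Differentiable ℂ (dslope f c) := by
  rw [← differentiableOn_univ] at hf ⊢
  exact (Complex.differentiableOn_dslope univ_mem).2 hf

theorem dslope_of_eq_zero {E : Type*} [NormedAddCommGroup E] [NormedSpace ℂ E] {f : ℂ → E}
    {c z : ℂ} (h0 : f c = 0) (hz : z ≠ c) : dslope f c z = (1 / (z - c)) • f z := by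
  rw [dslope_of_ne _ hz, slope_def_module, h0, sub_zero, one_div]

/-! ### The boundary Wronskian with the z-derivative of Θ, and the entire system Φ_γ, Θ_γ -/

namespace DiracOperator

variable {H : DiracOperator} {Φ Θ : ℂ → ℝ → Spinor} {lam : ℝ} {γ : ℝ≥0∞}

theorem isSeed (hH : H.IsAdmissible) (hsys : H.IsFundamentalSystem Φ Θ)
    (hb : H.InDomainNearB (Θ (lam : ℂ))) : H.IsSeed lam (Θ (lam : ℂ)) where
  lt := hH.1
  sol := hsys.2.1.1 _
  real := fun x hx i => by
    have := hsys.2.1.2.2 lam x hx i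
    rw [Complex.conj_ofReal] at this
    exact this.symm
  ne_zero := fun x hx h0 => by
    have := hsys.2.2.1 lam x hx
    simp [wronskian, h0] at this
  l2 := hb.2.1

/-- The derivative of `z ↦ Θ(z)` at `λ`. -/
noncomputable def dotTheta (Θ : ℂ → ℝ → Spinor) (lam : ℝ) (x : ℝ) : Spinor :=
  deriv (fun z : ℂ => Θ z x) (lam : ℂ)

theorem deriv_wronskian (hsys : H.IsFundamentalSystem Φ Θ) {u : ℝ → Spinor} {x : ℝ}
    (hx : x ∈ H.I) : HasDerivAt (fun z : ℂ => wronskian u (Θ z) x)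
      (wronskian u (dotTheta Θ lam) x) (lam : ℂ) := by
  have h := (hsys.2.1.2.1 x hx (lam : ℂ)).hasDerivAt
  have hi (i : Fin 2) : HasDerivAt (fun z => Θ z x i) (dotTheta Θ lam x i) (lam : ℂ) := by
    exact ((PiLp.proj 2 (fun _ : Fin 2 => ℂ) i : Spinor →L[ℂ] ℂ)).hasFDerivAt.comp_hasDerivAt _ h
  exact ((hi 1).const_mul _).sub ((hi 0).const_mul _)

theorem tendsto_slope_wronskian (hsys : H.IsFundamentalSystem Φ Θ) {x : ℝ} (hx : x ∈ H.I) :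
    Tendsto (fun z : ℂ => (z - lam)⁻¹ * wronskian (Θ lam) (Θ z) x) (𝓝[≠] (lam : ℂ))
      (𝓝 (wronskian (Θ lam) (dotTheta Θ lam) x)) := by
  refine ((deriv_wronskian hsys hx (u := Θ lam)).tendsto_slope).congr fun z => ?_
  simp only [slope_def_module, wronskian_self, sub_zero, smul_eq_mul]

theorem locInt (hH : H.IsAdmissible) : H.LocInt := ⟨hH.2.2.1, hH.2.2.2.1, hH.2.2.2.2.1⟩

/-- By the Lagrange identity, W(Θ(λ),Θ(z))/(z-λ) has x-derivative -Θ(λ)·Θ(z). Letting z tend to λ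
under the integral gives the result without differentiating the equation in z. -/
theorem hasACDeriv_wronskian_dot (hH : H.IsAdmissible) (hsys : H.IsFundamentalSystem Φ Θ)
    {x y : ℝ} (hx : x ∈ H.I) (hy : y ∈ H.I) :
    HasACDeriv (wronskian (Θ lam) (dotTheta Θ lam))
      (fun t => - spinorDot (Θ lam t) (Θ lam t)) x y := by
  have hs := DiracExpr.uIcc_subset_I hx hy
  obtain ⟨M, hM⟩ := DiracExpr.exists_bound_of_continuous (locInt hH) (z₀ := lam) (r := 1)
    (Z := Metric.closedBall (lam : ℂ) 1) subset_rfl (U := Θ) (fun z _ => hsys.2.1.1 z)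
    (fun x hx => (hsys.2.1.2.1 x hx).continuous) isCompact_uIcc hs
  have hball : ∀ᶠ z in 𝓝[≠] (lam : ℂ), z ∈ Metric.closedBall (lam : ℂ) 1 :=
    mem_nhdsWithin_of_mem_nhds (Metric.closedBall_mem_nhds _ one_pos)
  have hlam : (lam : ℂ) ∈ Metric.closedBall (lam : ℂ) 1 := Metric.mem_closedBall_self zero_le_one
  refine HasACDeriv.of_tendsto (l := 𝓝[≠] (lam : ℂ))
    (F := fun z t => (z - lam)⁻¹ * wronskian (Θ lam) (Θ z) t)
    (F' := fun z t => - spinorDot (Θ lam t) (Θ z t)) (k := fun _ => M * M) ?_ ?_ ?_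
    (fun t ht => tendsto_slope_wronskian hsys (hs ht)) fun t ht => ?_
  · exact (continuousOn_const.integrableOn_compact isCompact_uIcc).mono_set Set.uIoc_subset_uIcc
  · filter_upwards [self_mem_nhdsWithin] with z hz
    refine (((hsys.2.1.1 lam).wronskian (hsys.2.1.1 z) hx hy).const_mul _).congr_deriv fun t _ => ?_
    have : z - lam ≠ 0 := sub_ne_zero.2 hz
    field_simp
    ring
  · filter_upwards [hball] with z hz t ht
    rw [norm_neg]
    have h1 := hM _ hlam t ht
    exact (norm_spinorDot_le _ _).trans
      (mul_le_mul h1 (hM z hz t ht) (norm_nonneg _) ((norm_nonneg _).trans h1))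
  · have hc (i : Fin 2) : Tendsto (fun z => Θ z t i) (𝓝[≠] (lam : ℂ)) (𝓝 (Θ lam t i)) :=
      (((hsys.2.1.2.1 t (hs ht)).spinor_apply i).continuous.tendsto _).mono_left
        nhdsWithin_le_nhds
    exact (((hc 0).const_mul _).add ((hc 1).const_mul _)).neg

theorem IsSeed.tendsto_cGamma {u : ℝ → Spinor} (h : H.IsSeed lam u) :
    Tendsto (H.cGamma u γ) H.nearB (𝓝 (-((γ⁻¹.toReal : ℝ) : ℂ))) := by
  have hE := DiracExpr.isEnd_right h.lt
  obtain ⟨c, hc⟩ := DiracExpr.nonempty_I h.lt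
  have h1 : Tendsto (fun x => ∫ t in H.rightPart x, ‖u t‖ ^ 2) H.nearB (𝓝 0) := by
    refine (nhds_basis_Ioo_pos (0 : ℝ)).tendsto_right_iff.2 fun ε hε => ?_
    filter_upwards [hE.tail hc (h.integrableOn_sq hc) hε, hE.mem_I hc] with x hx hxI
    exact ⟨by linarith [h.integral_pos hxI], by linarith⟩
  have h2 := (Complex.continuous_ofReal.tendsto _).comp ((h1.const_add γ⁻¹.toReal).neg)
  simp only [add_zero, Complex.ofReal_neg] at h2
  refine h2.congr' ?_
  filter_upwards [hE.mem_I hc] with x hx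
  rw [h.cGamma_eq hx, rGamma]
  rfl

/-- The boundary Wronskian of `Θ(λ)` and the derivative of `Θ` at `λ` exists. -/
theorem exists_boundary_wronskian (hH : H.IsAdmissible) (hsys : H.IsFundamentalSystem Φ Θ)
    (hb : H.InDomainNearB (Θ (lam : ℂ))) (γ : ℝ≥0∞) :
    ∃ Wb : ℂ, Tendsto (wronskian (Θ lam) (dotTheta Θ lam)) H.nearB (𝓝 Wb) ∧
      (∀ x ∈ H.I, wronskian (Θ lam) (dotTheta Θ lam) x + H.cGamma (Θ lam) γ x =
        Wb - ((γ⁻¹.toReal : ℝ) : ℂ)) ∧ (starRingEnd ℂ) Wb = Wb := by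
  have hs := isSeed hH hsys hb
  have hE := DiracExpr.isEnd_right hH.1
  have := hE.neBot
  obtain ⟨c, hc⟩ := DiracExpr.nonempty_I hH.1
  set W := wronskian (Θ lam) (dotTheta Θ lam) with hW
  -- The derivatives of W and c are -u·u and u·u, so W + c is constant; the limit of c at b then
  -- gives that of W.
  have hconst : ∀ x ∈ H.I, W x = W c + H.cGamma (Θ lam) γ c - H.cGamma (Θ lam) γ x := by
    intro x hx
    have h1 := ((hasACDeriv_wronskian_dot (lam := lam) hH hsys hc hx).add
      (hs.hasACDeriv_cGamma (γ := γ) hc hx)).integral_eq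
    simp only [neg_add_cancel, intervalIntegral.integral_zero] at h1
    linear_combination -h1
  have hlim : Tendsto W H.nearB (𝓝 (W c + H.cGamma (Θ lam) γ c - -((γ⁻¹.toReal : ℝ) : ℂ))) := by
    refine (hs.tendsto_cGamma.const_sub _).congr' ?_
    filter_upwards [hE.mem_I hc] with x hx using (hconst x hx).symm
  refine ⟨_, hlim, fun x hx => by rw [hconst x hx]; ring, ?_⟩
  -- Conjugation preserves the punctured neighbourhoods of the real point λ and, since Θ is real
  -- entire, commutes with the difference quotients.
  have hreal : (starRingEnd ℂ) (W c) = W c := by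
    have t1 := tendsto_slope_wronskian (lam := lam) hsys hc
    have t2 : Tendsto (starRingEnd ℂ) (𝓝[≠] (lam : ℂ)) (𝓝[≠] (lam : ℂ)) := by
      refine tendsto_nhdsWithin_iff.2 ⟨?_, ?_⟩
      · have := Complex.continuous_conj.tendsto (lam : ℂ)
        rw [Complex.conj_ofReal] at this
        exact this.mono_left nhdsWithin_le_nhds
      · filter_upwards [self_mem_nhdsWithin] with z hz h
        refine hz ?_
        have := congrArg (starRingEnd ℂ) (Set.mem_singleton_iff.1 h)
        simpa using this
    refine tendsto_nhds_unique ((Complex.continuous_conj.tendsto _).comp t1)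
      ((t1.comp t2).congr fun z => ?_)
    have h0 := hsys.2.1.2.2 z c hc
    have hr := hs.real c hc
    simp only [Function.comp_apply, wronskian, map_mul, map_sub, map_inv₀, h0, hr,
      Complex.conj_ofReal]
  simp only [map_sub, map_add, map_neg, Complex.conj_ofReal, hreal, hs.cGamma_eq hc]

/-- The solution `Φ_γ` of the transformed equation. -/
noncomputable def phiGamma (H : DiracOperator) (Φ : ℂ → ℝ → Spinor) (u : ℝ → Spinor) (lam : ℝ)
    (γ : ℝ≥0∞) (z : ℂ) (x : ℝ) : Spinor :=
  (z - lam) • Φ z x + (1 : ℂ) • (wronskian u (Φ z) x • H.uGamma u γ x)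

/-- The function `(z - λ) Θ_γ(z)`. -/
noncomputable def preThetaGamma (H : DiracOperator) (Φ Θ : ℂ → ℝ → Spinor) (lam : ℝ)
    (γ : ℝ≥0∞) (Wb : ℂ) (x : ℝ) (z : ℂ) : Spinor :=
  Θ z x + dslope (fun z => wronskian (Θ lam) (Θ z) x) lam z • H.uGamma (Θ lam) γ x +
    (((γ⁻¹.toReal : ℝ) : ℂ) - Wb) • H.phiGamma Φ (Θ lam) lam γ z x

/-- The solution `Θ_γ` of the transformed equation. -/
noncomputable def thetaGamma (H : DiracOperator) (Φ Θ : ℂ → ℝ → Spinor) (lam : ℝ)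
    (γ : ℝ≥0∞) (Wb : ℂ) (z : ℂ) (x : ℝ) : Spinor :=
  dslope (H.preThetaGamma Φ Θ lam γ Wb x) lam z

theorem differentiable_phiGamma (hsys : H.IsFundamentalSystem Φ Θ) {u : ℝ → Spinor} {x : ℝ}
    (hx : x ∈ H.I) : Differentiable ℂ fun z => H.phiGamma Φ u lam γ z x := by
  have h1 := hsys.1.2.1 x hx
  have h2 := Differentiable.wronskian_right (u := u) h1
  unfold phiGamma
  fun_prop

theorem differentiable_preThetaGamma (hsys : H.IsFundamentalSystem Φ Θ) {x : ℝ} (hx : x ∈ H.I)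
    (Wb : ℂ) : Differentiable ℂ (H.preThetaGamma Φ Θ lam γ Wb x) := by
  have h1 := hsys.2.1.2.1 x hx
  have h2 := (Differentiable.wronskian_right (u := Θ lam) h1).dslope lam
  have h3 := differentiable_phiGamma (γ := γ) (lam := lam) (u := Θ lam) hsys hx
  unfold preThetaGamma
  fun_prop

theorem phiGamma_lam (hsys : H.IsFundamentalSystem Φ Θ) {x : ℝ} (hx : x ∈ H.I) :
    H.phiGamma Φ (Θ lam) lam γ lam x = H.uGamma (Θ lam) γ x := by
  rw [phiGamma, hsys.2.2.1 _ x hx]; simp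

/-- The data of the double commutation of a fundamental system. -/
structure IsCommutationData (H : DiracOperator) (Φ Θ : ℂ → ℝ → Spinor) (lam : ℝ) (γ : ℝ≥0∞)
    (Wb : ℂ) : Prop where
  adm : H.IsAdmissible
  sys : H.IsFundamentalSystem Φ Θ
  domB : H.InDomainNearB (Θ (lam : ℂ))
  not_l2 : ¬ MemLp (Θ (lam : ℂ)) 2 (volume.restrict H.I)
  add_eq : ∀ x ∈ H.I, wronskian (Θ lam) (dotTheta Θ lam) x + H.cGamma (Θ lam) γ x =
    Wb - ((γ⁻¹.toReal : ℝ) : ℂ)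
  conj_Wb : (starRingEnd ℂ) Wb = Wb

namespace IsCommutationData

variable {Wb : ℂ}

theorem seed (h : H.IsCommutationData Φ Θ lam γ Wb) : H.IsSeed lam (Θ lam) :=
  isSeed h.adm h.sys h.domB

/-- This removes the last pole of Θ_γ. At z = λ all three terms are multiples of u_γ, with
coefficients c, W_b - 1/γ - c and 1/γ - W_b. -/
theorem preThetaGamma_lam (h : H.IsCommutationData Φ Θ lam γ Wb) {x : ℝ} (hx : x ∈ H.I) :
    H.preThetaGamma Φ Θ lam γ Wb x lam = 0 := by
  have h1 : dslope (fun z => wronskian (Θ lam) (Θ z) x) (lam : ℂ) lam =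
      Wb - ((γ⁻¹.toReal : ℝ) : ℂ) - H.cGamma (Θ lam) γ x := by
    rw [dslope_same, (deriv_wronskian h.sys hx).deriv, ← h.add_eq x hx]
    ring
  have h2 : Θ lam x = H.cGamma (Θ lam) γ x • H.uGamma (Θ lam) γ x := by
    rw [uGamma, smul_smul, mul_inv_cancel₀ (h.seed.cGamma_ne_zero hx), one_smul]
  rw [preThetaGamma, phiGamma_lam h.sys hx, h1]
  nth_rewrite 1 [h2]
  rw [← add_smul, ← add_smul]
  ring_nf
  simp

theorem thetaGamma_eq (h : H.IsCommutationData Φ Θ lam γ Wb) {x : ℝ} (hx : x ∈ H.I) {z : ℂ}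
    (hz : z ≠ lam) : H.thetaGamma Φ Θ lam γ Wb z x =
      (1 / (z - lam)) • (Θ z x + (1 / (z - lam)) •
        (wronskian (Θ lam) (Θ z) x • H.uGamma (Θ lam) γ x)
        + (((γ⁻¹.toReal : ℝ) : ℂ) - Wb) • H.phiGamma Φ (Θ lam) lam γ z x) := by
  rw [thetaGamma, dslope_of_eq_zero (h.preThetaGamma_lam hx) hz, preThetaGamma,
    dslope_of_eq_zero (f := fun z => wronskian (Θ lam) (Θ z) x) (wronskian_self _ _) hz, smul_smul, smul_eq_mul]

theorem phiGamma_eq {u : ℝ → Spinor} {x : ℝ} {z : ℂ} (hz : z ≠ lam) :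
    H.phiGamma Φ u lam γ z x = (z - lam) • (Φ z x + (1 / (z - lam)) •
            (wronskian u (Φ z) x • H.uGamma u γ x)) := by
  rw [phiGamma, smul_add, smul_smul (z - (lam : ℂ)), mul_one_div_cancel (sub_ne_zero.2 hz)]

theorem isSolution_phiGamma (h : H.IsCommutationData Φ Θ lam γ Wb) (z : ℂ) :
    (H.dcExpr (Θ lam) γ).IsSolution z (H.phiGamma Φ (Θ lam) lam γ z) :=
  h.seed.isSolution_transform (one_mul _) (h.sys.1.1 z)

theorem locInt_dcExpr (h : H.IsCommutationData Φ Θ lam γ Wb) :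
    (H.dcExpr (Θ lam) γ).LocInt := locInt (h.seed.isAdmissible (γ := γ) h.adm)

theorem isSolution_thetaGamma_of_ne (h : H.IsCommutationData Φ Θ lam γ Wb) {z : ℂ}
    (hz : z ≠ lam) :
    (H.dcExpr (Θ lam) γ).IsSolution z (H.thetaGamma Φ Θ lam γ Wb z) := by
  have hz' := sub_ne_zero.2 hz
  have h1 := h.seed.isSolution_transform (γ := γ) (z := z) (κ := 1 / (z - lam)) (α := 1)
    (by field_simp) (h.sys.2.1.1 z)
  refine (h1.linear (h.isSolution_phiGamma z) (1 / (z - lam))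
    (1 / (z - lam) * (((γ⁻¹.toReal : ℝ) : ℂ) - Wb))).congr fun x hx => ?_
  rw [h.thetaGamma_eq hx hz, one_smul, smul_add (1 / (z - (lam : ℂ))) (_ + _), smul_smul _ (_ - _)]

theorem differentiable_thetaGamma (h : H.IsCommutationData Φ Θ lam γ Wb) {x : ℝ} (hx : x ∈ H.I) :
    Differentiable ℂ fun z => H.thetaGamma Φ Θ lam γ Wb z x :=
  (differentiable_preThetaGamma h.sys hx Wb).dslope _

/-- At z = λ the algebraic formula is unavailable; there the equation is inherited from z ≠ λ by
continuity in z. -/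
theorem isSolution_thetaGamma (h : H.IsCommutationData Φ Θ lam γ Wb) (z : ℂ) :
    (H.dcExpr (Θ lam) γ).IsSolution z (H.thetaGamma Φ Θ lam γ Wb z) := by
  by_cases hz : z = lam
  · rw [hz]
    exact DiracExpr.isSolution_of_continuous h.locInt_dcExpr
      (fun z hz => h.isSolution_thetaGamma_of_ne hz)
      (fun x hx => (h.differentiable_thetaGamma hx).continuous)
  · exact h.isSolution_thetaGamma_of_ne hz

theorem phiGamma_real (h : H.IsCommutationData Φ Θ lam γ Wb) (z : ℂ) {x : ℝ} (hx : x ∈ H.I)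
    (i : Fin 2) : H.phiGamma Φ (Θ lam) lam γ ((starRingEnd ℂ) z) x i =
      (starRingEnd ℂ) (H.phiGamma Φ (Θ lam) lam γ z x i) := by
  simp only [phiGamma, wronskian, PiLp.add_apply, PiLp.smul_apply, smul_eq_mul, map_add, map_mul,
    map_sub, Complex.conj_ofReal, map_one, h.sys.1.2.2 z x hx, h.seed.uGamma_real hx,
    h.seed.real x hx]

/-- Both sides are continuous in z, so it is enough to compare them on the dense set z ≠ λ, where
the explicit formula holds. The Wronskian identity below is proved in the same way. -/
theorem thetaGamma_real (h : H.IsCommutationData Φ Θ lam γ Wb) (z : ℂ) {x : ℝ} (hx : x ∈ H.I)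
    (i : Fin 2) : H.thetaGamma Φ Θ lam γ Wb ((starRingEnd ℂ) z) x i =
      (starRingEnd ℂ) (H.thetaGamma Φ Θ lam γ Wb z x i) := by
  have hc := ((h.differentiable_thetaGamma hx).spinor_apply i).continuous
  have hd : Dense ({(lam : ℂ)}ᶜ : Set ℂ) := dense_compl_singleton _
  refine congrFun (Continuous.ext_on hd (hc.comp Complex.continuous_conj)
    (Complex.continuous_conj.comp hc) fun z hz => ?_) z
  have hz' : (starRingEnd ℂ) z ≠ lam := fun hh => hz <| by
    have := congrArg (starRingEnd ℂ) hh
    simpa using this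
  simp only [Function.comp_apply]
  rw [h.thetaGamma_eq hx hz, h.thetaGamma_eq hx hz']
  simp only [wronskian, PiLp.add_apply, PiLp.smul_apply, smul_eq_mul, map_add, map_mul,
    map_sub, map_div₀, Complex.conj_ofReal, map_one, h.sys.2.1.2.2 z x hx, h.seed.uGamma_real hx,
    h.seed.real x hx, h.phiGamma_real z hx, h.conj_Wb]

theorem wronskian_thetaGamma_phiGamma (h : H.IsCommutationData Φ Θ lam γ Wb) (z : ℂ) {x : ℝ}
    (hx : x ∈ H.I) :
    wronskian (H.thetaGamma Φ Θ lam γ Wb z) (H.phiGamma Φ (Θ lam) lam γ z) x = 1 := by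
  have hc (i : Fin 2) := ((h.differentiable_thetaGamma hx).spinor_apply i).continuous
  have hc' (i : Fin 2) := ((differentiable_phiGamma (lam := lam) (γ := γ) (u := Θ lam)
    h.sys hx).spinor_apply i).continuous
  have hd : Dense ({(lam : ℂ)}ᶜ : Set ℂ) := dense_compl_singleton _
  refine congrFun (Continuous.ext_on hd (f := fun z => wronskian (H.thetaGamma Φ Θ lam γ Wb z)
    (H.phiGamma Φ (Θ lam) lam γ z) x) (((hc 0).mul (hc' 1)).sub ((hc 1).mul (hc' 0)))
    continuous_const fun z hz => ?_) z
  have hz' := sub_ne_zero.2 hz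
  have h1 := h.sys.2.2.1 z x hx
  simp only [wronskian, h.thetaGamma_eq hx hz, phiGamma, PiLp.add_apply, PiLp.smul_apply,
    smul_eq_mul, IsSeed.uGamma_apply] at h1 ⊢
  field_simp
  linear_combination (z - lam) ^ 2 * h1

end IsCommutationData

end DiracOperator

/-! ### Cauchy–Schwarz, the Hardy type inequality and growth of Wronskians -/

theorem sq_integral_mul_norm_le {S : Set ℝ} {u v : ℝ → Spinor}
    (hu : MemLp u 2 (volume.restrict S)) (hv : MemLp v 2 (volume.restrict S)) :
    (∫ t in S, ‖u t‖ * ‖v t‖) ^ 2 ≤ (∫ t in S, ‖u t‖ ^ 2) * ∫ t in S, ‖v t‖ ^ 2 := by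
  have hu2 := hu.norm.integrable_sq
  have hv2 := hv.norm.integrable_sq
  have huv := DiracExpr.integrableOn_mul_norm hu hv
  -- The quadratic polynomial s ↦ ∫ (‖u‖ + s‖v‖)² is nonnegative, hence its discriminant is not
  -- positive.
  have key : ∀ s : ℝ, 0 ≤ (∫ t in S, ‖v t‖ ^ 2) * (s * s) + (2 * ∫ t in S, ‖u t‖ * ‖v t‖) * s +
      ∫ t in S, ‖u t‖ ^ 2 := by
    intro s
    have h1 : 0 ≤ ∫ t in S, (‖u t‖ + s * ‖v t‖) ^ 2 := integral_nonneg fun t => sq_nonneg _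
    have h2 : ∫ t in S, (‖u t‖ + s * ‖v t‖) ^ 2 =
        ∫ t in S, ((s * s) * ‖v t‖ ^ 2 + (2 * s) * (‖u t‖ * ‖v t‖) + ‖u t‖ ^ 2) :=
      integral_congr_ae (Eventually.of_forall fun t => by ring)
    have h12 : Integrable (fun t => (s * s) * ‖v t‖ ^ 2 + (2 * s) * (‖u t‖ * ‖v t‖))
      (volume.restrict S) := (hv2.const_mul _).add (huv.const_mul _)
    rw [h2, integral_add h12 hu2, integral_add (hv2.const_mul _) (huv.const_mul _),
      integral_const_mul, integral_const_mul] at h1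
    linarith
  have := discrim_le_zero key
  rw [discrim] at this
  nlinarith

theorem integral_mul_norm_le {S : Set ℝ} {u v : ℝ → Spinor}
    (hu : MemLp u 2 (volume.restrict S)) (hv : MemLp v 2 (volume.restrict S)) :
    ∫ t in S, ‖u t‖ * ‖v t‖ ≤ √(∫ t in S, ‖u t‖ ^ 2) * √(∫ t in S, ‖v t‖ ^ 2) := by
  rw [← Real.sqrt_mul (integral_nonneg fun t => by positivity)]
  exact Real.le_sqrt_of_sq_le (sq_integral_mul_norm_le hu hv)

/-- A Hardy type inequality for Wronskians. -/
theorem integral_sq_div_mul_le {f v : ℝ → Spinor} {W : ℝ → ℂ} {C : ℝ → ℝ} {κ : ℂ} {σ x y : ℝ}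
    (hσ : σ ^ 2 = 1) (hxy : x ≤ y) (hf : ContinuousOn f (Set.uIcc x y))
    (hv : ContinuousOn v (Set.uIcc x y)) (hC0 : ∀ t ∈ Set.uIcc x y, C t ≠ 0)
    (hC : HasACDeriv (fun t => (C t : ℂ)) (fun t => ((σ * ‖f t‖ ^ 2 : ℝ) : ℂ)) x y)
    (hW : HasACDeriv W (fun t => κ * spinorDot (f t) (v t)) x y) :
    ∫ t in Set.Ioc x y, ‖(W t / C t) • f t‖ ^ 2 ≤
      2 * (-(σ * ‖W y‖ ^ 2 / C y) + σ * ‖W x‖ ^ 2 / C x) +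
        4 * ‖κ‖ ^ 2 * ∫ t in Set.Ioc x y, ‖v t‖ ^ 2 := by
  -- The function -σ|W|²/C. As C' = σ|f|² and σ² = 1, its derivative is |W|²|f|²/C² plus a cross
  -- term that contains W'.
  have hF := (((hW.conj.mul hW).mul (hC.inv fun t ht => Complex.ofReal_ne_zero.2
    (hC0 t ht))).const_mul (-(σ : ℂ))).re_im.1
  obtain ⟨hi, hint⟩ := hF.1.integral_of_hasDerivAt hF.2
  have hend (t : ℝ) : (-(σ : ℂ) * ((starRingEnd ℂ) (W t) * W t * ((C t : ℂ))⁻¹)).re =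
      -(σ * ‖W t‖ ^ 2 / C t) := by
    rw [Complex.conj_mul', ← Complex.ofReal_inv]
    norm_cast
    ring
  rw [hend, hend, intervalIntegral.integral_of_le hxy] at hint
  have hIcc : Set.uIcc x y = Set.Icc x y := Set.uIcc_of_le hxy
  have hWc := hW.continuousOn
  have hCc : ContinuousOn (fun t => (C t : ℂ)) (Set.uIcc x y) := hC.continuousOn
  have i1 : IntegrableOn (fun t => ‖(W t / C t) • f t‖ ^ 2) (Set.Ioc x y) := by
    refine IntegrableOn.mono_set (ContinuousOn.integrableOn_compact isCompact_uIcc ?_)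
      (hIcc ▸ Set.Ioc_subset_Icc_self)
    exact ((((hWc.div hCc fun t ht => Complex.ofReal_ne_zero.2 (hC0 t ht))).smul hf).norm).pow 2
  have i2 : IntegrableOn (fun t => ‖v t‖ ^ 2) (Set.Ioc x y) :=
    (ContinuousOn.integrableOn_compact isCompact_uIcc (hv.norm.pow 2)).mono_set
      (hIcc ▸ Set.Ioc_subset_Icc_self)
  rw [intervalIntegrable_iff_integrableOn_Ioc_of_le hxy] at hi
  have hle := setIntegral_mono_on (i1.const_mul (1 / 2))
    (hi.add (i2.const_mul (2 * ‖κ‖ ^ 2))) measurableSet_Ioc fun t ht => ?_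
  · simp only [Pi.add_apply] at hle
    rw [integral_const_mul, integral_add hi (i2.const_mul _), integral_const_mul,
      hint] at hle
    linarith
  · have htm : t ∈ Set.uIcc x y := hIcc ▸ Set.Ioc_subset_Icc_self ht
    have hCt := hC0 t htm
    have hCt' : (C t : ℂ) ≠ 0 := Complex.ofReal_ne_zero.2 hCt
    set d := spinorDot (f t) (v t) with hd
    have hdn : ‖d‖ ≤ ‖f t‖ * ‖v t‖ := norm_spinorDot_le _ _
    have e1 : (-(σ : ℂ) * (((starRingEnd ℂ) (κ * d) * W t + (starRingEnd ℂ) (W t) * (κ * d)) *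
        ((C t : ℂ))⁻¹ + (starRingEnd ℂ) (W t) * W t *
          (-((σ * ‖f t‖ ^ 2 : ℝ) : ℂ) / (C t : ℂ) ^ 2))).re =
        ‖W t‖ ^ 2 * ‖f t‖ ^ 2 / C t ^ 2 - 2 * σ / C t * ((starRingEnd ℂ) (W t) * (κ * d)).re := by
      have h1 : (starRingEnd ℂ) (κ * d) * W t + (starRingEnd ℂ) (W t) * (κ * d) =
          ((2 * ((starRingEnd ℂ) (W t) * (κ * d)).re : ℝ) : ℂ) := by
        have := Complex.add_conj ((starRingEnd ℂ) (W t) * (κ * d))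
        rw [map_mul, Complex.conj_conj] at this
        rw [← this]
        ring
      rw [h1, Complex.conj_mul', ← Complex.ofReal_inv]
      norm_cast
      have : σ * σ = 1 := by rw [← hσ]; ring
      field_simp
      linear_combination (‖W t‖ ^ 2 * ‖f t‖ ^ 2) * this
    have e2 : |2 * σ / C t * ((starRingEnd ℂ) (W t) * (κ * d)).re| ≤
        2 * ((‖W t‖ * ‖f t‖ / |C t|) * (‖κ‖ * ‖v t‖)) := by
      have hσ1 : |σ| = 1 := by
        rw [← sq_eq_sq₀ (abs_nonneg _) zero_le_one, sq_abs, hσ, one_pow]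
      rw [abs_mul, abs_div, abs_mul, hσ1, abs_two, mul_one]
      have h2 : |((starRingEnd ℂ) (W t) * (κ * d)).re| ≤ ‖W t‖ * (‖κ‖ * (‖f t‖ * ‖v t‖)) := by
        refine (Complex.abs_re_le_norm _).trans ?_
        rw [norm_mul, norm_mul, RCLike.norm_conj]
        gcongr
      calc _ ≤ 2 / |C t| * (‖W t‖ * (‖κ‖ * (‖f t‖ * ‖v t‖))) := by gcongr
        _ = _ := by ring
    have e3 : ‖(W t / C t) • f t‖ ^ 2 = (‖W t‖ * ‖f t‖ / |C t|) ^ 2 := by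
      rw [norm_smul, norm_div, Complex.norm_real, Real.norm_eq_abs]; ring
    have e4 : ‖W t‖ ^ 2 * ‖f t‖ ^ 2 / C t ^ 2 = (‖W t‖ * ‖f t‖ / |C t|) ^ 2 := by
      rw [div_pow, sq_abs, mul_pow]
    simp only [Pi.add_apply]
    rw [e1, e3, e4]
    have e5 := (abs_le.1 e2).2
    -- With A = |W||f|/|C| and B = |κ||v|, the cross term is at most 2AB ≤ A²/2 + 2B². Half of A²
    -- survives, whence the constants 2 and 4.
    nlinarith [sq_nonneg (‖W t‖ * ‖f t‖ / |C t| - 2 * (‖κ‖ * ‖v t‖))]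

namespace DiracExpr

variable {T : DiracExpr}

namespace IsEnd

variable {S : ℝ → Set ℝ} {l : Filter ℝ}

theorem tendsto_integral_atTop (h : T.IsEnd S l) {c : ℝ} (hc : c ∈ T.I) {k : ℝ → ℝ}
    (hk : ContinuousOn k T.I) (hk0 : ∀ t, 0 ≤ k t) (hn : ¬ IntegrableOn k (S c)) :
    Tendsto (fun x => ∫ t in Set.uIoc c x, k t) l atTop := by
  refine tendsto_atTop.2 fun M => ?_
  obtain ⟨x, hx, hM⟩ : ∃ x ∈ S c, M ≤ ∫ t in Set.uIoc c x, k t := by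
    by_contra! hcon
    exact hn (h.integrableOn_of_bounded (M := M) hc hk hk0
      (mem_of_superset (h.mem c hc) fun x hx => (hcon x hx).le))
  have hxI := h.sub c hc hx
  filter_upwards [h.mem x hxI] with x' hx'
  refine hM.trans (setIntegral_mono_set ?_ (Eventually.of_forall hk0)
    (h.nested c x x' hx hx').eventuallyLE)
  exact ((hk.mono (uIcc_subset_I hc (h.sub x hxI hx'))).integrableOn_compact
    isCompact_uIcc).mono_set Set.uIoc_subset_uIcc

/-- If `|C|` dominates `∫ |f|²` and diverges, then the Wronskian of `f` with a square integrable
`v` is negligible with respect to `C`. -/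
theorem tendsto_div_zero (h : T.IsEnd S l) {y : ℝ} (hy : y ∈ T.I) {f v : ℝ → Spinor} {W : ℝ → ℂ}
    {C : ℝ → ℝ} {κ : ℂ} (hf : ContinuousOn f T.I)
    (hv : MemLp v 2 (volume.restrict (S y)))
    (hW : ∀ x ∈ S y, HasACDeriv W (fun t => κ * spinorDot (f t) (v t)) y x)
    (hC : Tendsto (fun x => |C x|) l atTop)
    (hCf : ∀ x ∈ S y, ∫ t in Set.uIoc y x, ‖f t‖ ^ 2 ≤ |C x|) :
    Tendsto (fun x => W x / C x) l (𝓝 0) := by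
  set K := ‖κ‖ * √(∫ t in S y, ‖v t‖ ^ 2) with hK
  -- By Cauchy–Schwarz the increment of W is O(|C|^(1/2)), which is of lower order than C.
  have hbound : ∀ x ∈ S y, ‖W x‖ ≤ ‖W y‖ + K * √|C x| := by
    intro x hx
    have hxI := h.sub y hy hx
    have hfx := (memLp_uIcc hf hy hxI).mono_measure
      (Measure.restrict_mono (Set.uIoc_subset_uIcc (a := y) (b := x)) le_rfl)
    have hvx : MemLp v 2 (volume.restrict (Set.uIoc y x)) := by
      rw [← h.restrict_uIoc hx]; exact hv.mono_measure Measure.restrict_le_self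
    refine (hW x hx).norm_sub_le.trans (add_le_add le_rfl ?_)
    calc ∫ s in Set.uIoc y x, ‖κ * spinorDot (f s) (v s)‖
        ≤ ∫ s in Set.uIoc y x, ‖κ‖ * (‖f s‖ * ‖v s‖) := by
          refine integral_mono_of_nonneg (Eventually.of_forall fun _ => norm_nonneg _)
            ((integrableOn_mul_norm hfx hvx).const_mul _) (Eventually.of_forall fun s => ?_)
          simp only [norm_mul]
          gcongr
          exact norm_spinorDot_le _ _
      _ = ‖κ‖ * ∫ s in Set.uIoc y x, ‖f s‖ * ‖v s‖ := integral_const_mul _ _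
      _ ≤ ‖κ‖ * (√(∫ t in Set.uIoc y x, ‖f t‖ ^ 2) * √(∫ t in Set.uIoc y x, ‖v t‖ ^ 2)) := by
          gcongr; exact integral_mul_norm_le hfx hvx
      _ ≤ ‖κ‖ * (√|C x| * √(∫ t in S y, ‖v t‖ ^ 2)) := by
          refine mul_le_mul_of_nonneg_left (mul_le_mul (Real.sqrt_le_sqrt (hCf x hx))
            (Real.sqrt_le_sqrt ?_) (Real.sqrt_nonneg _) (Real.sqrt_nonneg _)) (norm_nonneg _)
          exact h.integral_uIoc_le hx hv.norm.integrable_sq fun _ => by positivity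
      _ = K * √|C x| := by rw [hK]; ring
  have hs : Tendsto (fun x => √|C x|) l atTop := Real.tendsto_sqrt_atTop.comp hC
  have hz : Tendsto (fun x => ‖W y‖ / |C x| + K / √|C x|) l (𝓝 0) := by
    simpa using (tendsto_const_nhds.div_atTop hC).add (tendsto_const_nhds.div_atTop hs)
  refine squeeze_zero_norm' ?_ hz
  filter_upwards [h.mem y hy, hC.eventually_gt_atTop 0] with x hx hpos
  have hsp : 0 < √|C x| := Real.sqrt_pos.2 hpos
  rw [norm_div, Complex.norm_real, Real.norm_eq_abs]
  calc _ ≤ (‖W y‖ + K * √|C x|) / |C x| := by gcongr; exact hbound x hx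
    _ = ‖W y‖ / |C x| + K * (√|C x| / (√|C x| * √|C x|)) := by
        rw [Real.mul_self_sqrt hpos.le]; ring
    _ = _ := by field_simp

end IsEnd

end DiracExpr

/-! ### Behaviour of the transformation at the two endpoints -/

namespace DiracOperator

namespace IsSeed

variable {H : DiracOperator} {lam : ℝ} {u v : ℝ → Spinor} {γ : ℝ≥0∞} {z : ℂ}

theorem hasACDeriv_neg_rGamma (h : H.IsSeed lam u) {x y : ℝ} (hx : x ∈ H.I) (hy : y ∈ H.I) :
    HasACDeriv (fun t => ((-H.rGamma u γ t : ℝ) : ℂ)) (fun t => ((1 * ‖u t‖ ^ 2 : ℝ) : ℂ)) x y := by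
  have hs := DiracExpr.uIcc_subset_I hx hy
  refine ((h.hasACDeriv_cGamma (γ := γ) hx hy).congr fun t ht => h.cGamma_eq (hs ht)).congr_deriv
    fun t ht => ?_
  rw [h.spinorDot_self (hs ht), one_mul]

/-- The pair u_γ, -1/r thus satisfies the hypothesis of the Hardy type inequality with σ = -1, as u,
-r does with σ = 1. This symmetry lets the transformation be inverted. -/
theorem hasACDeriv_neg_inv_rGamma (h : H.IsSeed lam u) {x y : ℝ} (hx : x ∈ H.I) (hy : y ∈ H.I) :
    HasACDeriv (fun t => ((-(H.rGamma u γ t)⁻¹ : ℝ) : ℂ))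
      (fun t => ((-1 * ‖H.uGamma u γ t‖ ^ 2 : ℝ) : ℂ)) x y := by
  have hs := DiracExpr.uIcc_subset_I hx hy
  have h1 := (h.hasACDeriv_neg_rGamma (γ := γ) hx hy).inv fun t ht =>
    Complex.ofReal_ne_zero.2 (neg_ne_zero.2 (h.rGamma_pos (hs ht)).ne')
  refine (h1.congr fun t ht => ?_).congr_deriv fun t ht => ?_
  · rw [← Complex.ofReal_inv, inv_neg]
  · rw [h.norm_uGamma (hs ht)]
    push_cast
    rw [div_pow, neg_sq]
    ring

theorem continuousOn_uGamma (h : H.IsSeed lam u) : ContinuousOn (H.uGamma u γ) H.I :=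
  h.isSolution_uGamma.continuousOn

theorem continuousOn_wronskian_smul (h : H.IsSeed lam u) (hv : H.IsSolution z v) :
    ContinuousOn (fun x => wronskian u v x • H.uGamma u γ x) H.I :=
  (DiracExpr.ContinuousOn.wronskian h.sol.continuousOn hv.continuousOn).smul h.continuousOn_uGamma

theorem div_smul_eq (h : H.IsSeed lam u) {t : ℝ} (ht : t ∈ H.I) :
    (wronskian u v t / ((-H.rGamma u γ t : ℝ) : ℂ)) • u t = wronskian u v t • H.uGamma u γ t := by
  rw [uGamma, smul_smul, h.cGamma_eq ht, div_eq_mul_inv]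

/-- Near `a` the correction term of the transformation is always square integrable. -/
theorem l2NearA_wronskian_smul (h : H.IsSeed lam u) (hv : H.IsSolution z v) (hL : H.L2NearA v) :
    H.L2NearA (fun x => wronskian u v x • H.uGamma u γ x) := by
  have hE := DiracExpr.isEnd_left h.lt
  obtain ⟨y, hy, hvy⟩ := hL
  refine ⟨y, hy, hE.memLp_of_bounded (h.continuousOn_wronskian_smul hv) hy
    (M := 2 * (‖wronskian u v y‖ ^ 2 / H.rGamma u γ y) +
      4 * ‖(lam : ℂ) - z‖ ^ 2 * ∫ t in H.leftPart y, ‖v t‖ ^ 2) ?_⟩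
  filter_upwards [hE.mem y hy] with x hx
  have hxI := hE.sub y hy hx
  have hs := DiracExpr.uIcc_subset_I hxI hy
  have h1 := integral_sq_div_mul_le (σ := 1) (by norm_num) hx.2.le (h.sol.continuousOn.mono hs)
    (hv.continuousOn.mono hs) (fun t ht => neg_ne_zero.2 (h.rGamma_pos (γ := γ) (hs ht)).ne')
    (h.hasACDeriv_neg_rGamma hxI hy) (h.sol.wronskian hv hxI hy)
  have h2 : ∫ t in Set.Ioc x y, ‖v t‖ ^ 2 ≤ ∫ t in H.leftPart y, ‖v t‖ ^ 2 := by
    have := hE.integral_uIoc_le hx hvy.norm.integrable_sq fun _ => by positivity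
    rwa [Set.uIoc_of_ge hx.2.le] at this
  have h3 : ∫ t in Set.Ioc x y, ‖wronskian u v t • H.uGamma u γ t‖ ^ 2 =
      ∫ t in Set.Ioc x y, ‖(wronskian u v t / ((-H.rGamma u γ t : ℝ) : ℂ)) • u t‖ ^ 2 :=
    setIntegral_congr_fun measurableSet_Ioc fun t ht => by
      rw [h.div_smul_eq (hs (Set.Icc_subset_uIcc (Set.Ioc_subset_Icc_self ht)))]
  rw [Set.uIoc_of_ge hx.2.le, h3]
  refine h1.trans (add_le_add ?_ (mul_le_mul_of_nonneg_left h2 (by positivity)))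
  -- For σ = 1 and C = -r the boundary term at the moving left end x is -‖W(x)‖²/r(x), which is
  -- dropped.
  have hpos := h.rGamma_pos (γ := γ) hxI
  have : 0 ≤ ‖wronskian u v x‖ ^ 2 / H.rGamma u γ x := by positivity
  rw [one_mul, one_mul, div_neg, div_neg]
  linarith

/-- Near `b` the correction term is square integrable if the boundary Wronskian vanishes. -/
theorem l2NearB_wronskian_smul (h : H.IsSeed lam u) (hv : H.IsSolution z v) (hL : H.L2NearB v)
    (hW : Tendsto (wronskian u v) H.nearB (𝓝 0)) :
    H.L2NearB (fun x => wronskian u v x • H.uGamma u γ x) := by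
  have hE := DiracExpr.isEnd_right h.lt
  have := hE.neBot
  obtain ⟨y, hy, hvy⟩ := hL
  set K := ‖(lam : ℂ) - z‖ ^ 2 * ∫ t in H.rightPart y, ‖v t‖ ^ 2 with hK
  refine ⟨y, hy, hE.memLp_of_bounded (h.continuousOn_wronskian_smul hv) hy
    (M := 2 * K + 4 * K) ?_⟩
  filter_upwards [hE.mem y hy] with x hx
  have hxI := hE.sub y hy hx
  have hs := DiracExpr.uIcc_subset_I hy hxI
  have h1 := integral_sq_div_mul_le (σ := 1) (by norm_num) hx.1.le (h.sol.continuousOn.mono hs)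
    (hv.continuousOn.mono hs) (fun t ht => neg_ne_zero.2 (h.rGamma_pos (γ := γ) (hs ht)).ne')
    (h.hasACDeriv_neg_rGamma hy hxI) (h.sol.wronskian hv hy hxI)
  have h2 : ∫ t in Set.Ioc y x, ‖v t‖ ^ 2 ≤ ∫ t in H.rightPart y, ‖v t‖ ^ 2 := by
    have := hE.integral_uIoc_le hx hvy.norm.integrable_sq fun _ => by positivity
    rwa [Set.uIoc_of_le hx.1.le] at this
  have h3 : ∫ t in Set.Ioc y x, ‖wronskian u v t • H.uGamma u γ t‖ ^ 2 =
      ∫ t in Set.Ioc y x, ‖(wronskian u v t / ((-H.rGamma u γ t : ℝ) : ℂ)) • u t‖ ^ 2 :=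
    setIntegral_congr_fun measurableSet_Ioc fun t ht => by
      rw [h.div_smul_eq (hs (Set.Icc_subset_uIcc (Set.Ioc_subset_Icc_self ht)))]
  have hux := h.memLp_right hxI
  have hvx := hE.memLp_of_memLp hv.continuousOn hy hxI hvy
  -- Here the boundary term at the moving end is +‖W(x)‖²/r(x). Since W vanishes at b, W(x) is minus
  -- the integral of W' over (x,b). By Cauchy–Schwarz ‖W(x)‖² contains the factor ∫ ‖u‖² over (x,b),
  -- which is at most r(x).
  have h4 : ‖wronskian u v x‖ ≤ ‖(lam : ℂ) - z‖ * ∫ t in H.rightPart x, ‖u t‖ * ‖v t‖ := by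
    have h5 : ∀ᶠ x' in H.nearB, ‖wronskian u v x' - wronskian u v x‖ ≤
        ‖(lam : ℂ) - z‖ * ∫ t in H.rightPart x, ‖u t‖ * ‖v t‖ := by
      filter_upwards [hE.mem x hxI] with x' hx'
      have hx'I := hE.sub x hxI hx'
      rw [← (h.sol.wronskian hv hxI hx'I).integral_eq]
      refine intervalIntegral.norm_integral_le_integral_norm_uIoc.trans ?_
      rw [← integral_const_mul]
      refine le_trans ?_ (hE.integral_uIoc_le hx'
        ((DiracExpr.integrableOn_mul_norm hux hvx).const_mul _) fun t => by positivity)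
      refine integral_mono_of_nonneg (Eventually.of_forall fun _ => norm_nonneg _)
        (hE.integrableOn_uIoc hx' ((DiracExpr.integrableOn_mul_norm hux hvx).const_mul _))
        (Eventually.of_forall fun t => ?_)
      simp only [norm_mul]
      gcongr
      exact norm_spinorDot_le _ _
    have h6 := le_of_tendsto (hW.sub_const (wronskian u v x)).norm h5
    rwa [zero_sub, norm_neg] at h6
  have hpos := h.rGamma_pos (γ := γ) hxI
  have h7 : ‖wronskian u v x‖ ^ 2 / H.rGamma u γ x ≤ K := by
    rw [div_le_iff₀ hpos]
    have h8 : ∫ t in H.rightPart x, ‖v t‖ ^ 2 ≤ ∫ t in H.rightPart y, ‖v t‖ ^ 2 :=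
      setIntegral_mono_set hvy.norm.integrable_sq (Eventually.of_forall fun _ => by positivity)
        (hE.mono y x hx).eventuallyLE
    have h9 : ∫ t in H.rightPart x, ‖u t‖ ^ 2 ≤ H.rGamma u γ x :=
      le_add_of_nonneg_left ENNReal.toReal_nonneg
    have h0 : 0 ≤ ∫ t in H.rightPart x, ‖v t‖ ^ 2 := integral_nonneg fun _ => by positivity
    calc ‖wronskian u v x‖ ^ 2
        ≤ (‖(lam : ℂ) - z‖ * ∫ t in H.rightPart x, ‖u t‖ * ‖v t‖) ^ 2 := by gcongr
      _ = ‖(lam : ℂ) - z‖ ^ 2 * (∫ t in H.rightPart x, ‖u t‖ * ‖v t‖) ^ 2 := by ring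
      _ ≤ ‖(lam : ℂ) - z‖ ^ 2 *
          ((∫ t in H.rightPart x, ‖u t‖ ^ 2) * ∫ t in H.rightPart x, ‖v t‖ ^ 2) := by
          gcongr; exact sq_integral_mul_norm_le hux hvx
      _ ≤ ‖(lam : ℂ) - z‖ ^ 2 * (H.rGamma u γ x * ∫ t in H.rightPart y, ‖v t‖ ^ 2) :=
          mul_le_mul_of_nonneg_left (mul_le_mul h9 h8 h0 hpos.le) (by positivity)
      _ = K * H.rGamma u γ x := by rw [hK]; ring
  rw [Set.uIoc_of_le hx.1.le, h3]
  refine h1.trans (add_le_add ?_ ?_)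
  · have hposy := h.rGamma_pos (γ := γ) hy
    have : 0 ≤ ‖wronskian u v y‖ ^ 2 / H.rGamma u γ y := by positivity
    rw [one_mul, one_mul, div_neg, div_neg]
    linarith
  · rw [hK, ← mul_assoc]
    exact mul_le_mul_of_nonneg_left h2 (by positivity)

theorem wronskian_uGamma (H : DiracOperator) (u w : ℝ → Spinor) (γ : ℝ≥0∞) (x : ℝ) :
    wronskian (H.uGamma u γ) w x = (H.cGamma u γ x)⁻¹ * wronskian u w x := by
  simp only [wronskian, uGamma_apply]; ring

theorem wronskian_transform (H : DiracOperator) (u v : ℝ → Spinor) (γ : ℝ≥0∞) (α κ : ℂ) (x : ℝ) :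
    wronskian u (fun x => α • v x + κ • (wronskian u v x • H.uGamma u γ x)) x =
      α * wronskian u v x := by
  simp only [wronskian, uGamma_apply, PiLp.add_apply, PiLp.smul_apply, smul_eq_mul]; ring

/-- The transformation is reversible near `b`. -/
theorem l2NearB_of_transform (h : H.IsSeed lam u) (hv : H.IsSolution z v) {κ : ℂ}
    (hκ : κ * (z - lam) = 1)
    (hL : H.L2NearB (fun x => v x + κ • (wronskian u v x • H.uGamma u γ x))) :
    H.L2NearB v := by
  have hE := DiracExpr.isEnd_right h.lt
  set w : ℝ → Spinor := fun x => v x + κ • (wronskian u v x • H.uGamma u γ x) with hw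
  have hws : (H.dcExpr u γ).IsSolution z w := by
    have := h.isSolution_transform (γ := γ) hκ hv
    simpa only [one_smul] using this
  have hwW (x : ℝ) : wronskian u w x = wronskian u v x := by
    have := wronskian_transform H u v γ 1 κ x
    simpa only [one_smul, one_mul] using this
  have hcont := h.continuousOn_wronskian_smul (γ := γ) hv
  have hkey : H.L2NearB (fun x => wronskian u v x • H.uGamma u γ x) := by
    obtain ⟨y, hy, hwy⟩ := hL
    refine ⟨y, hy, hE.memLp_of_bounded hcont hy
      (M := 2 * (‖wronskian (H.uGamma u γ) w y‖ ^ 2 * H.rGamma u γ y) +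
        4 * ‖(lam : ℂ) - z‖ ^ 2 * ∫ t in H.rightPart y, ‖w t‖ ^ 2) ?_⟩
    filter_upwards [hE.mem y hy] with x hx
    have hxI := hE.sub y hy hx
    have hs := DiracExpr.uIcc_subset_I hy hxI
    -- With u_γ and C = -1/r the boundary term at the moving end is -‖W(u_γ,w)(x)‖² r(x), so no
    -- boundary condition is needed to bound the integral.
    have h1 := integral_sq_div_mul_le (σ := -1) (by norm_num) hx.1.le
      (h.continuousOn_uGamma.mono hs) (hws.continuousOn.mono hs)
      (fun t ht => neg_ne_zero.2 (inv_ne_zero (h.rGamma_pos (γ := γ) (hs ht)).ne'))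
      (h.hasACDeriv_neg_inv_rGamma hy hxI) (h.isSolution_uGamma.wronskian hws hy hxI)
    have h2 : ∫ t in Set.Ioc y x, ‖w t‖ ^ 2 ≤ ∫ t in H.rightPart y, ‖w t‖ ^ 2 := by
      have := hE.integral_uIoc_le hx hwy.norm.integrable_sq fun _ => by positivity
      rwa [Set.uIoc_of_le hx.1.le] at this
    have h3 : ∫ t in Set.Ioc y x, ‖wronskian u v t • H.uGamma u γ t‖ ^ 2 =
        ∫ t in Set.Ioc y x, ‖(wronskian (H.uGamma u γ) w t /
          ((-(H.rGamma u γ t)⁻¹ : ℝ) : ℂ)) • H.uGamma u γ t‖ ^ 2 :=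
      setIntegral_congr_fun measurableSet_Ioc fun t ht => by
        have htI := hs (Set.Icc_subset_uIcc (Set.Ioc_subset_Icc_self ht))
        have hc := h.cGamma_ne_zero (γ := γ) htI
        rw [wronskian_uGamma, hwW, ← inv_neg, Complex.ofReal_inv, ← h.cGamma_eq htI,
          div_inv_eq_mul, mul_comm, mul_inv_cancel_left₀ hc]
    rw [Set.uIoc_of_le hx.1.le, h3]
    refine h1.trans (add_le_add ?_ (mul_le_mul_of_nonneg_left h2 (by positivity)))
    have hpos := h.rGamma_pos (γ := γ) hxI
    have : 0 ≤ ‖wronskian (H.uGamma u γ) w x‖ ^ 2 * H.rGamma u γ x := by positivity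
    simp only [div_neg, div_inv_eq_mul]
    linarith
  have h1 := hE.l2NearEnd_linear (u := w) (S := H.rightPart)
    (v := fun x => wronskian u v x • H.uGamma u γ x) hcont hL hkey 1 (-κ)
  obtain ⟨c, hc, h2⟩ := h1
  refine ⟨c, hc, ?_⟩
  convert h2 using 1
  funext x
  simp only [hw, one_smul, neg_smul, add_neg_cancel_right]

/-- As u is square integrable near b but not on all of I, its energy must diverge at a. -/
theorem tendsto_rGamma_nearA (h : H.IsSeed lam u) (hn : ¬ MemLp u 2 (volume.restrict H.I)) :
    Tendsto (H.rGamma u γ) H.nearA atTop := by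
  have hE := DiracExpr.isEnd_left h.lt
  obtain ⟨c, hc⟩ := DiracExpr.nonempty_I h.lt
  have hni : ¬ IntegrableOn (fun t => ‖u t‖ ^ 2) (H.leftPart c) := by
    intro hi
    refine hn ?_
    rw [DiracExpr.memLp_iff h.sol.continuousOn subset_rfl DiracExpr.measurableSet_I]
    have hr := h.integrableOn_sq hc
    refine IntegrableOn.mono_set ((hi.union hr).union
      (integrableOn_singleton (f := fun t => ‖u t‖ ^ 2) (x := c) (by simp) (by simp))) fun t ht => ?_
    rcases lt_trichotomy t c with hlt | heq | hgt
    · exact Or.inl (Or.inl ⟨ht.1, hlt⟩)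
    · exact Or.inr heq
    · exact Or.inl (Or.inr ⟨hgt, ht.2⟩)
  have h1 := hE.tendsto_integral_atTop hc (h.sol.continuousOn.norm.pow 2)
    (fun _ => sq_nonneg _) hni
  refine tendsto_atTop_mono' _ ?_ h1
  filter_upwards [hE.mem c hc] with x hx
  rw [h.rGamma_sub (γ := γ) (hE.sub c hc hx) hc hx.2.le, Set.uIoc_of_ge hx.2.le]
  simpa using (h.rGamma_pos (γ := γ) hc).le

/-- W(u,v) grows at most like r^(1/2) while r diverges. This is the source of the boundary condition
for Φ_γ at a. -/
theorem tendsto_wronskian_div_nearA (h : H.IsSeed lam u) (hn : ¬ MemLp u 2 (volume.restrict H.I))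
    (hv : H.IsSolution z v) (hL : H.L2NearA v) :
    Tendsto (fun x => (H.cGamma u γ x)⁻¹ * wronskian u v x) H.nearA (𝓝 0) := by
  have hE := DiracExpr.isEnd_left h.lt
  obtain ⟨y, hy, hvy⟩ := hL
  refine (hE.tendsto_div_zero (C := fun t => -H.rGamma u γ t) hy h.sol.continuousOn hvy
    (fun x hx => h.sol.wronskian hv hy (hE.sub y hy hx)) ?_ fun x hx => ?_).congr' ?_
  · refine (h.tendsto_rGamma_nearA hn (γ := γ)).congr' ?_
    filter_upwards [hE.mem_I hy] with x hx
    rw [abs_neg, abs_of_pos (h.rGamma_pos hx)]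
  · have hxI := hE.sub y hy hx
    rw [abs_neg, abs_of_pos (h.rGamma_pos hxI), h.rGamma_sub hxI hy hx.2.le,
      Set.uIoc_of_ge hx.2.le]
    simpa using (h.rGamma_pos (γ := γ) hy).le
  · filter_upwards [hE.mem_I hy] with x hx
    rw [h.cGamma_eq hx, inv_mul_eq_div]

theorem tendsto_rGamma_nearB (h : H.IsSeed lam u) :
    Tendsto (H.rGamma u γ) H.nearB (𝓝 γ⁻¹.toReal) := by
  have hE := DiracExpr.isEnd_right h.lt
  obtain ⟨c, hc⟩ := DiracExpr.nonempty_I h.lt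
  have := (Complex.continuous_re.tendsto _).comp (h.tendsto_cGamma (γ := γ)).neg
  simp only [neg_neg, Complex.ofReal_re] at this
  refine this.congr' ?_
  filter_upwards [hE.mem_I hc] with x hx
  simp [h.cGamma_eq hx]

theorem integral_uGamma (h : H.IsSeed lam u) {x y : ℝ} (hy : y ∈ H.I) (hx : x ∈ H.rightPart y) :
    ∫ t in Set.uIoc y x, ‖H.uGamma u γ t‖ ^ 2 = (H.rGamma u γ x)⁻¹ - (H.rGamma u γ y)⁻¹ := by
  have hE := DiracExpr.isEnd_right h.lt
  have h1 := (h.hasACDeriv_neg_inv_rGamma (γ := γ) hy (hE.sub y hy hx)).integral_eq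
  rw [intervalIntegral.integral_of_le hx.1.le, integral_complex_ofReal, integral_const_mul] at h1
  rw [Set.uIoc_of_le hx.1.le]
  have h2 := congrArg Complex.re h1
  simp only [Complex.ofReal_re, Complex.sub_re] at h2
  linarith

/-- When 1/γ = 0, the energy of u_γ is 1/r up to a constant and diverges at b. Hence W(u_γ,w) is
negligible against 1/r, and multiplication by c = -r gives W(u,w). -/
theorem tendsto_wronskian_div_nearB (h : H.IsSeed lam u) (hγ : γ⁻¹.toReal = 0) {w : ℝ → Spinor}
    (hw : (H.dcExpr u γ).IsSolution z w) (hL : H.L2NearB w) :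
    Tendsto (wronskian u w) H.nearB (𝓝 0) := by
  have hE := DiracExpr.isEnd_right h.lt
  obtain ⟨y, hy, hwy⟩ := hL
  have key := (hE.tendsto_div_zero (C := fun t => -(H.rGamma u γ t)⁻¹) (f := H.uGamma u γ)
    (W := wronskian (H.uGamma u γ) w) hy h.continuousOn_uGamma hwy
    (fun x hx => h.isSolution_uGamma.wronskian hw hy (hE.sub y hy hx)) ?_ fun x hx => ?_)
  · refine key.congr' ?_
    filter_upwards [hE.mem_I hy] with x hx
    have hc := h.cGamma_ne_zero (γ := γ) hx
    rw [wronskian_uGamma, ← inv_neg, Complex.ofReal_inv, ← h.cGamma_eq hx,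
      div_inv_eq_mul, mul_comm, mul_inv_cancel_left₀ hc]
  · have h0 := h.tendsto_rGamma_nearB (γ := γ)
    rw [hγ] at h0
    have h1 : Tendsto (H.rGamma u γ) H.nearB (𝓝[>] 0) := by
      refine tendsto_nhdsWithin_iff.2 ⟨h0, ?_⟩
      filter_upwards [hE.mem_I hy] with x hx using h.rGamma_pos hx
    refine h1.inv_tendsto_nhdsGT_zero.congr' ?_
    filter_upwards [hE.mem_I hy] with x hx
    have := h.rGamma_pos (γ := γ) hx
    rw [abs_neg, abs_of_pos (inv_pos.2 this)]
    rfl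
  · have hxI := hE.sub y hy hx
    rw [abs_neg, abs_of_pos (inv_pos.2 (h.rGamma_pos hxI)), h.integral_uGamma hy hx]
    have := inv_pos.2 (h.rGamma_pos (γ := γ) hy)
    linarith

/-- The solution u_γ itself fails to be square integrable: its energy on (y,x) is 1/r(x) - 1/r(y),
and r tends to 0 at b. -/
theorem not_limitCircleB (h : H.IsSeed lam u) (hγ : γ⁻¹.toReal = 0) :
    ¬ (H.dcExpr u γ).LimitCircleB := by
  intro hlc
  have hE := DiracExpr.isEnd_right h.lt
  have := hE.neBot
  obtain ⟨y, hy, huy⟩ := hlc _ _ h.isSolution_uGamma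
  replace hy : y ∈ H.I := hy
  have h0 := h.tendsto_rGamma_nearB (γ := γ)
  rw [hγ] at h0
  have h1 : Tendsto (H.rGamma u γ) H.nearB (𝓝[>] 0) := by
    refine tendsto_nhdsWithin_iff.2 ⟨h0, ?_⟩
    filter_upwards [hE.mem_I hy] with x hx using h.rGamma_pos hx
  have h2 := h1.inv_tendsto_nhdsGT_zero
  obtain ⟨x, hx1, hx2⟩ := ((h2.eventually_gt_atTop ((H.rGamma u γ y)⁻¹ +
    ∫ t in H.rightPart y, ‖H.uGamma u γ t‖ ^ 2)).and (hE.mem y hy)).exists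
  have h3 := hE.integral_uIoc_le hx2 huy.norm.integrable_sq fun _ => by positivity
  rw [h.integral_uGamma hy hx2] at h3
  simp only [Pi.inv_apply] at hx1
  linarith

/-- Here r is bounded below by 1/γ > 0, so |u_γ| ≤ γ|u|. -/
theorem l2NearB_uGamma (h : H.IsSeed lam u) (hγ : γ⁻¹.toReal ≠ 0) : H.L2NearB (H.uGamma u γ) := by
  have hE := DiracExpr.isEnd_right h.lt
  obtain ⟨y, hy, huy⟩ := h.l2
  have hg : 0 < γ⁻¹.toReal := lt_of_le_of_ne ENNReal.toReal_nonneg hγ.symm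
  refine ⟨y, hy, hE.memLp_of_norm_le (u := u) (v := u) (K := γ⁻¹.toReal⁻¹)
    h.continuousOn_uGamma hy huy huy fun t ht => ?_⟩
  have htI := hE.sub y hy ht
  have h1 : γ⁻¹.toReal ≤ H.rGamma u γ t := le_add_of_nonneg_right (h.integral_pos htI).le
  rw [h.norm_uGamma htI, inv_mul_eq_div]
  gcongr
  linarith [norm_nonneg (u t)]

end IsSeed

end DiracOperator

/-! ### Transformation of domains near b and of the singular Weyl function -/

namespace DiracOperator

section WeylValue

variable {H : DiracOperator} {Φ Θ : ℂ → ℝ → Spinor} {z : ℂ}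

theorem InDomainNearB.of_eq_smul (hH : H.IsAdmissible) {u v : ℝ → Spinor} {k : ℂ}
    (hu : H.IsSolution z u) (hd : H.InDomainNearB u) (huv : ∀ x ∈ H.I, k • u x = v x) :
    H.InDomainNearB v := by
  have hE := DiracExpr.isEnd_right hH.1
  obtain ⟨c, hc⟩ := DiracExpr.nonempty_I hH.1
  have hv : H.IsSolution z v := (hu.linear hu k 0).congr fun x hx => by simp [huv x hx]
  refine inDomainNearB_of hH hv ?_ ?_
  · obtain ⟨d, hd, hud⟩ := hd.2.1
    exact DiracExpr.L2NearEnd.congr_ae hE.sub hE.meas ⟨d, hd, hud.const_smul k⟩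
      (Eventually.of_forall huv)
  · have h1 := hd.2.2.2.const_mul k
    rw [mul_zero] at h1
    refine h1.congr' ?_
    filter_upwards [hE.mem_I hc] with x hx
    simp only [wronskian, ← huv x hx, PiLp.smul_apply, smul_eq_mul]
    ring

theorem isSolution_psi (hsys : H.IsFundamentalSystem Φ Θ) (z w : ℂ) :
    H.IsSolution z (fun x => Θ z x + w • Φ z x) := by
  have := (hsys.2.1.1 z).linear (hsys.1.1 z) 1 w
  simpa only [one_smul] using this

theorem wronskian_phi_psi (hsys : H.IsFundamentalSystem Φ Θ) (z w : ℂ) {x : ℝ} (hx : x ∈ H.I) :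
    wronskian (Φ z) (fun x => Θ z x + w • Φ z x) x = -1 := by
  have := hsys.2.2.1 z x hx
  simp only [wronskian, PiLp.add_apply, PiLp.smul_apply, smul_eq_mul] at this ⊢
  linear_combination -this

theorem wronskian_theta_psi (hsys : H.IsFundamentalSystem Φ Θ) (z w : ℂ) {x : ℝ} (hx : x ∈ H.I) :
    wronskian (Θ z) (fun x => Θ z x + w • Φ z x) x = w := by
  have := hsys.2.2.1 z x hx
  simp only [wronskian, PiLp.add_apply, PiLp.smul_apply, smul_eq_mul] at this ⊢
  linear_combination w * this

theorem exists_ne_zero_of_wronskian {u v : ℝ → Spinor} {x : ℝ} (hx : x ∈ H.I)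
    (h : wronskian u v x ≠ 0) : ∃ x ∈ H.I, v x ≠ 0 :=
  ⟨x, hx, fun h0 => h (by simp [wronskian, h0])⟩

/-- `w` is the value of the singular Weyl function at `z` iff `Θ(z) + w Φ(z)` lies in the domain
near `b`. -/
theorem isWeylValue_iff (hH : H.IsAdmissible) (hsys : H.IsFundamentalSystem Φ Θ) {w : ℂ} :
    H.IsWeylValue Φ Θ z w ↔ H.InDomainNearB (fun x => Θ z x + w • Φ z x) := by
  obtain ⟨c, hc⟩ := DiracExpr.nonempty_I hH.1
  constructor
  · rintro ⟨u, ⟨hu, -, hud⟩, hw⟩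
    obtain ⟨hne, hwc⟩ := hw c hc
    -- Expanding u in the fundamental system gives u = -W(Φ,u) (Θ + wΦ).
    refine hud.of_eq_smul hH hu (k := (-wronskian (Φ z) u c)⁻¹) fun x hx => ?_
    have h1 := DiracExpr.IsSolution.eq_combination (hsys.2.1.1 z) (hsys.1.1 z) (hsys.2.2.1 z) hu
      hc x hx
    rw [h1, smul_add, smul_smul, smul_smul, wronskian_comm u (Φ z),
      inv_mul_cancel₀ (neg_ne_zero.2 hne), one_smul, hwc]
    congr 2
    field_simp
  · intro h
    refine ⟨_, ⟨isSolution_psi hsys z w, exists_ne_zero_of_wronskian (u := Φ z) hc ?_, h⟩,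
      fun x hx => ?_⟩
    · rw [wronskian_phi_psi hsys z w hc]; norm_num
    · rw [wronskian_phi_psi hsys z w hx, wronskian_theta_psi hsys z w hx]
      norm_num

end WeylValue

namespace IsCommutationData

variable {H : DiracOperator} {Φ Θ : ℂ → ℝ → Spinor} {lam : ℝ} {γ : ℝ≥0∞} {Wb z : ℂ}

theorem adm_gamma (h : H.IsCommutationData Φ Θ lam γ Wb) :
    (H.doubleCommutation (Θ lam) γ).IsAdmissible := h.seed.isAdmissible h.adm

/-- In the limit point case the generating function is 0 and the condition is vacuous, so only the
Wronskian with u_γ matters. -/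
theorem bcA_of (H : DiracOperator) (u f : ℝ → Spinor) (γ : ℝ≥0∞)
    (hf : Tendsto (wronskian (H.uGamma u γ) f) H.nearA (𝓝 0)) :
    (H.doubleCommutation u γ).BCA f := by
  by_cases hlc : (H.dcExpr u γ).LimitCircleA
  · have : (H.doubleCommutation u γ).wa = H.uGamma u γ := if_pos hlc
    rw [BCA, this]; exact hf
  · have : (H.doubleCommutation u γ).wa = 0 := if_neg hlc
    rw [BCA, this]
    exact tendsto_const_nhds.congr fun x => by simp [wronskian]

theorem bcB_of (H : DiracOperator) (u f : ℝ → Spinor) (γ : ℝ≥0∞)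
    (hf : (H.dcExpr u γ).LimitCircleB → Tendsto (wronskian (H.uGamma u γ) f) H.nearB (𝓝 0)) :
    (H.doubleCommutation u γ).BCB f := by
  by_cases hlc : (H.dcExpr u γ).LimitCircleB
  · have : (H.doubleCommutation u γ).wb = H.uGamma u γ := if_pos hlc
    rw [BCB, this]; exact hf hlc
  · have : (H.doubleCommutation u γ).wb = 0 := if_neg hlc
    rw [BCB, this]
    exact tendsto_const_nhds.congr fun x => by simp [wronskian]

/-- W(u_γ,Φ_γ(z)) = (z-λ) W(u,Φ(z))/c tends to 0 because c diverges; here Θ(λ) ∉ L²(I) enters. -/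
theorem inDomainNearA_phiGamma (h : H.IsCommutationData Φ Θ lam γ Wb) (z : ℂ) :
    (H.doubleCommutation (Θ lam) γ).InDomainNearA (H.phiGamma Φ (Θ lam) lam γ z) := by
  have hE := DiracExpr.isEnd_left h.adm.1
  have hΦ := h.sys.1.1 z
  have hL : H.L2NearA (Φ z) := (h.sys.2.2.2 z).2.2.2.1
  refine inDomainNearA_of h.adm_gamma (h.isSolution_phiGamma z) ?_ (bcA_of _ _ _ _ ?_)
  · exact hE.l2NearEnd_linear (h.seed.continuousOn_wronskian_smul hΦ) hL
      (h.seed.l2NearA_wronskian_smul hΦ hL) (z - lam) 1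
  · have h1 := (h.seed.tendsto_wronskian_div_nearA (γ := γ) h.not_l2 hΦ hL).const_mul
      (z - (lam : ℂ))
    rw [mul_zero] at h1
    refine h1.congr fun x => ?_
    rw [IsSeed.wronskian_uGamma, show H.phiGamma Φ (Θ lam) lam γ z = fun x => (z - (lam : ℂ)) • Φ z x + (1 : ℂ) •
      (wronskian (Θ lam) (Φ z) x • H.uGamma (Θ lam) γ x) from rfl, IsSeed.wronskian_transform]
    ring

theorem isFundamentalSystem (h : H.IsCommutationData Φ Θ lam γ Wb) :
    (H.doubleCommutation (Θ lam) γ).IsFundamentalSystem (H.phiGamma Φ (Θ lam) lam γ)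
      (H.thetaGamma Φ Θ lam γ Wb) := by
  refine ⟨⟨h.isSolution_phiGamma, fun x hx => differentiable_phiGamma h.sys hx,
    fun z x hx i => h.phiGamma_real z hx i⟩, ⟨h.isSolution_thetaGamma,
    fun x hx => h.differentiable_thetaGamma hx, fun z x hx i => h.thetaGamma_real z hx i⟩,
    fun z x hx => h.wronskian_thetaGamma_phiGamma z hx,
    fun z => ⟨h.isSolution_phiGamma z, ?_, h.inDomainNearA_phiGamma z⟩⟩
  obtain ⟨x, hx⟩ := DiracExpr.nonempty_I h.adm.1
  exact exists_ne_zero_of_wronskian (H := H) hx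
    (by rw [h.wronskian_thetaGamma_phiGamma z hx]; exact one_ne_zero)

variable {v : ℝ → Spinor} {κ : ℂ}

theorem isSolution_transform (h : H.IsCommutationData Φ Θ lam γ Wb) (hκ : κ * (z - lam) = 1)
    (hv : H.IsSolution z v) : (H.dcExpr (Θ lam) γ).IsSolution z
      (fun x => v x + κ • (wronskian (Θ lam) v x • H.uGamma (Θ lam) γ x)) := by
  have := h.seed.isSolution_transform (γ := γ) hκ hv
  simpa only [one_smul] using this

theorem wronskian_transform (u v : ℝ → Spinor) (γ : ℝ≥0∞) (κ : ℂ) (x : ℝ) :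
    wronskian u (fun x => v x + κ • (wronskian u v x • H.uGamma u γ x)) x = wronskian u v x := by
  have := IsSeed.wronskian_transform H u v γ 1 κ x
  simpa only [one_smul, one_mul] using this

theorem hasSolutionPairs (h : H.IsCommutationData Φ Θ lam γ Wb) : H.HasSolutionPairs :=
  h.sys.hasSolutionPairs

/-- Two functions in the domain near b have zero boundary Wronskian, so W_b(u,v) = 0. A boundary
condition for τ_γ at b occurs only if 1/γ ≠ 0; then c has a nonzero limit and dividing by it is
harmless. -/
theorem inDomainNearB_transform (h : H.IsCommutationData Φ Θ lam γ Wb) (hκ : κ * (z - lam) = 1)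
    (hv : H.IsSolution z v) (hvd : H.InDomainNearB v) :
    (H.doubleCommutation (Θ lam) γ).InDomainNearB
      (fun x => v x + κ • (wronskian (Θ lam) v x • H.uGamma (Θ lam) γ x)) := by
  have hE := DiracExpr.isEnd_right h.adm.1
  have hW := tendsto_wronskian_nearB h.adm h.hasSolutionPairs h.seed.sol hv h.domB hvd
  refine inDomainNearB_of h.adm_gamma (h.isSolution_transform hκ hv) ?_ (bcB_of _ _ _ _ fun hlc => ?_)
  · have := hE.l2NearEnd_linear (h.seed.continuousOn_wronskian_smul (γ := γ) hv) hvd.2.1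
      (h.seed.l2NearB_wronskian_smul hv hvd.2.1 hW) 1 κ
    simp only [one_smul] at this; exact this
  · have hγ : γ⁻¹.toReal ≠ 0 := fun h0 => h.seed.not_limitCircleB h0 hlc
    have h1 := (h.seed.tendsto_cGamma (γ := γ)).inv₀
      (neg_ne_zero.2 (Complex.ofReal_ne_zero.2 hγ)) |>.mul hW
    rw [mul_zero] at h1
    refine h1.congr fun x => ?_
    rw [IsSeed.wronskian_uGamma, wronskian_transform]

theorem inDomainNearB_uGamma (h : H.IsCommutationData Φ Θ lam γ Wb) (hγ : γ⁻¹.toReal ≠ 0) :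
    (H.doubleCommutation (Θ lam) γ).InDomainNearB (H.uGamma (Θ lam) γ) := by
  refine inDomainNearB_of h.adm_gamma h.seed.isSolution_uGamma (h.seed.l2NearB_uGamma hγ)
    (bcB_of _ _ _ _ fun _ => ?_)
  exact tendsto_const_nhds.congr fun x => (wronskian_self _ x).symm

/-- If 1/γ = 0 the growth of u_γ gives the claim. Otherwise u_γ lies in the domain near b, its
boundary Wronskian with w is zero, and c converges. -/
theorem tendsto_wronskian_of_transform (h : H.IsCommutationData Φ Θ lam γ Wb) {w : ℝ → Spinor}
    (hw : (H.dcExpr (Θ lam) γ).IsSolution z w)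
    (hd : (H.doubleCommutation (Θ lam) γ).InDomainNearB w) :
    Tendsto (wronskian (Θ lam) w) H.nearB (𝓝 0) := by
  by_cases hγ : γ⁻¹.toReal = 0
  · exact h.seed.tendsto_wronskian_div_nearB hγ hw hd.2.1
  · have hE := DiracExpr.isEnd_right h.adm.1
    obtain ⟨c, hc⟩ := DiracExpr.nonempty_I h.adm.1
    have h1 : Tendsto _ H.nearB _ := tendsto_wronskian_nearB h.adm_gamma
      h.isFundamentalSystem.hasSolutionPairs h.seed.isSolution_uGamma hw
      (h.inDomainNearB_uGamma hγ) hd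
    have h2 := (h.seed.tendsto_cGamma (γ := γ)).mul h1
    rw [mul_zero] at h2
    refine h2.congr' ?_
    filter_upwards [hE.mem_I hc] with x hx
    rw [IsSeed.wronskian_uGamma, mul_inv_cancel_left₀ (h.seed.cGamma_ne_zero hx)]

theorem inDomainNearB_of_transform (h : H.IsCommutationData Φ Θ lam γ Wb)
    (hκ : κ * (z - lam) = 1) (hv : H.IsSolution z v)
    (hd : (H.doubleCommutation (Θ lam) γ).InDomainNearB
      (fun x => v x + κ • (wronskian (Θ lam) v x • H.uGamma (Θ lam) γ x))) :
    H.InDomainNearB v := by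
  have hE := DiracExpr.isEnd_right h.adm.1
  obtain ⟨c, hc⟩ := DiracExpr.nonempty_I h.adm.1
  have hL := h.seed.l2NearB_of_transform hv hκ hd.2.1
  refine inDomainNearB_of h.adm hv hL ?_
  have hW : Tendsto (wronskian (Θ lam) v) H.nearB (𝓝 0) :=
    (h.tendsto_wronskian_of_transform (h.isSolution_transform hκ hv) hd).congr fun x =>
      wronskian_transform _ _ _ _ _
  by_cases hlc : H.LimitCircleB
  -- Since u itself satisfies the condition given by `wb`, the functions u and `wb` generate the
  -- same boundary condition, and v satisfies the one given by u.
  · obtain ⟨⟨μ, hμ⟩, -, -⟩ := h.adm.2.2.2.2.2.2.2.1 hlc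
    refine hE.tendsto_wronskian_zero_of_limitCircle hlc h.hasSolutionPairs (w := Θ lam)
      ⟨⟨lam, h.seed.sol⟩, ⟨c, hc, h.seed.ne_zero c hc⟩, h.seed.real⟩ hμ hv ?_ hW
    have := h.domB.2.2.2.neg
    rw [neg_zero] at this
    exact this.congr fun x => (wronskian_comm _ _ _).symm
  · rw [BCB, h.adm.2.2.2.2.2.2.2.2 hlc]
    exact tendsto_const_nhds.congr fun x => by simp [wronskian]

/-- The transformation of `Θ(z) + w Φ(z)`. -/
theorem psi_transform (h : H.IsCommutationData Φ Θ lam γ Wb) (hz : z ≠ lam) {Ψ : ℝ → Spinor}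
    {w wγ : ℂ} (hw : wγ = (w + Wb * (z - lam)) / (z - lam) ^ 2
      - ((γ⁻¹.toReal : ℝ) : ℂ) / (z - lam)) (hΨ : ∀ x, Ψ x = Θ z x + w • Φ z x) {x : ℝ}
    (hx : x ∈ H.I) :
    (1 / (z - (lam : ℂ))) • (Ψ x + (1 / (z - (lam : ℂ))) •
      (wronskian (Θ lam) Ψ x • H.uGamma (Θ lam) γ x)) =
    H.thetaGamma Φ Θ lam γ Wb z x + wγ • H.phiGamma Φ (Θ lam) lam γ z x := by
  have hz' := sub_ne_zero.2 hz
  rw [h.thetaGamma_eq hx hz, hw]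
  refine Spinor.ext' ?_ ?_ <;>
  · simp only [wronskian, hΨ x, phiGamma, PiLp.add_apply, PiLp.smul_apply, smul_eq_mul]
    field_simp
    ring

/-- Up to the factor z - λ, the transform of Θ + wΦ is Θ_γ + w_γ Φ_γ, and the transformation
preserves and reflects the domain near b. -/
theorem isWeylValue_iff_gamma (h : H.IsCommutationData Φ Θ lam γ Wb) (hz : z ≠ lam) {w wγ : ℂ}
    (hw : wγ = (w + Wb * (z - lam)) / (z - lam) ^ 2 - ((γ⁻¹.toReal : ℝ) : ℂ) / (z - lam)) :
    (H.doubleCommutation (Θ lam) γ).IsWeylValue (H.phiGamma Φ (Θ lam) lam γ)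
      (H.thetaGamma Φ Θ lam γ Wb) z wγ ↔ H.IsWeylValue Φ Θ z w := by
  have hz' := sub_ne_zero.2 hz
  have hκ : 1 / (z - (lam : ℂ)) * (z - lam) = 1 := by field_simp
  have hs := isSolution_psi h.sys z w
  rw [isWeylValue_iff h.adm_gamma h.isFundamentalSystem, isWeylValue_iff h.adm h.sys]
  constructor
  · refine fun hd => h.inDomainNearB_of_transform hκ hs (hd.of_eq_smul h.adm_gamma
      (isSolution_psi h.isFundamentalSystem z wγ) (k := z - lam) fun x hx => ?_)
    rw [← h.psi_transform hz hw (fun _ => rfl) hx, smul_smul, mul_one_div_cancel hz', one_smul]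
  · exact fun hd => (h.inDomainNearB_transform hκ hs hd).of_eq_smul h.adm_gamma
      (h.isSolution_transform hκ hs) (k := 1 / (z - lam)) fun x hx =>
        h.psi_transform hz hw (fun _ => rfl) hx

theorem mem_weylDomain_iff (h : H.IsCommutationData Φ Θ lam γ Wb) (hz : z ≠ lam) :
    z ∈ (H.doubleCommutation (Θ lam) γ).weylDomain (H.phiGamma Φ (Θ lam) lam γ)
      (H.thetaGamma Φ Θ lam γ Wb) ↔ z ∈ H.weylDomain Φ Θ := by
  have hz' := sub_ne_zero.2 hz
  constructor
  · rintro ⟨w, hw⟩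
    -- The preimage of w under the affine map w ↦ w_γ.
    refine ⟨w * (z - lam) ^ 2 + ((γ⁻¹.toReal : ℝ) : ℂ) * (z - lam) - Wb * (z - lam),
      (h.isWeylValue_iff_gamma hz ?_).1 hw⟩
    field_simp
    ring
  · rintro ⟨w, hw⟩
    exact ⟨_, (h.isWeylValue_iff_gamma hz rfl).2 hw⟩

theorem weyl_transform (h : H.IsCommutationData Φ Θ lam γ Wb) (hz : z ≠ lam)
    (hd : z ∈ H.weylDomain Φ Θ) :
    ∃ Ψ Ψγ : ℝ → Spinor, ∃ Mγ : ℂ,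
      (∀ x, Ψ x = Θ z x + H.singularWeyl Φ Θ z • Φ z x) ∧
      (∀ x, Ψγ x = (1 / (z - lam)) • (Ψ x + (1 / (z - lam)) •
        (wronskian (Θ (lam : ℂ)) Ψ x • H.uGamma (Θ (lam : ℂ)) γ x))) ∧
      Mγ = (H.singularWeyl Φ Θ z + Wb * (z - lam)) / (z - lam) ^ 2
        - ((γ⁻¹.toReal : ℝ) : ℂ) / (z - lam) ∧
      (H.doubleCommutation (Θ (lam : ℂ)) γ).IsWeylSolutionB z Ψγ ∧
      (∀ x ∈ H.I, Ψγ x = H.thetaGamma Φ Θ lam γ Wb z x +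
        Mγ • H.phiGamma Φ (Θ lam) lam γ z x) ∧
      (H.doubleCommutation (Θ (lam : ℂ)) γ).singularWeyl (H.phiGamma Φ (Θ lam) lam γ)
        (H.thetaGamma Φ Θ lam γ Wb) z = Mγ := by
  obtain ⟨w, hw⟩ := hd
  have hwe := hw.singularWeyl_eq h.adm h.hasSolutionPairs
  refine ⟨_, _, _, fun _ => rfl, fun _ => rfl, rfl, ?_, fun x hx => ?_, ?_⟩
  · rw [hwe]
    have hz' := sub_ne_zero.2 hz
    have hκ : 1 / (z - (lam : ℂ)) * (z - lam) = 1 := by field_simp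
    have hs := isSolution_psi h.sys z w
    have hs' := h.isSolution_transform (γ := γ) hκ hs
    obtain ⟨c, hc⟩ := DiracExpr.nonempty_I h.adm.1
    refine ⟨(hs'.linear hs' (1 / (z - lam)) 0).congr fun x hx => ?_, ?_,
      (h.inDomainNearB_transform hκ hs ((isWeylValue_iff h.adm h.sys).1 hw)).of_eq_smul
        h.adm_gamma hs' fun _ _ => rfl⟩
    · simp only [zero_smul, add_zero]
    · refine exists_ne_zero_of_wronskian (u := H.phiGamma Φ (Θ lam) lam γ z) hc ?_
      have h1 := wronskian_phi_psi h.isFundamentalSystem z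
        ((w + Wb * (z - lam)) / (z - lam) ^ 2 - ((γ⁻¹.toReal : ℝ) : ℂ) / (z - lam)) hc
      rw [wronskian] at h1 ⊢
      rw [h.psi_transform hz rfl (fun _ => rfl) hc, h1]
      norm_num
  · exact h.psi_transform hz rfl (fun _ => rfl) hx
  · rw [hwe]
    exact ((h.isWeylValue_iff_gamma hz rfl).2 hw).singularWeyl_eq h.adm_gamma
      h.isFundamentalSystem.hasSolutionPairs

end IsCommutationData

end DiracOperator

/-! ### Existence of Weyl solutions at b off the real line and off the spectrum -/

namespace DiracExpr

variable {T : DiracExpr}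

/-- A solution on a subinterval is a linear combination of a fundamental pair. -/
theorem IsSolOn.eq_combination {S : Set ℝ} (hS : S.OrdConnected) (hSI : S ⊆ T.I) {z : ℂ}
    {θ φ v : ℝ → Spinor} (hθ : T.IsSolution z θ) (hφ : T.IsSolution z φ)
    (hW : ∀ x ∈ T.I, _root_.wronskian θ φ x = 1) (hv : T.IsSolOn S (fun t => z • v t) v)
    {x₀ : ℝ} (hx₀ : x₀ ∈ S) :
    ∀ x ∈ S, _root_.wronskian v φ x₀ • θ x + _root_.wronskian θ v x₀ • φ x = v x := by
  intro x hx
  rw [hv.wronskian_eq_of_eq hS ((isSolution_iff.1 hφ).mono hSI) hx₀ hx,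
    ((isSolution_iff.1 hθ).mono hSI).wronskian_eq_of_eq hS hv hx₀ hx, ← wronskian_smul_eq,
    hW x (hSI hx), one_smul]

/-- The part `(a, c]` of the interval. -/
def leftClosed (T : DiracExpr) (c : ℝ) : Set ℝ := {x : ℝ | T.a < (x : EReal) ∧ x ≤ c}

/-- The part `[c, b)` of the interval. -/
def rightClosed (T : DiracExpr) (c : ℝ) : Set ℝ := {x : ℝ | c ≤ x ∧ (x : EReal) < T.b}

theorem ordConnected_leftClosed (c : ℝ) : (T.leftClosed c).OrdConnected :=
  ⟨fun _ hx _ hy _ ht => ⟨hx.1.trans_le (EReal.coe_le_coe_iff.2 ht.1), ht.2.trans hy.2⟩⟩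

theorem ordConnected_rightClosed (c : ℝ) : (T.rightClosed c).OrdConnected :=
  ⟨fun _ hx _ hy _ ht => ⟨hx.1.trans ht.1, (EReal.coe_le_coe_iff.2 ht.2).trans_lt hy.2⟩⟩

theorem leftClosed_subset {c : ℝ} (hc : c ∈ T.I) : T.leftClosed c ⊆ T.I :=
  fun _ hx => ⟨hx.1, (EReal.coe_le_coe_iff.2 hx.2).trans_lt hc.2⟩

theorem rightClosed_subset {c : ℝ} (hc : c ∈ T.I) : T.rightClosed c ⊆ T.I :=
  fun _ hx => ⟨hc.1.trans_le (EReal.coe_le_coe_iff.2 hx.1), hx.2⟩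

theorem leftPart_subset_leftClosed (c : ℝ) : T.leftPart c ⊆ T.leftClosed c :=
  fun _ hx => ⟨hx.1, hx.2.le⟩

theorem rightPart_subset_rightClosed (c : ℝ) : T.rightPart c ⊆ T.rightClosed c :=
  fun _ hx => ⟨hx.1.le, hx.2⟩

theorem exists_rightPart {c : ℝ} (hc : c ∈ T.I) : ∃ d ∈ T.I, c < d := by
  obtain ⟨d, h1, h2⟩ := EReal.lt_iff_exists_real_btwn.1 hc.2
  exact ⟨d, ⟨hc.1.trans h1, h2⟩, EReal.coe_lt_coe_iff.1 h1⟩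

/-- Lagrange identity for v̄, a solution for z̄, and v: the Wronskian form measures energy. -/
theorem IsSolution.conj_wronskian {z : ℂ} {v : ℝ → Spinor} (hv : T.IsSolution z v) {x y : ℝ}
    (hx : x ∈ T.I) (hy : y ∈ T.I) (hxy : x ≤ y) :
    _root_.wronskian (fun t => (v t).conj) v y - _root_.wronskian (fun t => (v t).conj) v x =
      ((starRingEnd ℂ) z - z) * ((∫ t in Set.Ioc x y, ‖v t‖ ^ 2 : ℝ) : ℂ) := by
  rw [← (hv.conj.wronskian hv hx hy).integral_eq, intervalIntegral.integral_of_le hxy,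
    integral_const_mul, ← integral_complex_ofReal]
  simp only [spinorDot_conj_self]

end DiracExpr

namespace DiracOperator

variable {H : DiracOperator} {Φ Θ : ℂ → ℝ → Spinor} {z : ℂ}

theorem IsFundamentalSystem.phi_ne_zero (hsys : H.IsFundamentalSystem Φ Θ) (z : ℂ) {x : ℝ}
    (hx : x ∈ H.I) : Φ z x ≠ 0 := fun h0 => by
  have := hsys.2.2.1 z x hx
  simp [wronskian, h0] at this

theorem IsFundamentalSystem.phi_conj (hsys : H.IsFundamentalSystem Φ Θ) (z : ℂ) {x : ℝ}
    (hx : x ∈ H.I) : Φ ((starRingEnd ℂ) z) x = (Φ z x).conj :=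
  Spinor.ext' (hsys.1.2.2 z x hx 0) (hsys.1.2.2 z x hx 1)

theorem IsFundamentalSystem.integral_phi_pos (hsys : H.IsFundamentalSystem Φ Θ) (z : ℂ) {x y : ℝ}
    (hx : x ∈ H.I) (hy : y ∈ H.I) (hxy : x < y) : 0 < ∫ t in Set.Ioc x y, ‖Φ z t‖ ^ 2 := by
  have hs : Set.Ioc x y ⊆ H.I :=
    (Set.Ioc_subset_Icc_self.trans Set.Icc_subset_uIcc).trans (DiracExpr.uIcc_subset_I hx hy)
  rw [setIntegral_pos_iff_support_of_nonneg_ae (Eventually.of_forall fun t => by positivity)]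
  · have hsub : Set.Ioc x y ⊆ (Function.support fun t => ‖Φ z t‖ ^ 2) ∩ Set.Ioc x y :=
      fun t ht => ⟨by simpa using hsys.phi_ne_zero z (hs ht), ht⟩
    refine lt_of_lt_of_le ?_ (measure_mono hsub)
    rw [Real.volume_Ioc, ENNReal.ofReal_pos]
    linarith
  · have := DiracExpr.memLp_uIcc (hsys.1.1 z).continuousOn hx hy
    exact this.norm.integrable_sq.mono_measure
      (Measure.restrict_mono (Set.Ioc_subset_Icc_self.trans Set.Icc_subset_uIcc) le_rfl)

/-- The boundary behaviour at `a` of the Wronskian of `Φ(z)` and its complex conjugate. -/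
theorem IsFundamentalSystem.tendsto_conj_wronskian (hH : H.IsAdmissible)
    (hsys : H.IsFundamentalSystem Φ Θ) (z : ℂ) :
    Tendsto (wronskian (fun t => (Φ z t).conj) (Φ z)) H.nearA (𝓝 0) := by
  obtain ⟨c, hc⟩ := DiracExpr.nonempty_I hH.1
  refine (tendsto_wronskian_nearA hH hsys.hasSolutionPairs (hsys.1.1 ((starRingEnd ℂ) z))
    (hsys.1.1 z) (hsys.2.2.2 _).2.2 (hsys.2.2.2 z).2.2).congr' ?_
  filter_upwards [(DiracExpr.isEnd_left hH.1).mem_I hc] with x hx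
  simp only [wronskian, hsys.phi_conj z hx]

theorem InDomainNearB.conj (hH : H.IsAdmissible) {v : ℝ → Spinor} (hv : H.IsSolution z v)
    (hd : H.InDomainNearB v) : H.InDomainNearB (fun t => (v t).conj) := by
  have hE := DiracExpr.isEnd_right hH.1
  obtain ⟨c, hc⟩ := DiracExpr.nonempty_I hH.1
  refine inDomainNearB_of hH hv.conj ?_ ?_
  · obtain ⟨d, hd, hvd⟩ := hd.2.1
    rw [DiracExpr.memLp_iff hv.continuousOn (hE.sub d hd) (hE.meas d)] at hvd
    refine ⟨d, hd, ?_⟩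
    rw [DiracExpr.memLp_iff hv.conj.continuousOn (hE.sub d hd) (hE.meas d)]
    simpa only [Spinor.norm_conj] using hvd
  · by_cases hlc : H.LimitCircleB
    · have hr := (hH.2.2.2.2.2.2.2.1 hlc).2.2
      have := (Complex.continuous_conj.tendsto _).comp hd.2.2.2
      rw [map_zero] at this
      refine this.congr' ?_
      filter_upwards [hE.mem_I hc] with x hx
      simp [wronskian, hr x hx]
    · rw [BCB, hH.2.2.2.2.2.2.2.2 hlc]
      exact tendsto_const_nhds.congr fun x => by simp [wronskian]

theorem conj_sub_ne_zero (hz : z.im ≠ 0) : (starRingEnd ℂ) z - z ≠ 0 :=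
  fun h0 => hz (Complex.conj_eq_iff_im.1 (sub_eq_zero.1 h0))

theorem IsFundamentalSystem.re_conj_wronskian_lt (hsys : H.IsFundamentalSystem Φ Θ)
    (hz : z.im ≠ 0) {x y : ℝ} (hx : x ∈ H.I) (hy : y ∈ H.I) (hxy : x < y) :
    (wronskian (fun t => (Φ z t).conj) (Φ z) x / ((starRingEnd ℂ) z - z)).re <
      (wronskian (fun t => (Φ z t).conj) (Φ z) y / ((starRingEnd ℂ) z - z)).re := by
  have h1 := (hsys.1.1 z).conj_wronskian hx hy hxy.le
  have h2 : (wronskian (fun t => (Φ z t).conj) (Φ z) y / ((starRingEnd ℂ) z - z)).re -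
      (wronskian (fun t => (Φ z t).conj) (Φ z) x / ((starRingEnd ℂ) z - z)).re =
      ∫ t in Set.Ioc x y, ‖Φ z t‖ ^ 2 := by
    rw [← Complex.sub_re, ← sub_div, h1, mul_div_cancel_left₀ _ (conj_sub_ne_zero hz),
      Complex.ofReal_re]
  linarith [hsys.integral_phi_pos z hx hy hxy]

theorem tendsto_re_div {W : ℝ → ℂ} {l : Filter ℝ} (h : Tendsto W l (𝓝 0)) (w : ℂ) :
    Tendsto (fun x => (W x / w).re) l (𝓝 0) := by
  have := (Complex.continuous_re.tendsto _).comp (h.div_const w)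
  rw [zero_div, Complex.zero_re] at this
  exact this

/-- The form is strictly increasing in x and tends to 0 at a, where both Φ(z) and its conjugate
Φ(z̄) lie in the domain. -/
theorem IsFundamentalSystem.re_conj_wronskian_pos (hH : H.IsAdmissible)
    (hsys : H.IsFundamentalSystem Φ Θ) (hz : z.im ≠ 0) {x : ℝ} (hx : x ∈ H.I) :
    0 < (wronskian (fun t => (Φ z t).conj) (Φ z) x / ((starRingEnd ℂ) z - z)).re := by
  have hE := DiracExpr.isEnd_left hH.1
  have := hE.neBot
  obtain ⟨y, hy⟩ := Filter.nonempty_of_mem (hE.mem x hx)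
  have hyI := hE.sub x hx hy
  refine lt_of_le_of_lt (le_of_tendsto (tendsto_re_div (hsys.tendsto_conj_wronskian hH z)
    ((starRingEnd ℂ) z - z)) ?_) (hsys.re_conj_wronskian_lt hz hyI hx hy.2)
  filter_upwards [hE.mem y hyI] with t ht using
    (hsys.re_conj_wronskian_lt hz (hE.sub y hyI ht) hyI ht.2).le

/-- For nonreal `z` the solution `Φ(z)` is not in the domain near `b`. -/
theorem IsFundamentalSystem.not_inDomainNearB (hH : H.IsAdmissible)
    (hsys : H.IsFundamentalSystem Φ Θ) (hz : z.im ≠ 0) : ¬ H.InDomainNearB (Φ z) := by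
  intro hd
  have hE := DiracExpr.isEnd_right hH.1
  have := hE.neBot
  have hΦ := hsys.1.1 z
  obtain ⟨c, hc⟩ := DiracExpr.nonempty_I hH.1
  -- Membership in the domain near b would make the form tend to 0 at b as well, although it is
  -- positive and increasing.
  refine (hsys.re_conj_wronskian_pos hH hz hc).not_ge (ge_of_tendsto (tendsto_re_div
    (tendsto_wronskian_nearB hH hsys.hasSolutionPairs hΦ.conj hΦ (hd.conj hH hΦ) hd)
    ((starRingEnd ℂ) z - z)) ?_)
  filter_upwards [hE.mem c hc] with t ht using
    (hsys.re_conj_wronskian_lt hz hc (hE.sub c hc ht) ht.1).le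

/-- For nonreal `z` the first component of `Φ(z)` does not vanish. -/
theorem IsFundamentalSystem.phi_apply_zero_ne_zero (hH : H.IsAdmissible)
    (hsys : H.IsFundamentalSystem Φ Θ) (hz : z.im ≠ 0) {x : ℝ} (hx : x ∈ H.I) :
    Φ z x 0 ≠ 0 := by
  intro h0
  have := hsys.re_conj_wronskian_pos hH hz hx
  simp [wronskian, h0] at this

/-- For nonreal `z` there is a nontrivial solution that is square integrable near `b`. -/
theorem IsFundamentalSystem.exists_l2NearB (hH : H.IsAdmissible)
    (hsys : H.IsFundamentalSystem Φ Θ) (hz : z.im ≠ 0) :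
    ∃ p : ℂ × ℂ, p ≠ 0 ∧ H.L2NearB (fun t => p.1 • Θ z t + p.2 • Φ z t) := by
  have hE := DiracExpr.isEnd_right hH.1
  have := hE.neBot
  obtain ⟨c, hc⟩ := DiracExpr.nonempty_I hH.1
  have hz' : (starRingEnd ℂ) z - z ≠ 0 := fun h0 => hz (Complex.conj_eq_iff_im.1 (sub_eq_zero.1 h0))
  set v : ℂ × ℂ → ℝ → Spinor := fun p t => p.1 • Θ z t + p.2 • Φ z t with hv
  have hvs (p : ℂ × ℂ) : H.IsSolution z (v p) := (hsys.2.1.1 z).linear (hsys.1.1 z) p.1 p.2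
  set W : ℂ × ℂ → ℝ → ℂ := fun p => wronskian (fun t => (v p t).conj) (v p) with hW
  have hWc (x : ℝ) : Continuous fun p => W p x := by
    simp only [hW, hv, wronskian, Spinor.conj_zero, Spinor.conj_one, PiLp.add_apply,
      PiLp.smul_apply, smul_eq_mul]
    have := Complex.continuous_conj
    fun_prop
  have hWn (p : ℂ × ℂ) {x : ℝ} (hx : x ∈ H.rightPart c) :
      ‖W p x - W p c‖ = ‖(starRingEnd ℂ) z - z‖ * ∫ t in Set.uIoc c x, ‖v p t‖ ^ 2 := by
    rw [Set.uIoc_of_le hx.1.le]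
    simp only [hW]
    rw [(hvs p).conj_wronskian hc (hE.sub c hc hx) hx.1.le, norm_mul, Complex.norm_real,
      Real.norm_of_nonneg (integral_nonneg fun _ => by positivity)]
  set K := (‖Θ z c‖ + ‖Φ z c‖) ^ 2 with hK
  -- A compactness version of Weyl's nested discs: the normalised coefficient pairs whose solution
  -- has energy on (c,x) below a fixed bound form compact sets that decrease as x moves to b.
  set s : H.rightPart c → Set (ℂ × ℂ) := fun x => {p ∈ Metric.sphere 0 1 | ‖W p x - W p c‖ ≤ K}
    with hs
  obtain ⟨x₀, hx₀⟩ : (H.rightPart c).Nonempty := Filter.nonempty_of_mem (hE.mem c hc)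
  have : Nonempty (H.rightPart c) := ⟨⟨x₀, hx₀⟩⟩
  have hcl (x : H.rightPart c) : IsClosed (s x) :=
    Metric.isClosed_sphere.inter (isClosed_le ((hWc x).sub (hWc c)).norm continuous_const)
  have hmono (p : ℂ × ℂ) {x y : ℝ} (hx : x ∈ H.rightPart c) (hy : y ∈ H.rightPart c)
      (hxy : x ≤ y) : ‖W p x - W p c‖ ≤ ‖W p y - W p c‖ := by
    rw [hWn p hx, hWn p hy]
    refine mul_le_mul_of_nonneg_left (setIntegral_mono_set ?_
      (Eventually.of_forall fun _ => by positivity) ?_) (norm_nonneg _)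
    · exact ((DiracExpr.memLp_uIcc (hvs p).continuousOn hc (hE.sub c hc hy)).norm.integrable_sq).mono_measure
        (Measure.restrict_mono Set.uIoc_subset_uIcc le_rfl)
    · rw [Set.uIoc_of_le hx.1.le, Set.uIoc_of_le hy.1.le]
      exact (Set.Ioc_subset_Ioc_right hxy).eventuallyLE
  have hne (x : H.rightPart c) : (s x).Nonempty := by
    obtain ⟨x, hx⟩ := x
    have hxI := hE.sub c hc hx
    -- The combination whose first component vanishes at x. Its form vanishes at x, so the energy on
    -- (c,x) is governed by the value at c alone, which K bounds.
    set q : ℂ × ℂ := (Φ z x 0, -Θ z x 0) with hq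
    have hq0 : q ≠ 0 := by
      intro h0
      have h1 := congrArg Prod.fst h0
      have h2 := congrArg Prod.snd h0
      simp only [hq, Prod.fst_zero, Prod.snd_zero, neg_eq_zero] at h1 h2
      have := hsys.2.2.1 z x hxI
      rw [wronskian, h1, h2] at this
      simp at this
    have hqn : ‖q‖ ≠ 0 := norm_ne_zero_iff.2 hq0
    set p : ℂ × ℂ := (‖q‖⁻¹ : ℂ) • q with hp
    have hpn : ‖p‖ = 1 := by
      rw [hp, norm_smul, norm_inv, Complex.norm_real, norm_norm, inv_mul_cancel₀ hqn]
    refine ⟨p, by simpa using hpn, ?_⟩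
    have h0 : v p x 0 = 0 := by
      simp only [hv, hp, hq, Prod.smul_fst, Prod.smul_snd, PiLp.add_apply, PiLp.smul_apply,
        smul_eq_mul]
      ring
    have h1 : W p x = 0 := by
      simp only [hW, wronskian, Spinor.conj_zero, Spinor.conj_one, h0]
      simp
    show ‖W p x - W p c‖ ≤ K
    rw [h1, zero_sub, norm_neg]
    refine (norm_wronskian_le _ _ _).trans ?_
    rw [Spinor.norm_conj, ← sq]
    have h2 : ‖v p c‖ ≤ ‖Θ z c‖ + ‖Φ z c‖ := by
      refine (norm_add_le _ _).trans ?_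
      rw [norm_smul, norm_smul]
      have e1 : ‖p.1‖ ≤ 1 := hpn ▸ norm_fst_le p
      have e2 : ‖p.2‖ ≤ 1 := hpn ▸ norm_snd_le p
      nlinarith [norm_nonneg (Θ z c), norm_nonneg (Φ z c)]
    exact pow_le_pow_left₀ (norm_nonneg _) h2 2
  obtain ⟨p, hp⟩ := IsCompact.nonempty_iInter_of_directed_nonempty_isCompact_isClosed s
    (fun x y => by
      rcases le_total x y with hxy | hxy
      · exact ⟨y, fun p hp => ⟨hp.1, (hmono p x.2 y.2 hxy).trans hp.2⟩, subset_rfl⟩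
      · exact ⟨x, subset_rfl, fun p hp => ⟨hp.1, (hmono p y.2 x.2 hxy).trans hp.2⟩⟩)
    hne (fun x => (isCompact_sphere _ _).of_isClosed_subset (hcl x) fun p hp => hp.1) hcl
  rw [Set.mem_iInter] at hp
  refine ⟨p, ?_, c, hc, hE.memLp_of_bounded (hvs p).continuousOn hc
    (M := K / ‖(starRingEnd ℂ) z - z‖) ?_⟩
  · rintro rfl
    have := (hp ⟨x₀, hx₀⟩).1
    simp at this
  · filter_upwards [hE.mem c hc] with x hx
    rw [le_div_iff₀ (norm_pos_iff.2 hz'), mul_comm, ← hWn p hx]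
    exact (hp ⟨x, hx⟩).2

theorem mem_weylDomain_of_combination (hH : H.IsAdmissible) (hsys : H.IsFundamentalSystem Φ Θ)
    {α β : ℂ} (hα : α ≠ 0) (hd : H.InDomainNearB (fun t => α • Θ z t + β • Φ z t)) :
    z ∈ H.weylDomain Φ Θ := by
  refine ⟨α⁻¹ * β, (isWeylValue_iff hH hsys).2 (hd.of_eq_smul hH
    ((hsys.2.1.1 z).linear (hsys.1.1 z) α β) (k := α⁻¹) fun x _ => ?_)⟩
  rw [smul_add, smul_smul, smul_smul, inv_mul_cancel₀ hα, one_smul]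

/-- Some nontrivial combination αΘ + βΦ lies in the domain near b, and α ≠ 0 because Φ(z) does not
lie there for nonreal z. -/
theorem mem_weylDomain_of_im_ne_zero (hH : H.IsAdmissible) (hsys : H.IsFundamentalSystem Φ Θ)
    (hz : z.im ≠ 0) : z ∈ H.weylDomain Φ Θ := by
  have hE := DiracExpr.isEnd_right hH.1
  have hθ := hsys.2.1.1 z
  have hφ := hsys.1.1 z
  obtain ⟨p, hp, hd⟩ : ∃ p : ℂ × ℂ, p ≠ 0 ∧ H.InDomainNearB (fun t => p.1 • Θ z t + p.2 • Φ z t) := by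
    by_cases hlc : H.LimitCircleB
    · obtain ⟨⟨μ, hμ⟩, -, -⟩ := hH.2.2.2.2.2.2.2.1 hlc
      -- In the limit circle case the boundary condition is one linear equation for two
      -- coefficients.
      obtain ⟨L₁, h₁⟩ := hE.tendsto_wronskian hμ hθ (hlc _ _ hμ) (hlc _ _ hθ)
      obtain ⟨L₂, h₂⟩ := hE.tendsto_wronskian hμ hφ (hlc _ _ hμ) (hlc _ _ hφ)
      have hin (p : ℂ × ℂ) (h0 : p.1 * L₁ + p.2 * L₂ = 0) :
          H.InDomainNearB (fun t => p.1 • Θ z t + p.2 • Φ z t) := by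
        refine inDomainNearB_of hH (hθ.linear hφ _ _) (hlc _ _ (hθ.linear hφ _ _)) ?_
        have := (h₁.const_mul p.1).add (h₂.const_mul p.2)
        rw [h0] at this
        refine this.congr fun x => ?_
        simp only [wronskian, PiLp.add_apply, PiLp.smul_apply, smul_eq_mul]
        ring
      by_cases h0 : L₁ = 0
      · exact ⟨(1, 0), by simp, hin _ (by simp [h0])⟩
      · exact ⟨(L₂, -L₁), by simp [h0], hin _ (by ring)⟩
    · obtain ⟨p, hp, hL⟩ := hsys.exists_l2NearB hH hz
      refine ⟨p, hp, inDomainNearB_of hH (hθ.linear hφ _ _) hL ?_⟩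
      rw [BCB, hH.2.2.2.2.2.2.2.2 hlc]
      exact tendsto_const_nhds.congr fun x => by simp [wronskian]
  refine mem_weylDomain_of_combination hH hsys (fun h1 => ?_) hd
  have h2 : p.2 ≠ 0 := fun h2 => hp (Prod.ext h1 h2)
  refine hsys.not_inDomainNearB hH hz (hd.of_eq_smul hH (hθ.linear hφ _ _) (k := p.2⁻¹)
    fun x _ => ?_)
  rw [h1, zero_smul, zero_add, smul_smul, inv_mul_cancel₀ h2, one_smul]

/-- A function in the domain near `a` which solves the equation on `(a, c]` is a multiple of
`Φ(z)`. -/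
theorem IsFundamentalSystem.eq_smul_phi (hH : H.IsAdmissible) (hsys : H.IsFundamentalSystem Φ Θ)
    {c : ℝ} (hc : c ∈ H.I) {f : ℝ → Spinor}
    (hf : H.IsSolOn (H.leftClosed c) (fun t => z • f t) f)
    (hL : MemLp f 2 (volume.restrict (H.leftPart c))) (hBC : H.BCA f) :
    wronskian (Φ z) f c = 0 ∧ ∀ x ∈ H.leftClosed c, wronskian (Θ z) f c • Φ z x = f x := by
  have hE := DiracExpr.isEnd_left hH.1
  have hcc : c ∈ H.leftClosed c := ⟨hc.1, le_rfl⟩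
  have hθ := hsys.2.1.1 z
  have hφ := hsys.1.1 z
  have h1 := hf.eq_combination (DiracExpr.ordConnected_leftClosed c)
    (DiracExpr.leftClosed_subset hc) hθ hφ (hsys.2.2.1 z) hcc
  have hs := hθ.linear hφ (wronskian f (Φ z) c) (wronskian (Θ z) f c)
  have hd := inDomainNearA_of hH hs
    ⟨c, hc, hL.ae_eq ((ae_restrict_iff' (hE.meas c)).2 (Eventually.of_forall fun t ht =>
      (h1 t (DiracExpr.leftPart_subset_leftClosed c ht)).symm))⟩
    (hBC.congr' (by
      filter_upwards [hE.mem c hc] with x hx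
      simp only [wronskian, ← h1 x (DiracExpr.leftPart_subset_leftClosed c hx)]))
  have h2 := IsWeylSolutionA.wronskian_eq_zero hH hsys.hasSolutionPairs hφ
    (hsys.2.2.2 z).2.2 hs hd hc
  have h3 : wronskian f (Φ z) c = 0 := by
    have := hsys.2.2.1 z c hc
    simp only [wronskian, PiLp.add_apply, PiLp.smul_apply, smul_eq_mul] at this h2 ⊢
    linear_combination -h2 - (f c 0 * Φ z c 1 - f c 1 * Φ z c 0) * this
  refine ⟨by rw [wronskian_comm, h3, neg_zero], fun x hx => ?_⟩
  rw [← h1 x hx, h3, zero_smul, zero_add]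

/-- Let f be the resolvent applied to a function supported in (c,d). To the right of d, f is a
homogeneous solution in the domain near b. It remains to arrange that it is not a multiple of Φ. -/
theorem mem_weylDomain_of_notMem_spec (hH : H.IsAdmissible) (hsys : H.IsFundamentalSystem Φ Θ)
    (hz : z ∉ H.spec) : z ∈ H.weylDomain Φ Θ := by
  have hE := DiracExpr.isEnd_right hH.1
  obtain ⟨R, hR⟩ : z ∈ graphResolventSet H.graph := by simpa [spec, graphSpectrum] using hz
  obtain ⟨c, hc⟩ := DiracExpr.nonempty_I hH.1
  obtain ⟨d, hd, hcd⟩ := DiracExpr.exists_rightPart hc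
  have hθ := hsys.2.1.1 z
  have hφ := hsys.1.1 z
  have hcdI : Set.uIcc c d ⊆ H.I := DiracExpr.uIcc_subset_I hc hd
  have hIoo : Set.Ioo c d ⊆ Set.uIcc c d := Set.Ioo_subset_Icc_self.trans Set.Icc_subset_uIcc
  -- The conjugate of Φ is chosen so that the integral of Φ·G is a positive energy.
  set G : ℝ → Spinor := (Set.Ioo c d).indicator fun t => (Φ z t).conj with hG
  have hGm : MemLp G 2 (volume.restrict H.I) := by
    rw [hG, memLp_indicator_iff_restrict measurableSet_Ioo,
      Measure.restrict_restrict measurableSet_Ioo,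
      Set.inter_eq_left.2 (hIoo.trans hcdI)]
    exact (DiracExpr.memLp_uIcc hφ.conj.continuousOn hc hd).mono_measure
      (Measure.restrict_mono hIoo le_rfl)
  have hmem : (R hGm.toLp, hGm.toLp + z • R hGm.toLp) ∈ H.graph := by
    rw [hR, add_sub_cancel_right]
  obtain ⟨f, hac, hA, hB, h1, h2⟩ := hmem
  have hsol : H.IsSolOn H.I (fun t => z • f t + G t) f := by
    refine ⟨hac, (ae_restrict_iff' DiracExpr.measurableSet_I).1 ?_⟩
    filter_upwards [h1, h2, hGm.coeFn_toLp, Lp.coeFn_add hGm.toLp (z • R hGm.toLp),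
      Lp.coeFn_smul z (R hGm.toLp)] with t e1 e2 e3 e4 e5
    rw [← e2, e4, Pi.add_apply, e5, Pi.smul_apply, e3, e1, add_comm]
  have hfL : MemLp f 2 (volume.restrict H.I) := (Lp.memLp (R hGm.toLp)).ae_eq h1
  have hoff {S : Set ℝ} (hS : S ⊆ H.I) (hdis : ∀ t ∈ S, t ∉ Set.Ioo c d) :
      H.IsSolOn S (fun t => z • f t) f := by
    refine ⟨(hsol.mono hS).1, (hsol.mono hS).2.mono fun t ht hm => ?_⟩
    simp only [ht hm, hG, Set.indicator_of_notMem (hdis t hm), add_zero]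
  have hleft := (hsys.eq_smul_phi hH hc
    (hoff (DiracExpr.leftClosed_subset hc) fun t ht ht' => absurd ht'.1 (not_lt.2 ht.2))
    (hfL.mono_measure (Measure.restrict_mono ((DiracExpr.isEnd_left hH.1).sub c hc) le_rfl)) hA).1
  -- To the left of c the function f is a multiple of Φ, so W(Φ,f) vanishes at c; by the Lagrange
  -- identity it equals -∫ ‖Φ‖² over (c,d) at d.
  have hWd : wronskian (Φ z) f d ≠ 0 := by
    have h3 := ((DiracExpr.isSolution_iff.1 hφ).wronskian DiracExpr.ordConnected_I hsol hc
      hd).integral_eq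
    rw [hleft, sub_zero, intervalIntegral.integral_of_le hcd.le] at h3
    have h4 : ∫ t in Set.Ioc c d, (spinorDot (z • Φ z t) (f t) - spinorDot (Φ z t) (z • f t + G t)) =
        ((-∫ t in Set.Ioc c d, ‖Φ z t‖ ^ 2 : ℝ) : ℂ) := by
      rw [← integral_neg, ← integral_complex_ofReal, integral_Ioc_eq_integral_Ioo,
        integral_Ioc_eq_integral_Ioo]
      refine setIntegral_congr_fun measurableSet_Ioo fun t ht => ?_
      have h5 := spinorDot_conj_self (Φ z t)
      simp only [hG, Set.indicator_of_mem ht, Complex.ofReal_neg, ← h5]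
      simp only [spinorDot, PiLp.add_apply, PiLp.smul_apply, smul_eq_mul]
      ring
    rw [← h3, h4, Complex.ofReal_ne_zero, neg_ne_zero]
    exact (hsys.integral_phi_pos z hc hd hcd).ne'
  have hr := (hoff (DiracExpr.rightClosed_subset hd) fun t ht ht' =>
    absurd ht'.2 (not_lt.2 ht.1)).eq_combination (DiracExpr.ordConnected_rightClosed d)
    (DiracExpr.rightClosed_subset hd) hθ hφ (hsys.2.2.1 z) ⟨le_rfl, hd.2⟩
  refine mem_weylDomain_of_combination hH hsys (α := wronskian f (Φ z) d)
    (β := wronskian (Θ z) f d) (by rw [wronskian_comm]; exact neg_ne_zero.2 hWd)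
    (inDomainNearB_of hH (hθ.linear hφ _ _) ⟨d, hd, ?_⟩ (hB.congr' ?_))
  · refine (hfL.mono_measure (Measure.restrict_mono (hE.sub d hd) le_rfl)).ae_eq
      ((ae_restrict_iff' (hE.meas d)).2 (Eventually.of_forall fun t ht =>
        (hr t (DiracExpr.rightPart_subset_rightClosed d ht)).symm))
  · filter_upwards [hE.mem d hd] with x hx
    simp only [wronskian, ← hr x (DiracExpr.rightPart_subset_rightClosed d hx)]

end DiracOperator

/-! ### The Green function on (a,c): energy estimate, holomorphy in z and uniform bounds -/

/-- An integral depending holomorphically on a parameter, with an integrable bound, is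
holomorphic. -/
theorem differentiableOn_integral_of_bound {α : Type*} [MeasurableSpace α] {μ : Measure α}
    {U : Set ℂ} (hU : IsOpen U) {F : ℂ → α → ℂ} {b : α → ℝ} (hb : Integrable b μ)
    (hm : ∀ z ∈ U, AEStronglyMeasurable (F z) μ)
    (hd : ∀ᵐ a ∂μ, DifferentiableOn ℂ (fun z => F z a) U)
    (hle : ∀ᵐ a ∂μ, ∀ z ∈ U, ‖F z a‖ ≤ b a) :
    DifferentiableOn ℂ (fun z => ∫ a, F z a ∂μ) U := by
  intro z₀ hz₀
  obtain ⟨ε, hε, hball⟩ := Metric.isOpen_iff.1 hU z₀ hz₀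
  set r := ε / 3 with hr
  have hr0 : 0 < r := by positivity
  have hsub (z : ℂ) (hz : z ∈ Metric.ball z₀ r) : Metric.closedBall z r ⊆ U := fun w hw => by
    refine hball (Metric.mem_ball.2 ?_)
    have h1 := Metric.mem_closedBall.1 hw
    have h2 := Metric.mem_ball.1 hz
    linarith [dist_triangle w z z₀]
  have hder : ∀ᵐ a ∂μ, ∀ z ∈ Metric.ball z₀ r, HasDerivAt (fun z => F z a)
      (deriv (fun z => F z a) z) z := by
    filter_upwards [hd] with a ha z hz
    exact (ha.differentiableAt (hU.mem_nhds (hsub z hz (Metric.mem_closedBall_self hr0.le)))).hasDerivAt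
  -- The derivative is an almost everywhere limit of measurable difference quotients along a
  -- sequence in U converging to z₀.
  have hmeas : AEStronglyMeasurable (fun a => deriv (fun z => F z a) z₀) μ := by
    set s : ℕ → ℂ := fun n => z₀ + (((r / 2) * (1 / ((n : ℝ) + 1)) : ℝ) : ℂ) with hs
    have hpos (n : ℕ) : 0 < (r / 2) * (1 / ((n : ℝ) + 1)) := by positivity
    have hne (n : ℕ) : s n ≠ z₀ := by
      simp only [hs, ne_eq, add_eq_left, Complex.ofReal_eq_zero]
      exact (hpos n).ne'
    have hsU (n : ℕ) : s n ∈ U := by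
      refine hball (Metric.mem_ball.2 ?_)
      simp only [hs, dist_eq_norm, add_sub_cancel_left, Complex.norm_real,
        Real.norm_of_nonneg (hpos n).le]
      have : 1 / ((n : ℝ) + 1) ≤ 1 := by
        rw [div_le_one (by positivity)]; linarith [Nat.cast_nonneg (α := ℝ) n]
      nlinarith
    have hlim : Tendsto s atTop (𝓝[≠] z₀) := by
      refine tendsto_nhdsWithin_iff.2 ⟨?_, Eventually.of_forall hne⟩
      have h1 := ((tendsto_one_div_add_atTop_nhds_zero_nat (𝕜 := ℝ)).const_mul (r / 2))
      rw [mul_zero] at h1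
      have h2 := ((Complex.continuous_ofReal.tendsto _).comp h1).const_add z₀
      simpa [hs] using h2
    refine aestronglyMeasurable_of_tendsto_ae atTop
      (f := fun n a => (s n - z₀)⁻¹ * (F (s n) a - F z₀ a)) (fun n => ?_) ?_
    · exact ((hm _ (hsU n)).sub (hm _ hz₀)).const_mul _
    · filter_upwards [hder] with a ha
      have := (ha z₀ (Metric.mem_ball_self hr0)).tendsto_slope.comp hlim
      simpa only [Function.comp_def, slope, vsub_eq_sub, smul_eq_mul] using this
  have key := hasDerivAt_integral_of_dominated_loc_of_deriv_le (μ := μ)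
    (F := F) (F' := fun z a => deriv (fun z => F z a) z) (x₀ := z₀)
    (bound := fun a => b a / r) (Metric.ball_mem_nhds z₀ hr0)
    (by filter_upwards [hU.mem_nhds hz₀] with z hz using hm z hz)
    (hb.mono' (hm z₀ hz₀) (hle.mono fun a ha => ha z₀ hz₀)) hmeas ?_ (hb.div_const r) hder
  · exact key.2.differentiableAt.differentiableWithinAt
  · filter_upwards [hd, hle] with a ha hla z hz
    -- Cauchy's estimate on circles of radius r contained in U bounds the derivative by b/r.
    refine Complex.norm_deriv_le_of_forall_mem_sphere_norm_le hr0 ?_ fun w hw =>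
      hla w (hsub z hz (Metric.sphere_subset_closedBall hw))
    exact ((ha.mono (hsub z hz)).mono Metric.closure_ball_subset_closedBall).diffContOnCl

namespace DiracExpr

variable {T : DiracExpr}

/-- The solution of `τ f = z f + G` given by variation of constants from the solutions `ψ`, `φ`
of `τ u = z u`. -/
noncomputable def green (ψ φ G : ℝ → Spinor) (c : ℝ) (k : ℂ) (x : ℝ) : Spinor :=
  (∫ t in x..c, spinorDot (ψ t) (G t)) • φ x + (k + ∫ t in c..x, spinorDot (φ t) (G t)) • ψ x

theorem intervalIntegrable_spinorDot {u G : ℝ → Spinor} (hu : ContinuousOn u T.I)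
    (hG : MemLp G 2 volume) {x y : ℝ} (hx : x ∈ T.I) (hy : y ∈ T.I) :
    IntervalIntegrable (fun t => spinorDot (u t) (G t)) volume x y := by
  rw [intervalIntegrable_iff]
  exact (integrableOn_spinorDot (memLp_uIcc hu hx hy) (hG.restrict _)).mono_set
    Set.uIoc_subset_uIcc

theorem hasACDeriv_integral {u G : ℝ → Spinor} (hu : ContinuousOn u T.I)
    (hG : MemLp G 2 volume) {c x y : ℝ} (hc : c ∈ T.I) (hx : x ∈ T.I) (hy : y ∈ T.I) (k : ℂ) :
    HasACDeriv (fun s => k + ∫ t in c..s, spinorDot (u t) (G t)) (fun t => spinorDot (u t) (G t))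
      x y := by
  refine .of_integral (intervalIntegrable_spinorDot hu hG hx hy) fun t ht => ?_
  have htI := uIcc_subset_I hx hy ht
  rw [add_assoc, intervalIntegral.integral_add_adjacent_intervals
    (intervalIntegrable_spinorDot hu hG hc hx) (intervalIntegrable_spinorDot hu hG hx htI)]

theorem isSolOn_green {z : ℂ} {ψ φ G : ℝ → Spinor} (hψ : T.IsSolution z ψ)
    (hφ : T.IsSolution z φ) (hW : ∀ x ∈ T.I, _root_.wronskian ψ φ x = 1) (hG : MemLp G 2 volume)
    {c : ℝ} (hc : c ∈ T.I) (k : ℂ) :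
    T.IsSolOn T.I (fun t => z • green ψ φ G c k t + G t) (green ψ φ G c k) := by
  refine IsSolOn.of_hasACDeriv fun x hx y hy => ?_
  have hs := uIcc_subset_I hx hy
  obtain ⟨u0, u1⟩ := (isSolution_iff.1 hψ).hasACDeriv ordConnected_I hx hy
  obtain ⟨v0, v1⟩ := (isSolution_iff.1 hφ).hasACDeriv ordConnected_I hx hy
  have hA : HasACDeriv (fun s => ∫ t in s..c, spinorDot (ψ t) (G t))
      (fun t => -spinorDot (ψ t) (G t)) x y :=
    (hasACDeriv_integral hψ.continuousOn hG hc hx hy 0).neg.congr fun t ht => by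
      rw [zero_add, intervalIntegral.integral_symm, neg_neg]
  have hB := hasACDeriv_integral hφ.continuousOn hG hc hx hy k
  refine ⟨((hA.mul v0).add (hB.mul u0)).congr_deriv fun t ht => ?_,
    ((hA.mul v1).add (hB.mul u1)).congr_deriv fun t ht => ?_⟩
  · have := hW t (hs ht)
    simp only [_root_.wronskian] at this
    simp only [rhs0, green, spinorDot, PiLp.smul_apply, PiLp.add_apply, smul_eq_mul]
    linear_combination (G t 1) * this
  · have := hW t (hs ht)
    simp only [_root_.wronskian] at this
    simp only [rhs1, green, spinorDot, PiLp.smul_apply, PiLp.add_apply, smul_eq_mul]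
    linear_combination -(G t 0) * this

theorem green_self {ψ φ G : ℝ → Spinor} {c : ℝ} (k : ℂ) (h0 : ψ c 0 = 0) :
    green ψ φ G c k c 0 = 0 := by
  simp [green, h0]

/-- This choice of k cancels the ψ-part at x, so that the energy form of the solution at x is a
multiple of the form of φ. -/
theorem green_left {ψ φ G : ℝ → Spinor} {c x : ℝ} :
    green ψ φ G c (∫ t in x..c, spinorDot (φ t) (G t)) x =
      (∫ t in x..c, spinorDot (ψ t) (G t)) • φ x := by
  rw [green, intervalIntegral.integral_symm x c, add_neg_cancel, zero_smul, add_zero]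

/-- The energy estimate for nonreal spectral parameter. -/
theorem IsSolOn.integral_sq_le {z : ℂ} (hz : z.im ≠ 0) {f G : ℝ → Spinor}
    (hf : T.IsSolOn T.I (fun t => z • f t + G t) f) (hG : MemLp G 2 volume) {x c : ℝ}
    (hx : x ∈ T.I) (hc : c ∈ T.I) (hxc : x ≤ c) (h0 : f c 0 = 0)
    (hW : 0 ≤ (_root_.wronskian (fun t => (f t).conj) f x / ((starRingEnd ℂ) z - z)).re) :
    z.im ^ 2 * ∫ t in Set.Ioc x c, ‖f t‖ ^ 2 ≤ ∫ t in Set.Ioc x c, ‖G t‖ ^ 2 := by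
  have hz' : (starRingEnd ℂ) z - z ≠ 0 := fun h0 => hz (Complex.conj_eq_iff_im.1 (sub_eq_zero.1 h0))
  have hfc := continuousOn_of_acLoc isOpen_I hf.1
  have hIoc : Set.Ioc x c ⊆ Set.uIcc x c := Set.Ioc_subset_Icc_self.trans Set.Icc_subset_uIcc
  have hfL : MemLp f 2 (volume.restrict (Set.Ioc x c)) :=
    (memLp_uIcc hfc hx hc).mono_measure (Measure.restrict_mono hIoc le_rfl)
  have hfcL : MemLp (fun t => (f t).conj) 2 (volume.restrict (Set.Ioc x c)) := by
    have := continuousOn_of_acLoc isOpen_I hf.conj.1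
    exact (memLp_uIcc this hx hc).mono_measure (Measure.restrict_mono hIoc le_rfl)
  have hGL : MemLp G 2 (volume.restrict (Set.Ioc x c)) := hG.restrict _
  have h1 := (hf.conj.wronskian ordConnected_I hf hx hc)
  set E : ℝ → ℂ := fun t => spinorDot (G t).conj (f t) - spinorDot (f t).conj (G t) with hE
  have h2 : HasACDeriv (_root_.wronskian (fun t => (f t).conj) f)
      (fun t => ((starRingEnd ℂ) z - z) * ((‖f t‖ ^ 2 : ℝ) : ℂ) + E t) x c := by
    refine h1.congr_deriv fun t _ => ?_
    rw [← spinorDot_conj_self]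
    simp only [hE, spinorDot, Spinor.conj_zero, Spinor.conj_one, PiLp.add_apply, PiLp.smul_apply,
      smul_eq_mul, map_add, map_mul]
    ring
  have i1 : IntegrableOn (fun t => ((starRingEnd ℂ) z - z) * ((‖f t‖ ^ 2 : ℝ) : ℂ)) (Set.Ioc x c) :=
    (hfL.norm.integrable_sq.ofReal (𝕜 := ℂ)).const_mul _
  have i2 : IntegrableOn E (Set.Ioc x c) := by
    have := h2.intervalIntegrable
    rw [intervalIntegrable_iff, Set.uIoc_of_le hxc] at this
    refine (this.sub i1).congr (Eventually.of_forall fun t => ?_)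
    simp
  have i3 := integrableOn_mul_norm hGL hfL
  have h3 := h2.integral_eq
  rw [intervalIntegral.integral_of_le hxc, integral_add i1 i2, integral_const_mul,
    integral_complex_ofReal] at h3
  have h4 : _root_.wronskian (fun t => (f t).conj) f c = 0 := by
    simp [_root_.wronskian, h0]
  rw [h4, zero_sub] at h3
  set N := ∫ t in Set.Ioc x c, ‖f t‖ ^ 2 with hN
  -- The vanishing component at c removes one boundary term and `hW` fixes the sign of the other.
  -- What is left bounds |Im z| N by ∫ ‖G‖‖f‖.
  have h5 : N = -(_root_.wronskian (fun t => (f t).conj) f x / ((starRingEnd ℂ) z - z)).re -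
      ((∫ t in Set.Ioc x c, E t) / ((starRingEnd ℂ) z - z)).re := by
    rw [← Complex.neg_re, ← Complex.sub_re, ← neg_div, ← sub_div, ← h3, add_sub_cancel_right,
      mul_div_cancel_left₀ _ hz', Complex.ofReal_re]
  have h6 : ‖∫ t in Set.Ioc x c, E t‖ ≤ 2 * ∫ t in Set.Ioc x c, ‖G t‖ * ‖f t‖ := by
    rw [← integral_const_mul]
    refine norm_integral_le_of_norm_le (i3.const_mul 2) (Eventually.of_forall fun t => ?_)
    have e1 := norm_spinorDot_le (G t).conj (f t)
    have e2 := norm_spinorDot_le (f t).conj (G t)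
    rw [Spinor.norm_conj] at e1 e2
    refine (norm_sub_le _ _).trans ?_
    linarith [mul_comm ‖f t‖ ‖G t‖]
  have hzn : ‖(starRingEnd ℂ) z - z‖ = 2 * |z.im| := by
    have : (starRingEnd ℂ) z - z = ((-2 * z.im : ℝ) : ℂ) * Complex.I := by
      apply Complex.ext <;> simp
      ring
    rw [this, norm_mul, Complex.norm_I, mul_one, Complex.norm_real, Real.norm_eq_abs, abs_mul]
    norm_num
  have him : 0 < |z.im| := abs_pos.2 hz
  have h7 : |z.im| * N ≤ ∫ t in Set.Ioc x c, ‖G t‖ * ‖f t‖ := by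
    have h8 : N ≤ ‖(∫ t in Set.Ioc x c, E t) / ((starRingEnd ℂ) z - z)‖ := by
      have := neg_le_of_abs_le (Complex.abs_re_le_norm
        ((∫ t in Set.Ioc x c, E t) / ((starRingEnd ℂ) z - z)))
      linarith
    rw [norm_div, hzn, le_div_iff₀ (by positivity)] at h8
    linarith
  have h8 : (|z.im| * N) ^ 2 ≤ (∫ t in Set.Ioc x c, ‖G t‖ ^ 2) * N :=
    (pow_le_pow_left₀ (mul_nonneg him.le (integral_nonneg fun _ => by positivity)) h7 2).trans
      (sq_integral_mul_norm_le hGL hfL)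
  have hN0 : 0 ≤ N := integral_nonneg fun _ => by positivity
  have hG0 : 0 ≤ ∫ t in Set.Ioc x c, ‖G t‖ ^ 2 := integral_nonneg fun _ => by positivity
  rw [mul_pow, sq_abs] at h8
  rcases hN0.eq_or_lt with h | h
  · rw [← h, mul_zero]; exact hG0
  · refine le_of_mul_le_mul_right ?_ h
    linarith

end DiracExpr

/-- With w = z - z₀ one has w² - |w|² = w(w - w̄). On a circle about a real point this factor
therefore compensates a singularity 1/|Im z| of a resolvent bound. -/
theorem norm_sq_sub_sq_of_mem_sphere {z z₀ : ℂ} (h₀ : z₀.im = 0) :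
    ‖(z - z₀) ^ 2 - (‖z - z₀‖ : ℂ) ^ 2‖ = 2 * ‖z - z₀‖ * |z.im| := by
  set w := z - z₀ with hw
  have him : w.im = z.im := by rw [hw, Complex.sub_im, h₀, sub_zero]
  have h1 : w ^ 2 - (‖w‖ : ℂ) ^ 2 = w * (((2 * w.im : ℝ) : ℂ) * Complex.I) := by
    rw [← Complex.mul_conj', sq, ← mul_sub]
    congr 1
    apply Complex.ext <;> simp
    ring
  rw [h1, norm_mul, norm_mul, Complex.norm_I, Complex.norm_real, Real.norm_eq_abs, abs_mul, him,
    abs_two]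
  ring

namespace DiracExpr

variable {T : DiracExpr}

/-- Dependence on the spectral parameter of the integral of a product. -/
theorem differentiableOn_integral_spinorDot {U : Set ℂ} (hU : IsOpen U) {u : ℂ → ℝ → Spinor}
    {G : ℝ → Spinor} (hG : MemLp G 2 volume) {p q M : ℝ} (hp : p ∈ T.I) (hq : q ∈ T.I)
    (hu : ∀ z ∈ U, ContinuousOn (u z) T.I)
    (hd : ∀ t ∈ Set.uIcc p q, DifferentiableOn ℂ (fun z => u z t) U)
    (hM : ∀ z ∈ U, ∀ t ∈ Set.uIcc p q, ‖u z t‖ ≤ M) :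
    DifferentiableOn ℂ (fun z => ∫ t in p..q, spinorDot (u z t) (G t)) U ∧
      ∀ z ∈ U, ‖∫ t in p..q, spinorDot (u z t) (G t)‖ ≤ M * ∫ t in Set.uIoc p q, ‖G t‖ := by
  have hGi : IntegrableOn G (Set.uIoc p q) := by
    have : IsFiniteMeasure (volume.restrict (Set.uIoc p q)) := by
      rw [Set.uIoc]; infer_instance
    exact (hG.restrict _).integrable one_le_two
  have hle : ∀ᵐ t ∂(volume.restrict (Set.uIoc p q)), ∀ z ∈ U,
      ‖spinorDot (u z t) (G t)‖ ≤ M * ‖G t‖ := by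
    refine (ae_restrict_iff' measurableSet_uIoc).2 (Eventually.of_forall fun t ht z hz => ?_)
    refine (norm_spinorDot_le _ _).trans ?_
    have := hM z hz t (Set.uIoc_subset_uIcc ht)
    gcongr
  constructor
  · simp only [intervalIntegral.intervalIntegral_eq_integral_uIoc]
    refine DifferentiableOn.const_smul (differentiableOn_integral_of_bound hU
      (hGi.norm.const_mul M) (fun z hz => ?_) ?_ hle) _
    · exact (intervalIntegrable_iff.1 (intervalIntegrable_spinorDot (hu z hz) hG hp hq)).aestronglyMeasurable
    · refine (ae_restrict_iff' measurableSet_uIoc).2 (Eventually.of_forall fun t ht => ?_)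
      have h1 (i : Fin 2) : DifferentiableOn ℂ (fun z => u z t i) U := fun z hz =>
        ((EuclideanSpace.proj (𝕜 := ℂ) i).differentiableAt.comp_differentiableWithinAt z
          (hd t (Set.uIoc_subset_uIcc ht) z hz) :)
      exact ((h1 0).mul_const _).add ((h1 1).mul_const _)
  · intro z hz
    refine intervalIntegral.norm_integral_le_integral_norm_uIoc.trans ?_
    rw [← integral_const_mul]
    refine integral_mono_of_nonneg (Eventually.of_forall fun _ => norm_nonneg _)
      (hGi.norm.const_mul M) (hle.mono fun t ht => ht z hz)

end DiracExpr

namespace DiracOperator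

variable {H : DiracOperator} {Φ Θ : ℂ → ℝ → Spinor} {z : ℂ} {c : ℝ}

/-- The solution whose first component vanishes at `c`. -/
noncomputable def dirichletPsi (Φ Θ : ℂ → ℝ → Spinor) (c : ℝ) (z : ℂ) : ℝ → Spinor :=
  fun x => Θ z x + (-(Θ z c 0 / Φ z c 0)) • Φ z x

theorem dirichletPsi_self (h0 : Φ z c 0 ≠ 0) : dirichletPsi Φ Θ c z c 0 = 0 := by
  simp [dirichletPsi, h0]

theorem isSolution_dirichletPsi (hsys : H.IsFundamentalSystem Φ Θ) (z : ℂ) :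
    H.IsSolution z (dirichletPsi Φ Θ c z) := isSolution_psi hsys z _

theorem wronskian_dirichletPsi (hsys : H.IsFundamentalSystem Φ Θ) (z : ℂ) {x : ℝ} (hx : x ∈ H.I) :
    wronskian (dirichletPsi Φ Θ c z) (Φ z) x = 1 := by
  rw [wronskian_comm]
  exact neg_eq_iff_eq_neg.2 (wronskian_phi_psi hsys z _ hx)

/-- The solution of the inhomogeneous equation on `(x, c)` with vanishing first component at `c`
that continues as a multiple of `Φ(z)` to the left of `x`. -/
noncomputable def truncGreen (Φ Θ : ℂ → ℝ → Spinor) (G : ℝ → Spinor) (c x : ℝ) (z : ℂ) :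
    ℝ → Spinor :=
  DiracExpr.green (dirichletPsi Φ Θ c z) (Φ z) G c (∫ t in x..c, spinorDot (Φ z t) (G t))

theorem isSolOn_green (hsys : H.IsFundamentalSystem Φ Θ) (z : ℂ) {G : ℝ → Spinor}
    (hG : MemLp G 2 volume) (hc : c ∈ H.I) (k : ℂ) :
    H.IsSolOn H.I (fun t => z • DiracExpr.green (dirichletPsi Φ Θ c z) (Φ z) G c k t + G t)
      (DiracExpr.green (dirichletPsi Φ Θ c z) (Φ z) G c k) :=
  DiracExpr.isSolOn_green (isSolution_dirichletPsi hsys z) (hsys.1.1 z)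
    (fun _ hx => wronskian_dirichletPsi hsys z hx) hG hc k

theorem continuousOn_green (hsys : H.IsFundamentalSystem Φ Θ) (z : ℂ) {G : ℝ → Spinor}
    (hG : MemLp G 2 volume) (hc : c ∈ H.I) (k : ℂ) :
    ContinuousOn (DiracExpr.green (dirichletPsi Φ Θ c z) (Φ z) G c k) H.I :=
  DiracExpr.continuousOn_of_acLoc DiracExpr.isOpen_I (isSolOn_green hsys z hG hc k).1

/-- At x the solution equals kΦ(z,x), so its boundary form is |k|² times the positive form of Φ(z),
as the energy estimate requires. -/
theorem integral_truncGreen_le (hH : H.IsAdmissible) (hsys : H.IsFundamentalSystem Φ Θ)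
    (hz : z.im ≠ 0) {G : ℝ → Spinor} (hG : MemLp G 2 volume) {x : ℝ} (hx : x ∈ H.I)
    (hc : c ∈ H.I) (hxc : x ≤ c) :
    z.im ^ 2 * ∫ t in Set.Ioc x c, ‖truncGreen Φ Θ G c x z t‖ ^ 2 ≤
      ∫ t in Set.Ioc x c, ‖G t‖ ^ 2 := by
  refine (isSolOn_green hsys z hG hc _).integral_sq_le hz hG hx hc hxc
    (DiracExpr.green_self _ (dirichletPsi_self (hsys.phi_apply_zero_ne_zero hH hz hc))) ?_
  set k := ∫ t in x..c, spinorDot (dirichletPsi Φ Θ c z t) (G t) with hk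
  have h1 : truncGreen Φ Θ G c x z x = k • Φ z x := DiracExpr.green_left
  have h2 : wronskian (fun t => (truncGreen Φ Θ G c x z t).conj) (truncGreen Φ Θ G c x z) x =
      ((‖k‖ ^ 2 : ℝ) : ℂ) * wronskian (fun t => (Φ z t).conj) (Φ z) x := by
    have : (starRingEnd ℂ) k * k = ((‖k‖ ^ 2 : ℝ) : ℂ) := by
      rw [Complex.conj_mul']; norm_cast
    simp only [wronskian, h1, ← this, Spinor.conj_zero, Spinor.conj_one, PiLp.smul_apply,
      smul_eq_mul, map_mul]
    ring
  have h3 := (hsys.re_conj_wronskian_pos hH hz hx).le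
  change 0 ≤ (wronskian (fun t => (truncGreen Φ Θ G c x z t).conj) (truncGreen Φ Θ G c x z) x /
    ((starRingEnd ℂ) z - z)).re
  rw [h2, mul_div_assoc, Complex.re_ofReal_mul]
  positivity

theorem exists_ball_phi_ne_zero (hsys : H.IsFundamentalSystem Φ Θ) (hc : c ∈ H.I)
    (h0 : Φ z c 0 ≠ 0) : ∃ R > 0, ∀ w ∈ Metric.closedBall z R, Φ w c 0 ≠ 0 := by
  have hcont : Continuous fun w => Φ w c 0 := ((hsys.1.2.1 c hc).spinor_apply 0).continuous
  obtain ⟨R, hR, h1⟩ := Metric.nhds_basis_closedBall.mem_iff.1 (hcont.continuousAt.eventually_ne h0)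
  exact ⟨R, hR, fun w hw => h1 hw⟩

/-- Holomorphy and local boundedness of the truncated Green function solution. -/
theorem differentiableOn_truncGreen (hH : H.IsAdmissible) (hsys : H.IsFundamentalSystem Φ Θ)
    {R : ℝ} (h0 : ∀ w ∈ Metric.closedBall z R, Φ w c 0 ≠ 0) {G : ℝ → Spinor}
    (hG : MemLp G 2 volume) {x : ℝ} (hx : x ∈ H.I) (hc : c ∈ H.I) :
    (∀ t ∈ Set.uIcc x c,
      DifferentiableOn ℂ (fun w => truncGreen Φ Θ G c x w t) (Metric.ball z R)) ∧
    ∃ M, ∀ w ∈ Metric.ball z R, ∀ t ∈ Set.uIcc x c, ‖truncGreen Φ Θ G c x w t‖ ≤ M := by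
  have hKI := DiracExpr.uIcc_subset_I hx hc
  have hsub : Metric.ball z R ⊆ Metric.closedBall z R := Metric.ball_subset_closedBall
  obtain ⟨M₁, hM₁⟩ := DiracExpr.exists_bound_of_continuous (locInt hH) (subset_refl _)
    (fun w _ => hsys.1.1 w) (fun x hx => (hsys.1.2.1 x hx).continuous) (z₀ := z) (r := R)
    isCompact_uIcc hKI
  obtain ⟨M₂, hM₂⟩ := DiracExpr.exists_bound_of_continuous (locInt hH) (subset_refl _)
    (fun w _ => hsys.2.1.1 w) (fun x hx => (hsys.2.1.2.1 x hx).continuous) (z₀ := z) (r := R)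
    isCompact_uIcc hKI
  have hΦc := (hsys.1.2.1 c hc).spinor_apply 0
  have hΘc := (hsys.2.1.2.1 c hc).spinor_apply 0
  obtain ⟨M₃, hM₃⟩ := (isCompact_closedBall z R).exists_bound_of_continuousOn
    (hΘc.continuous.continuousOn.div hΦc.continuous.continuousOn h0)
  have hψb : ∀ w ∈ Metric.ball z R, ∀ t ∈ Set.uIcc x c,
      ‖dirichletPsi Φ Θ c w t‖ ≤ M₂ + M₃ * M₁ := by
    intro w hw t ht
    refine (norm_add_le _ _).trans ?_
    rw [norm_smul, norm_neg]
    have e1 := hM₁ w (hsub hw) t ht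
    have e2 := hM₂ w (hsub hw) t ht
    have e3 := hM₃ w (hsub hw)
    simp only [Pi.div_apply] at e3
    have e4 := (norm_nonneg _).trans e3
    gcongr
  have hψd (t : ℝ) (ht : t ∈ Set.uIcc x c) :
      DifferentiableOn ℂ (fun w => dirichletPsi Φ Θ c w t) (Metric.ball z R) := by
    have e1 := (hsys.1.2.1 t (hKI ht)).differentiableOn (s := Metric.ball z R)
    have e2 := (hsys.2.1.2.1 t (hKI ht)).differentiableOn (s := Metric.ball z R)
    have e3 := hΘc.differentiableOn.div hΦc.differentiableOn fun w hw => h0 w (hsub hw)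
    exact e2.add (e3.neg.smul e1)
  have hφd (t : ℝ) (ht : t ∈ Set.uIcc x c) :
      DifferentiableOn ℂ (fun w => Φ w t) (Metric.ball z R) :=
    (hsys.1.2.1 t (hKI ht)).differentiableOn
  have hψI {p q : ℝ} (hp : p ∈ Set.uIcc x c) (hq : q ∈ Set.uIcc x c) :=
    DiracExpr.differentiableOn_integral_spinorDot Metric.isOpen_ball hG (hKI hp) (hKI hq)
      (fun w _ => (isSolution_dirichletPsi (c := c) hsys w).continuousOn)
      (fun t ht => hψd t (Set.uIcc_subset_uIcc hp hq ht))
      (fun w hw t ht => hψb w hw t (Set.uIcc_subset_uIcc hp hq ht))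
  have hφI {p q : ℝ} (hp : p ∈ Set.uIcc x c) (hq : q ∈ Set.uIcc x c) :=
    DiracExpr.differentiableOn_integral_spinorDot Metric.isOpen_ball hG (hKI hp) (hKI hq)
      (fun w _ => (hsys.1.1 w).continuousOn)
      (fun t ht => hφd t (Set.uIcc_subset_uIcc hp hq ht))
      (fun w hw t ht => hM₁ w (hsub hw) t (Set.uIcc_subset_uIcc hp hq ht))
  have hxm : x ∈ Set.uIcc x c := Set.left_mem_uIcc
  have hcm : c ∈ Set.uIcc x c := Set.right_mem_uIcc
  refine ⟨fun t ht => ?_, ?_⟩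
  · exact (((hψI ht hcm).1.smul (hφd t ht)).add
      (((hφI hxm hcm).1.add (hφI hcm ht).1).smul (hψd t ht)))
  · have hGi {p q : ℝ} (hp : p ∈ Set.uIcc x c) (hq : q ∈ Set.uIcc x c) :
        ∫ t in Set.uIoc p q, ‖G t‖ ≤ ∫ t in Set.uIcc x c, ‖G t‖ := by
      have : IsFiniteMeasure (volume.restrict (Set.uIcc x c)) := by
        rw [Set.uIcc]; infer_instance
      refine setIntegral_mono_set ((hG.restrict _).integrable one_le_two).norm
        (Eventually.of_forall fun _ => norm_nonneg _)
        (Set.uIoc_subset_uIcc.trans (Set.uIcc_subset_uIcc hp hq)).eventuallyLE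
    set Γ := ∫ t in Set.uIcc x c, ‖G t‖ with hΓ
    have hΓ0 : 0 ≤ Γ := integral_nonneg fun _ => norm_nonneg _
    refine ⟨((M₂ + M₃ * M₁) * Γ) * M₁ + (M₁ * Γ + M₁ * Γ) * (M₂ + M₃ * M₁), fun w hw t ht => ?_⟩
    have b1 := hM₁ w (hsub hw) t ht
    have b2 := hψb w hw t ht
    have p1 : 0 ≤ M₁ := (norm_nonneg _).trans b1
    have p2 : 0 ≤ M₂ + M₃ * M₁ := (norm_nonneg _).trans b2
    have a1 := ((hψI ht hcm).2 w hw).trans (mul_le_mul_of_nonneg_left (hGi ht hcm) p2)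
    have a2 := ((hφI hxm hcm).2 w hw).trans (mul_le_mul_of_nonneg_left (hGi hxm hcm) p1)
    have a3 := ((hφI hcm ht).2 w hw).trans (mul_le_mul_of_nonneg_left (hGi hcm ht) p1)
    refine (norm_add_le _ _).trans ?_
    rw [norm_smul, norm_smul]
    have a4 := (norm_add_le _ _).trans (add_le_add a2 a3)
    gcongr

/-- A bound for the truncated Green function solution which is uniform in the truncation. -/
theorem exists_truncGreen_bound (hH : H.IsAdmissible) (hsys : H.IsFundamentalSystem Φ Θ)
    (hc : c ∈ H.I) (h0 : Φ z c 0 ≠ 0) :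
    ∃ C, 0 ≤ C ∧ ∀ G : ℝ → Spinor, MemLp G 2 volume → ∀ x ∈ H.I, x ≤ c →
      ∫ t in Set.Ioc x c, ‖truncGreen Φ Θ G c x z t‖ ^ 2 ≤ C * ∫ t in Set.Ioc x c, ‖G t‖ ^ 2 := by
  by_cases hz : z.im ≠ 0
  · refine ⟨(z.im ^ 2)⁻¹, by positivity, fun G hG x hx hxc => ?_⟩
    have h1 := integral_truncGreen_le hH hsys hz hG hx hc hxc
    have : 0 < z.im ^ 2 := by positivity
    rwa [inv_mul_eq_div, le_div_iff₀ this, mul_comm]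
  push Not at hz
  obtain ⟨R, hR, hne⟩ := exists_ball_phi_ne_zero hsys hc h0
  set ρ := R / 2 with hρ
  have hρ0 : 0 < ρ := by positivity
  -- The constant results from Nρ² ≤ 2ρ√(Ng), obtained below from the maximum principle at the
  -- centre z.
  refine ⟨4 / ρ ^ 2, by positivity, fun G hG x hx hxc => ?_⟩
  obtain ⟨hd, M, hM⟩ := differentiableOn_truncGreen hH hsys hne hG hx hc
  set f := truncGreen Φ Θ G c x with hf
  have hfc (w : ℂ) : ContinuousOn (f w) H.I := continuousOn_green hsys w hG hc _
  have hIoc : Set.Ioc x c ⊆ Set.uIcc x c := Set.Ioc_subset_Icc_self.trans Set.Icc_subset_uIcc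
  have hfL (w : ℂ) : MemLp (f w) 2 (volume.restrict (Set.Ioc x c)) :=
    (DiracExpr.memLp_uIcc (hfc w) hx hc).mono_measure (Measure.restrict_mono hIoc le_rfl)
  -- Pairing f(w) with the fixed conjugate of f(z) gives a holomorphic scalar function F of w with
  -- F(z) = N.
  set h : ℝ → Spinor := (Set.Ioc x c).indicator fun t => (f z t).conj with hh
  have hhm : MemLp h 2 volume := by
    rw [hh, memLp_indicator_iff_restrict measurableSet_Ioc]
    have := DiracExpr.continuousOn_of_acLoc DiracExpr.isOpen_I (isSolOn_green hsys z hG hc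
      (∫ t in x..c, spinorDot (Φ z t) (G t))).conj.1
    exact (DiracExpr.memLp_uIcc this hx hc).mono_measure (Measure.restrict_mono hIoc le_rfl)
  set F : ℂ → ℂ := fun w => ∫ t in x..c, spinorDot (f w t) (h t) with hF
  have hFd : DifferentiableOn ℂ F (Metric.ball z R) :=
    (DiracExpr.differentiableOn_integral_spinorDot (T := H.toDiracExpr) Metric.isOpen_ball hhm hx hc
      (fun w _ => hfc w) hd hM).1
  set N := ∫ t in Set.Ioc x c, ‖f z t‖ ^ 2 with hN
  set g := ∫ t in Set.Ioc x c, ‖G t‖ ^ 2 with hg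
  have hN0 : 0 ≤ N := integral_nonneg fun _ => by positivity
  have hg0 : 0 ≤ g := integral_nonneg fun _ => by positivity
  have hhN : ∫ t in Set.Ioc x c, ‖h t‖ ^ 2 = N :=
    setIntegral_congr_fun measurableSet_Ioc fun t ht => by
      simp only [hh, Set.indicator_of_mem ht, Spinor.norm_conj]
  have hFz : F z = (N : ℂ) := by
    simp only [hF]
    rw [intervalIntegral.integral_of_le hxc, hN, ← integral_complex_ofReal]
    refine setIntegral_congr_fun measurableSet_Ioc fun t ht => ?_
    simp only [hh, Set.indicator_of_mem ht, ← spinorDot_conj_self]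
    simp only [spinorDot]
    ring
  have hFb (w : ℂ) (hw : w.im ≠ 0) : |w.im| * ‖F w‖ ≤ √(N * g) := by
    refine Real.le_sqrt_of_sq_le ?_
    have h1 : ‖F w‖ ≤ ∫ t in Set.Ioc x c, ‖f w t‖ * ‖h t‖ := by
      simp only [hF]
      rw [intervalIntegral.integral_of_le hxc]
      exact norm_integral_le_of_norm_le (DiracExpr.integrableOn_mul_norm (hfL w) (hhm.restrict _))
        (Eventually.of_forall fun t => norm_spinorDot_le _ _)
    have h2 := sq_integral_mul_norm_le (hfL w) (hhm.restrict (Set.Ioc x c))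
    rw [hhN] at h2
    have h3 := integral_truncGreen_le hH hsys hw hG hx hc hxc
    calc (|w.im| * ‖F w‖) ^ 2 = w.im ^ 2 * ‖F w‖ ^ 2 := by rw [mul_pow, sq_abs]
      _ ≤ w.im ^ 2 * ((∫ t in Set.Ioc x c, ‖f w t‖ ^ 2) * N) := by
          refine mul_le_mul_of_nonneg_left ?_ (sq_nonneg _)
          exact (pow_le_pow_left₀ (norm_nonneg _) h1 2).trans h2
      _ = (w.im ^ 2 * ∫ t in Set.Ioc x c, ‖f w t‖ ^ 2) * N := by ring
      _ ≤ g * N := mul_le_mul_of_nonneg_right h3 hN0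
      _ = N * g := mul_comm _ _
  -- The energy estimate bounds F only by 1/|Im w|. On the circle the added factor has modulus 2ρ|Im
  -- w|, which removes this singularity; at the centre it equals -ρ².
  have hmax := Complex.norm_le_of_forall_mem_frontier_norm_le (U := Metric.ball z ρ)
    (f := fun w => F w * ((w - z) ^ 2 - (ρ : ℂ) ^ 2)) (C := 2 * ρ * √(N * g))
    Metric.isBounded_ball ?_ ?_ (subset_closure (Metric.mem_ball_self hρ0))
  · simp only [sub_self, hFz] at hmax
    rw [norm_mul, Complex.norm_real, Real.norm_of_nonneg hN0, zero_pow two_ne_zero, zero_sub,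
      norm_neg, norm_pow, Complex.norm_real, Real.norm_of_nonneg hρ0.le] at hmax
    have h1 : N * ρ ≤ 2 * √(N * g) := by
      refine le_of_mul_le_mul_right ?_ hρ0
      linarith
    have h2 : (N * ρ) ^ 2 ≤ 4 * (N * g) := by
      refine (pow_le_pow_left₀ (by positivity) h1 2).trans ?_
      rw [mul_pow, Real.sq_sqrt (by positivity)]
      norm_num
    rw [div_mul_eq_mul_div, le_div_iff₀ (by positivity)]
    rcases hN0.eq_or_lt with h3 | h3
    · rw [← h3]; simpa using hg0
    · refine le_of_mul_le_mul_left ?_ h3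
      linarith
  · have hcl : closure (Metric.ball z ρ) ⊆ Metric.ball z R :=
      Metric.closure_ball_subset_closedBall.trans (Metric.closedBall_subset_ball (by linarith))
    refine DifferentiableOn.diffContOnCl ((hFd.mono hcl).mul ?_)
    fun_prop
  · intro w hw
    rw [frontier_ball z hρ0.ne', Metric.mem_sphere, dist_eq_norm] at hw
    have h1 := norm_sq_sub_sq_of_mem_sphere (z := w) hz
    rw [hw] at h1
    rw [norm_mul, h1]
    by_cases hw0 : w.im = 0
    · rw [hw0, abs_zero, mul_zero, mul_zero]; positivity
    · have := hFb w hw0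
      calc ‖F w‖ * (2 * ρ * |w.im|) = 2 * ρ * (|w.im| * ‖F w‖) := by ring
        _ ≤ _ := by gcongr

end DiracOperator

theorem MeasureTheory.Lp.norm_sq_eq_integral {α E : Type*} [MeasurableSpace α] {μ : Measure α}
    [NormedAddCommGroup E] [InnerProductSpace ℂ E] (f : Lp E 2 μ) :
    ‖f‖ ^ 2 = ∫ a, ‖f a‖ ^ 2 ∂μ := by
  have h1 : ((‖f‖ ^ 2 : ℝ) : ℂ) = ((∫ a, ‖f a‖ ^ 2 ∂μ : ℝ) : ℂ) := by
    rw [← integral_complex_ofReal]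
    have := inner_self_eq_norm_sq_to_K (𝕜 := ℂ) f
    rw [L2.inner_def] at this
    push_cast
    refine this.symm.trans (integral_congr_ae (Eventually.of_forall fun a => ?_))
    exact inner_self_eq_norm_sq_to_K (𝕜 := ℂ) (f a)
  exact_mod_cast h1

/-! ### Removal of the truncation -/

namespace DiracExpr

variable {T : DiracExpr}

theorem tendsto_integral_nearA (hab : T.a < T.b) {c : ℝ} (hc : c ∈ T.I) {k : ℝ → ℂ}
    (hk : IntegrableOn k (T.leftPart c)) :
    Tendsto (fun x => ∫ t in x..c, k t) T.nearA (𝓝 (∫ t in T.leftPart c, k t)) := by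
  have hE := isEnd_left hab
  have := hE.cg
  refine ((hE.aecover hc).integral_tendsto_of_countably_generated hk).congr' ?_
  filter_upwards [hE.mem c hc] with x hx
  rw [hE.restrict_uIoc hx, Set.uIoc_of_ge hx.2.le, intervalIntegral.integral_of_le hx.2.le]

theorem isOpen_leftPart (c : ℝ) : IsOpen (T.leftPart c) :=
  (isOpen_lt continuous_const continuous_coe_real_ereal).inter isOpen_Iio

theorem ae_leftClosed {c : ℝ} {p : ℝ → Prop} (h : ∀ᵐ t, t ∈ T.leftPart c → p t) :
    ∀ᵐ t, t ∈ T.leftClosed c → p t := by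
  have hne : ∀ᵐ t : ℝ, t ≠ c := by simp [ae_iff, measure_singleton]
  filter_upwards [h, hne] with t h1 h2 ht using h1 ⟨ht.1, lt_of_le_of_ne ht.2 h2⟩

theorem IsSolOn.sub_leftClosed {c : ℝ} {F G f g : ℝ → Spinor}
    (hf : T.IsSolOn (T.leftClosed c) F f) (hg : T.IsSolOn (T.leftClosed c) G g) :
    T.IsSolOn (T.leftClosed c) (fun t => F t - G t) (fun t => f t - g t) := by
  refine ⟨fun x hx y hy => (hf.1 x hx y hy).sub (hg.1 x hx y hy),
    ae_leftClosed (ae_of_forall_uIcc (isOpen_leftPart c) fun x hx y hy _ => ?_)⟩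
  have hx' := leftPart_subset_leftClosed c hx
  have hy' := leftPart_subset_leftClosed c hy
  obtain ⟨f0, f1⟩ := hf.hasACDeriv (ordConnected_leftClosed c) hx' hy'
  obtain ⟨g0, g1⟩ := hg.hasACDeriv (ordConnected_leftClosed c) hx' hy'
  have h0 : HasACDeriv (fun t => (f t - g t) 0) (T.rhs0 (fun t => F t - G t) fun t => f t - g t) x y :=
    (f0.sub g0).congr_deriv fun t _ => by simp only [rhs0, PiLp.sub_apply]; ring
  have h1 : HasACDeriv (fun t => (f t - g t) 1) (T.rhs1 (fun t => F t - G t) fun t => f t - g t) x y :=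
    (f1.sub g1).congr_deriv fun t _ => by simp only [rhs1, PiLp.sub_apply]; ring
  filter_upwards [h0.2, h1.2] with t e0 e1 ht
  exact (hasDerivAt_iff_op.2 ⟨e0 ht, e1 ht⟩).2

end DiracExpr

namespace DiracOperator

variable {H : DiracOperator} {Φ Θ : ℂ → ℝ → Spinor} {z : ℂ} {c : ℝ} {G G' : ℝ → Spinor}

/-- The solution of the inhomogeneous equation on `(a, c)` which lies in the domain near `a` and
whose first component vanishes at `c`. -/
noncomputable def fullGreen (H : DiracOperator) (Φ Θ : ℂ → ℝ → Spinor) (G : ℝ → Spinor) (c : ℝ)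
    (z : ℂ) : ℝ → Spinor :=
  DiracExpr.green (dirichletPsi Φ Θ c z) (Φ z) G c
    (∫ t in H.leftPart c, spinorDot (Φ z t) (G t))

/-- The coefficient of ψ is a tail integral that tends to 0 as x → a, so uniform bounds pass from
the truncated to the full solution. -/
theorem fullGreen_eq (x t : ℝ) : H.fullGreen Φ Θ G c z t = truncGreen Φ Θ G c x z t +
    ((∫ t in H.leftPart c, spinorDot (Φ z t) (G t)) - ∫ t in x..c, spinorDot (Φ z t) (G t)) •
      dirichletPsi Φ Θ c z t := by
  simp only [fullGreen, truncGreen, DiracExpr.green]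
  module

theorem memLp_phi_left (hH : H.IsAdmissible) (hsys : H.IsFundamentalSystem Φ Θ) (z : ℂ)
    (hc : c ∈ H.I) : MemLp (Φ z) 2 (volume.restrict (H.leftPart c)) :=
  (DiracExpr.isEnd_left hH.1).memLp (hsys.1.1 z).continuousOn (hsys.2.2.2 z).2.2.2.1 hc

theorem integrableOn_phi_left (hH : H.IsAdmissible) (hsys : H.IsFundamentalSystem Φ Θ) (z : ℂ)
    (hc : c ∈ H.I) (hG : MemLp G 2 volume) :
    IntegrableOn (fun t => spinorDot (Φ z t) (G t)) (H.leftPart c) :=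
  DiracExpr.integrableOn_spinorDot (memLp_phi_left hH hsys z hc) (hG.restrict _)

/-- On a fixed interval (y,c) the truncated solutions are bounded uniformly in x. First x → a, then
y → a; the factor 2 comes from |p + q|² ≤ 2|p|² + 2|q|². -/
theorem exists_fullGreen_bound (hH : H.IsAdmissible) (hsys : H.IsFundamentalSystem Φ Θ)
    (hc : c ∈ H.I) (h0 : Φ z c 0 ≠ 0) :
    ∃ C, 0 ≤ C ∧ ∀ G : ℝ → Spinor, MemLp G 2 volume →
      MemLp (H.fullGreen Φ Θ G c z) 2 (volume.restrict (H.leftPart c)) ∧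
      ∫ t in H.leftPart c, ‖H.fullGreen Φ Θ G c z t‖ ^ 2 ≤
        C * ∫ t in H.leftPart c, ‖G t‖ ^ 2 := by
  have hE := DiracExpr.isEnd_left hH.1
  have := hE.neBot
  have := hE.cg
  obtain ⟨C, hC, hb⟩ := exists_truncGreen_bound hH hsys hc h0
  refine ⟨2 * C, by positivity, fun G hG => ?_⟩
  set g := ∫ t in H.leftPart c, ‖G t‖ ^ 2 with hg
  have hfc : ContinuousOn (H.fullGreen Φ Θ G c z) H.I := continuousOn_green hsys z hG hc _
  have hψc := (isSolution_dirichletPsi (c := c) hsys z).continuousOn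
  have hGi : IntegrableOn (fun t => ‖G t‖ ^ 2) (H.leftPart c) := (hG.restrict _).norm.integrable_sq
  have key : ∀ y ∈ H.leftPart c,
      ∫ t in Set.uIoc c y, ‖H.fullGreen Φ Θ G c z t‖ ^ 2 ≤ 2 * C * g := by
    intro y hy
    have hyI := hE.sub c hc hy
    have hi {v : ℝ → Spinor} (hv : ContinuousOn v H.I) {x : ℝ} (hx : x ∈ H.I) :
        IntegrableOn (fun t => ‖v t‖ ^ 2) (Set.uIoc c x) :=
      (DiracExpr.memLp_uIcc hv hc hx).norm.integrable_sq.mono_measure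
        (Measure.restrict_mono Set.uIoc_subset_uIcc le_rfl)
    set P := ∫ t in Set.uIoc c y, ‖dirichletPsi Φ Θ c z t‖ ^ 2 with hP
    set d : ℝ → ℂ := fun x => (∫ t in H.leftPart c, spinorDot (Φ z t) (G t)) -
      ∫ t in x..c, spinorDot (Φ z t) (G t) with hd
    have hd0 : Tendsto (fun x => 2 * C * g + 2 * ‖d x‖ ^ 2 * P) H.nearA (𝓝 (2 * C * g)) := by
      have h1 := (DiracExpr.tendsto_integral_nearA hH.1 hc
        (integrableOn_phi_left hH hsys z hc hG)).const_sub
          (∫ t in H.leftPart c, spinorDot (Φ z t) (G t))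
      rw [sub_self] at h1
      have h2 := (((h1.norm.pow 2).const_mul 2).mul_const P).const_add (2 * C * g)
      simpa using h2
    refine ge_of_tendsto hd0 ?_
    filter_upwards [hE.mem y hyI] with x hx
    have hxI := hE.sub y hyI hx
    have hxc := hE.mono c y hy hx
    have htc : ContinuousOn (truncGreen Φ Θ G c x z) H.I := continuousOn_green hsys z hG hc _
    have h1 : ∫ t in Set.uIoc c y, ‖truncGreen Φ Θ G c x z t‖ ^ 2 ≤ C * g := by
      calc ∫ t in Set.uIoc c y, ‖truncGreen Φ Θ G c x z t‖ ^ 2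
          ≤ ∫ t in Set.uIoc c x, ‖truncGreen Φ Θ G c x z t‖ ^ 2 :=
            setIntegral_mono_set (hi htc hxI) (Eventually.of_forall fun _ => by positivity)
              (hE.nested c y x hy hx).eventuallyLE
        _ ≤ C * ∫ t in Set.uIoc c x, ‖G t‖ ^ 2 := by
            rw [Set.uIoc_of_ge hxc.2.le]
            exact hb G hG x hxI hxc.2.le
        _ ≤ C * g := mul_le_mul_of_nonneg_left (hE.integral_uIoc_le hxc hGi fun _ => by positivity) hC
    calc ∫ t in Set.uIoc c y, ‖H.fullGreen Φ Θ G c z t‖ ^ 2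
        ≤ ∫ t in Set.uIoc c y, (2 * ‖truncGreen Φ Θ G c x z t‖ ^ 2 +
            2 * ‖d x‖ ^ 2 * ‖dirichletPsi Φ Θ c z t‖ ^ 2) := by
          refine integral_mono_of_nonneg (Eventually.of_forall fun _ => by positivity)
            (((hi htc hyI).const_mul 2).add ((hi hψc hyI).const_mul _))
            (Eventually.of_forall fun t => ?_)
          simp only
          rw [fullGreen_eq x t]
          have h2 := norm_add_le (truncGreen Φ Θ G c x z t) (d x • dirichletPsi Φ Θ c z t)
          rw [norm_smul] at h2
          refine (pow_le_pow_left₀ (norm_nonneg _) h2 2).trans ?_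
          nlinarith [sq_nonneg (‖truncGreen Φ Θ G c x z t‖ - ‖d x‖ * ‖dirichletPsi Φ Θ c z t‖)]
      _ = 2 * (∫ t in Set.uIoc c y, ‖truncGreen Φ Θ G c x z t‖ ^ 2) + 2 * ‖d x‖ ^ 2 * P := by
          rw [integral_add ((hi htc hyI).const_mul 2) ((hi hψc hyI).const_mul _),
            integral_const_mul, integral_const_mul]
      _ ≤ 2 * C * g + 2 * ‖d x‖ ^ 2 * P := by linarith
  have hm : MemLp (H.fullGreen Φ Θ G c z) 2 (volume.restrict (H.leftPart c)) :=
    hE.memLp_of_bounded hfc hc (by filter_upwards [hE.mem c hc] with y hy using key y hy)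
  refine ⟨hm, le_of_tendsto ((hE.aecover hc).integral_tendsto_of_countably_generated
    hm.norm.integrable_sq) ?_⟩
  filter_upwards [hE.mem c hc] with y hy
  rw [hE.restrict_uIoc hy]
  exact key y hy

theorem isSolOn_fullGreen (hsys : H.IsFundamentalSystem Φ Θ) (z : ℂ) (hG : MemLp G 2 volume)
    (hc : c ∈ H.I) :
    H.IsSolOn H.I (fun t => z • H.fullGreen Φ Θ G c z t + G t) (H.fullGreen Φ Θ G c z) :=
  isSolOn_green hsys z hG hc _

theorem fullGreen_self (h0 : Φ z c 0 ≠ 0) : H.fullGreen Φ Θ G c z c 0 = 0 :=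
  DiracExpr.green_self _ (dirichletPsi_self h0)

/-- In the limit circle case the coefficient of Φ converges and W(wa,Φ) → 0, while the coefficient
of ψ tends to 0 and W(wa,ψ) converges. -/
theorem bcA_fullGreen (hH : H.IsAdmissible) (hsys : H.IsFundamentalSystem Φ Θ) (hc : c ∈ H.I)
    (hG : MemLp G 2 volume) : H.BCA (H.fullGreen Φ Θ G c z) := by
  have hE := DiracExpr.isEnd_left hH.1
  by_cases hlc : H.LimitCircleA
  · obtain ⟨⟨μ, hμ⟩, -, -⟩ := hH.2.2.2.2.2.1 hlc
    have hψ := isSolution_dirichletPsi (c := c) hsys z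
    have hψL := hE.memLp hψ.continuousOn (hlc _ _ hψ) hc
    obtain ⟨L, hL⟩ := hE.tendsto_wronskian hμ hψ (hlc _ _ hμ) (hlc _ _ hψ)
    have h1 := DiracExpr.tendsto_integral_nearA hH.1 hc
      (DiracExpr.integrableOn_spinorDot hψL (hG.restrict _))
    have h2 := (DiracExpr.tendsto_integral_nearA hH.1 hc
        (integrableOn_phi_left hH hsys z hc hG)).const_sub
          (∫ t in H.leftPart c, spinorDot (Φ z t) (G t))
    have h3 := (h1.mul (hsys.2.2.2 z).2.2.2.2.2).add (h2.mul hL)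
    rw [sub_self, mul_zero, zero_mul, add_zero] at h3
    refine h3.congr fun x => ?_
    simp only [wronskian, fullGreen, DiracExpr.green, PiLp.add_apply, PiLp.smul_apply, smul_eq_mul,
      intervalIntegral.integral_symm x c]
    ring
  · rw [BCA, hH.2.2.2.2.2.2.1 hlc]
    exact tendsto_const_nhds.congr fun x => by simp [wronskian]

theorem green_add {ψ φ : ℝ → Spinor} (hψ : ContinuousOn ψ H.I) (hφ : ContinuousOn φ H.I)
    (hG : MemLp G 2 volume) (hG' : MemLp G' 2 volume) (hc : c ∈ H.I) (k k' : ℂ) {x : ℝ}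
    (hx : x ∈ H.I) : DiracExpr.green ψ φ (G + G') c (k + k') x =
      DiracExpr.green ψ φ G c k x + DiracExpr.green ψ φ G' c k' x := by
  have h1 (u : ℝ → Spinor) (t : ℝ) : spinorDot (u t) ((G + G') t) =
      spinorDot (u t) (G t) + spinorDot (u t) (G' t) := by
    simp only [spinorDot, Pi.add_apply, PiLp.add_apply]; ring
  simp only [DiracExpr.green, h1]
  rw [intervalIntegral.integral_add (DiracExpr.intervalIntegrable_spinorDot hψ hG hx hc)
    (DiracExpr.intervalIntegrable_spinorDot hψ hG' hx hc),
    intervalIntegral.integral_add (DiracExpr.intervalIntegrable_spinorDot hφ hG hc hx)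
    (DiracExpr.intervalIntegrable_spinorDot hφ hG' hc hx)]
  module

theorem fullGreen_add (hH : H.IsAdmissible) (hsys : H.IsFundamentalSystem Φ Θ)
    (hG : MemLp G 2 volume) (hG' : MemLp G' 2 volume) (hc : c ∈ H.I) {x : ℝ} (hx : x ∈ H.I) :
    H.fullGreen Φ Θ (G + G') c z x = H.fullGreen Φ Θ G c z x + H.fullGreen Φ Θ G' c z x := by
  have h1 : ∫ t in H.leftPart c, spinorDot (Φ z t) ((G + G') t) =
      (∫ t in H.leftPart c, spinorDot (Φ z t) (G t)) +
        ∫ t in H.leftPart c, spinorDot (Φ z t) (G' t) := by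
    rw [← integral_add (integrableOn_phi_left hH hsys z hc hG)
      (integrableOn_phi_left hH hsys z hc hG')]
    refine integral_congr_ae (Eventually.of_forall fun t => ?_)
    simp only [spinorDot, Pi.add_apply, PiLp.add_apply]; ring
  rw [fullGreen, h1]
  exact green_add (isSolution_dirichletPsi hsys z).continuousOn (hsys.1.1 z).continuousOn hG hG'
    hc _ _ hx

theorem fullGreen_smul (k : ℂ) (x : ℝ) :
    H.fullGreen Φ Θ (k • G) c z x = k • H.fullGreen Φ Θ G c z x := by
  have h1 (u : ℝ → Spinor) (t : ℝ) : spinorDot (u t) ((k • G) t) = k * spinorDot (u t) (G t) := by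
    simp only [spinorDot, Pi.smul_apply, PiLp.smul_apply, smul_eq_mul]; ring
  simp only [fullGreen, DiracExpr.green, h1, integral_const_mul,
    intervalIntegral.integral_const_mul]
  module

theorem fullGreen_congr (h : G =ᵐ[volume] G') :
    H.fullGreen Φ Θ G c z = H.fullGreen Φ Θ G' c z := by
  have h1 (u : ℝ → Spinor) (x y : ℝ) : ∫ t in x..y, spinorDot (u t) (G t) =
      ∫ t in x..y, spinorDot (u t) (G' t) :=
    intervalIntegral.integral_congr_ae (h.mono fun t ht _ => by rw [ht])
  have h2 : ∫ t in H.leftPart c, spinorDot (Φ z t) (G t) =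
      ∫ t in H.leftPart c, spinorDot (Φ z t) (G' t) :=
    integral_congr_ae (ae_restrict_of_ae (h.mono fun t ht => by simp only [ht]))
  funext x
  simp only [fullGreen, DiracExpr.green, h1, h2]

end DiracOperator

/-! ### The resolvent on (a,c) and discreteness of the spectrum -/

namespace DiracOperator

variable {H : DiracOperator} {Φ Θ : ℂ → ℝ → Spinor} {z : ℂ} {c : ℝ}

/-- The extension by zero of an element of `L²((a, c), ℂ²)`. -/
noncomputable def extendZero (H : DiracOperator) (c : ℝ)
    (g : Lp Spinor 2 (volume.restrict (H.leftPart c))) : ℝ → Spinor :=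
  (H.leftPart c).indicator g

theorem measurableSet_leftPart (c : ℝ) : MeasurableSet (H.leftPart c) :=
  (DiracExpr.isOpen_leftPart c).measurableSet

theorem memLp_extendZero (g : Lp Spinor 2 (volume.restrict (H.leftPart c))) :
    MemLp (H.extendZero c g) 2 volume :=
  (memLp_indicator_iff_restrict (measurableSet_leftPart c)).2 (Lp.memLp g)

theorem extendZero_ae (g : Lp Spinor 2 (volume.restrict (H.leftPart c))) :
    H.extendZero c g =ᵐ[volume.restrict (H.leftPart c)] g :=
  indicator_ae_eq_restrict (measurableSet_leftPart c)

theorem extendZero_add (g g' : Lp Spinor 2 (volume.restrict (H.leftPart c))) :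
    H.extendZero c (g + g') =ᵐ[volume] H.extendZero c g + H.extendZero c g' := by
  filter_upwards [(ae_restrict_iff' (measurableSet_leftPart c)).1 (Lp.coeFn_add g g')] with t ht
  by_cases hm : t ∈ H.leftPart c
  · simp only [extendZero, Pi.add_apply, Set.indicator_of_mem hm]; exact ht hm
  · simp only [extendZero, Pi.add_apply, Set.indicator_of_notMem hm, add_zero]

theorem extendZero_smul (k : ℂ) (g : Lp Spinor 2 (volume.restrict (H.leftPart c))) :
    H.extendZero c (k • g) =ᵐ[volume] k • H.extendZero c g := by
  filter_upwards [(ae_restrict_iff' (measurableSet_leftPart c)).1 (Lp.coeFn_smul k g)] with t ht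
  by_cases hm : t ∈ H.leftPart c
  · simp only [extendZero, Pi.smul_apply, Set.indicator_of_mem hm]; exact ht hm
  · simp only [extendZero, Pi.smul_apply, Set.indicator_of_notMem hm, smul_zero]

/-- The resolvent of the Dirichlet operator on `(a, c)`. -/
theorem exists_resolvent (hH : H.IsAdmissible) (hsys : H.IsFundamentalSystem Φ Θ) (hc : c ∈ H.I)
    (h0 : Φ z c 0 ≠ 0) :
    ∃ R : Lp Spinor 2 (volume.restrict (H.leftPart c)) →L[ℂ]
      Lp Spinor 2 (volume.restrict (H.leftPart c)),
      ∀ g, R g =ᵐ[volume.restrict (H.leftPart c)] H.fullGreen Φ Θ (H.extendZero c g) c z := by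
  obtain ⟨C, hC, hb⟩ := exists_fullGreen_bound hH hsys hc h0
  have hI := (DiracExpr.isEnd_left hH.1).sub c hc
  have hm (g : Lp Spinor 2 (volume.restrict (H.leftPart c))) :=
    (hb _ (memLp_extendZero g)).1
  let R : Lp Spinor 2 (volume.restrict (H.leftPart c)) →ₗ[ℂ]
      Lp Spinor 2 (volume.restrict (H.leftPart c)) :=
    { toFun := fun g => (hm g).toLp
      map_add' := fun g g' => by
        rw [← MemLp.toLp_add]
        refine MemLp.toLp_congr _ _ ((ae_restrict_iff' (measurableSet_leftPart c)).2
          (Eventually.of_forall fun t ht => ?_))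
        rw [fullGreen_congr (extendZero_add g g')]
        exact fullGreen_add hH hsys (memLp_extendZero g) (memLp_extendZero g') hc (hI ht)
      map_smul' := fun k g => by
        rw [RingHom.id_apply, ← MemLp.toLp_const_smul]
        refine MemLp.toLp_congr _ _ (Eventually.of_forall fun t => ?_)
        rw [fullGreen_congr (extendZero_smul k g)]
        exact fullGreen_smul k t }
  refine ⟨R.mkContinuous √C fun g => ?_, fun g => (hm g).coeFn_toLp⟩
  refine (sq_le_sq₀ (norm_nonneg _) (by positivity)).1 ?_
  rw [mul_pow, Real.sq_sqrt hC, Lp.norm_sq_eq_integral, Lp.norm_sq_eq_integral]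
  have e1 : ∫ t in H.leftPart c, ‖R g t‖ ^ 2 =
      ∫ t in H.leftPart c, ‖H.fullGreen Φ Θ (H.extendZero c g) c z t‖ ^ 2 :=
    integral_congr_ae ((hm g).coeFn_toLp.mono fun t ht => by
      change ‖(hm g).toLp _ t‖ ^ 2 = _
      rw [ht])
  have e2 : ∫ t in H.leftPart c, ‖g t‖ ^ 2 = ∫ t in H.leftPart c, ‖H.extendZero c g t‖ ^ 2 :=
    integral_congr_ae ((extendZero_ae g).mono fun t ht => by simp only [ht])
  rw [e1, e2]
  exact (hb _ (memLp_extendZero g)).2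

theorem isSolOn_of_mem_dirichletGraph {p q : Lp Spinor 2 (volume.restrict (H.leftPart c))}
    {f G : ℝ → Spinor} (hac : ACLoc (H.leftClosed c) f)
    (hp : p =ᵐ[volume.restrict (H.leftPart c)] f)
    (hq : q =ᵐ[volume.restrict (H.leftPart c)] H.op f)
    (hG : (q - z • p : Lp Spinor 2 (volume.restrict (H.leftPart c)))
      =ᵐ[volume.restrict (H.leftPart c)] G) :
    H.IsSolOn (H.leftClosed c) (fun t => z • f t + G t) f := by
  refine ⟨hac, DiracExpr.ae_leftClosed ((ae_restrict_iff' (measurableSet_leftPart c)).1 ?_)⟩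
  filter_upwards [hp, hq, hG, Lp.coeFn_sub q (z • p), Lp.coeFn_smul z p] with t e1 e2 e3 e4 e5
  rw [← e3, e4, Pi.sub_apply, e5, Pi.smul_apply, e2, e1, add_sub_cancel]

/-- For an element f of the domain, f minus the Green solution is a homogeneous solution in the
domain near a, hence a multiple of Φ(z). Its first component vanishes at c where that of Φ(z) does
not, so it is zero. -/
theorem mem_graphResolventSet (hH : H.IsAdmissible) (hsys : H.IsFundamentalSystem Φ Θ)
    (hc : c ∈ H.I) (h0 : Φ z c 0 ≠ 0) : z ∈ graphResolventSet (H.dirichletGraph c) := by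
  obtain ⟨R, hR⟩ := exists_resolvent hH hsys hc h0
  have hE := DiracExpr.isEnd_left hH.1
  have hcc : c ∈ H.leftClosed c := ⟨hc.1, le_rfl⟩
  refine ⟨R, fun p q => ?_⟩
  set g := q - z • p with hg
  set w := H.fullGreen Φ Θ (H.extendZero c g) c z with hw
  have hws := isSolOn_fullGreen hsys z (memLp_extendZero g) hc
  have hwA : H.BCA w := bcA_fullGreen hH hsys hc (memLp_extendZero g)
  have hw0 : w c 0 = 0 := fullGreen_self h0
  constructor
  · rintro ⟨f, hac, hA, hf0, hp, hq⟩
    simp only at hp hq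
    have hfs := isSolOn_of_mem_dirichletGraph (H := H) (z := z) hac hp hq (extendZero_ae g).symm
    have hd := hfs.sub_leftClosed (hws.mono (DiracExpr.leftClosed_subset hc))
    have hd' : H.IsSolOn (H.leftClosed c) (fun t => z • (f t - w t)) (fun t => f t - w t) :=
      ⟨hd.1, hd.2.mono fun t ht hm => by
        refine (ht hm).trans ?_
        simp only [hw, smul_sub]
        abel⟩
    have hL : MemLp (fun t => f t - w t) 2 (volume.restrict (H.leftPart c)) :=
      ((Lp.memLp p).ae_eq hp).sub ((Lp.memLp (R g)).ae_eq (hR g))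
    have hBC : H.BCA (fun t => f t - w t) := by
      have h1 := Tendsto.sub hA hwA
      rw [sub_zero] at h1
      refine h1.congr fun x => ?_
      simp only [wronskian, PiLp.sub_apply]
      ring
    have hz := (hsys.eq_smul_phi hH hc hd' hL hBC).2
    have hk : wronskian (Θ z) (fun t => f t - w t) c = 0 := by
      have h1 := congrArg (fun v : Spinor => v 0) (hz c hcc)
      simp only [PiLp.smul_apply, PiLp.sub_apply, smul_eq_mul, hf0, hw0, sub_zero] at h1
      exact (mul_eq_zero.1 h1).resolve_right h0
    refine Lp.ext ((hR g).trans (EventuallyEq.trans ?_ hp.symm))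
    refine (ae_restrict_iff' (measurableSet_leftPart c)).2 (Eventually.of_forall fun t ht => ?_)
    have h1 := hz t (DiracExpr.leftPart_subset_leftClosed c ht)
    rw [hk, zero_smul] at h1
    exact (sub_eq_zero.1 h1.symm).symm
  · intro hp
    have hpw : p =ᵐ[volume.restrict (H.leftPart c)] w := by rw [← hp]; exact hR g
    refine ⟨w, (hws.mono (DiracExpr.leftClosed_subset hc)).1, hwA, hw0, hpw, ?_⟩
    filter_upwards [hpw, extendZero_ae g, Lp.coeFn_sub q (z • p), Lp.coeFn_smul z p,
      (ae_restrict_iff' (measurableSet_leftPart c)).2 (hws.mono (hE.sub c hc)).2]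
      with t e1 e2 e3 e4 e5
    rw [e5, e2, e3, Pi.sub_apply, e4, Pi.smul_apply, e1, add_sub_cancel]

/-- An operator with a fundamental system has purely discrete spectrum near `a`. -/
theorem IsFundamentalSystem.discreteNearA (hH : H.IsAdmissible)
    (hsys : H.IsFundamentalSystem Φ Θ) : H.DiscreteNearA := by
  intro c hc z hz
  have hE := DiracExpr.isEnd_left hH.1
  -- The spectrum lies in the zero set of the entire function w ↦ Φ₁(w,c); at such a zero Φ(z) is an
  -- eigenfunction and spans the eigenspace.
  have hspec : ∀ w ∈ graphSpectrum (H.dirichletGraph c), Φ w c 0 = 0 := fun w hw => by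
    by_contra h0
    exact hw (mem_graphResolventSet hH hsys hc h0)
  have h0 := hspec z hz
  have hΦL := memLp_phi_left hH hsys z hc
  have hΦs := hsys.1.1 z
  have hΦ' : H.IsSolOn (H.leftPart c) (fun t => z • Φ z t) (Φ z) :=
    (DiracExpr.isSolution_iff.1 hΦs).mono (hE.sub c hc)
  refine ⟨?_, ⟨hΦL.toLp, fun h => ?_, Φ z, ?_, (hsys.2.2.2 z).2.2.2.2.2, h0, hΦL.coeFn_toLp, ?_⟩, ?_⟩
  · have hd : Differentiable ℂ fun w => Φ w c 0 := (hsys.1.2.1 c hc).spinor_apply 0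
    have han : AnalyticOnNhd ℂ (fun w => Φ w c 0) Set.univ :=
      hd.differentiableOn.analyticOnNhd isOpen_univ
    -- Zeros are isolated unless the function vanishes identically, which is excluded by its value
    -- at i.
    rcases (han z trivial).eventually_eq_zero_or_eventually_ne_zero with h1 | h1
    · refine absurd (congrFun (han.eq_of_eventuallyEq (g := fun _ => 0)
        analyticOnNhd_const h1) Complex.I) ?_
      exact hsys.phi_apply_zero_ne_zero hH (by simp) hc
    · refine ⟨_, eventually_nhdsWithin_iff.1 h1, fun w hw => ?_⟩
      by_contra hne
      exact hw.1 hne (hspec w hw.2)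
  · have h1 : Φ z =ᵐ[volume.restrict (H.leftPart c)] (0 : ℝ → Spinor) := by
      refine hΦL.coeFn_toLp.symm.trans ?_
      rw [h]
      exact Lp.coeFn_zero _ _ _
    have hne : ∀ᵐ t ∂(volume.restrict (H.leftPart c)), False := by
      filter_upwards [h1, ae_restrict_mem (measurableSet_leftPart c)] with t ht hm
      exact hsys.phi_ne_zero z (hE.sub c hc hm) ht
    have := hE.neBot
    have hnonempty : (H.leftPart c).Nonempty := Filter.nonempty_of_mem (hE.mem c hc)
    have hpos := (DiracExpr.isOpen_leftPart (T := H.toDiracExpr) c).measure_pos volume hnonempty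
    rw [ae_iff] at hne
    simp only [not_false_eq_true, Set.ofPred_true, Measure.restrict_apply_univ] at hne
    exact hpos.ne' hne
  · exact ((DiracExpr.isSolution_iff.1 hΦs).mono (DiracExpr.leftClosed_subset hc)).1
  · filter_upwards [hΦL.coeFn_toLp, Lp.coeFn_smul z hΦL.toLp,
      (ae_restrict_iff' (measurableSet_leftPart c)).2 hΦ'.2] with t e1 e2 e3
    rw [e2, Pi.smul_apply, e1, e3]
  · have : FiniteDimensional ℂ (Submodule.span ℂ {hΦL.toLp}) := inferInstance
    refine Submodule.finiteDimensional_of_le (S₂ := Submodule.span ℂ {hΦL.toLp})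
      (Submodule.span_le.2 ?_)
    rintro p ⟨f, hac, hA, hf0, hp, hq⟩
    simp only at hp hq
    have hfs : H.IsSolOn (H.leftClosed c) (fun t => z • f t) f := by
      have h1 := isSolOn_of_mem_dirichletGraph (H := H) (z := z) (G := fun _ => 0) hac hp hq
        (by rw [sub_self]; exact Lp.coeFn_zero _ _ _)
      simpa only [add_zero] using h1
    have hk := (hsys.eq_smul_phi hH hc hfs ((Lp.memLp p).ae_eq hp) hA).2
    refine Submodule.mem_span_singleton.2 ⟨wronskian (Θ z) f c, Lp.ext ?_⟩
    filter_upwards [Lp.coeFn_smul (wronskian (Θ z) f c) hΦL.toLp, hΦL.coeFn_toLp, hp,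
      ae_restrict_mem (measurableSet_leftPart c)] with t e1 e2 e3 ht
    rw [e1, Pi.smul_apply, e2, e3]
    exact hk t (DiracExpr.leftPart_subset_leftClosed c ht)

end DiracOperator

/-! ### Assembly of the theorem -/

theorem mainTheorem3
    (H : DiracOperator) (hH : H.IsAdmissible)
    (Φ Θ : ℂ → ℝ → Spinor) (hsys : H.IsFundamentalSystem Φ Θ)
    (lam : ℝ)
    (hb : H.InDomainNearB (Θ (lam : ℂ)))
    (hnot : ¬ MemLp (Θ (lam : ℂ)) 2 (volume.restrict H.I))
    (γ : ℝ≥0∞) (hγ : 0 < γ) :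
    ∃ Wb : ℂ,
      -- the boundary Wronskian of `Θ(λ)` and the `z`-derivative of `Θ` at `λ` exists
      Tendsto (wronskian (Θ (lam : ℂ)) (fun x => deriv (fun z : ℂ => Θ z x) (lam : ℂ)))
        H.nearB (𝓝 Wb) ∧
      (H.doubleCommutation (Θ (lam : ℂ)) γ).IsAdmissible ∧
      ∃ Φγ Θγ : ℂ → ℝ → Spinor,
        -- the system of real entire solutions, with Wronskian one
        (H.doubleCommutation (Θ (lam : ℂ)) γ).IsFundamentalSystem Φγ Θγ ∧
        (∀ z : ℂ, z ≠ lam → ∀ x ∈ H.I,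
          Φγ z x = (z - lam) • (Φ z x + (1 / (z - lam)) •
            (wronskian (Θ (lam : ℂ)) (Φ z) x • H.uGamma (Θ (lam : ℂ)) γ x))) ∧
        (∀ z : ℂ, z ≠ lam → ∀ x ∈ H.I,
          Θγ z x = (1 / (z - lam)) • (Θ z x + (1 / (z - lam)) •
              (wronskian (Θ (lam : ℂ)) (Θ z) x • H.uGamma (Θ (lam : ℂ)) γ x)
            + (((γ⁻¹.toReal : ℝ) : ℂ) - Wb) • Φγ z x)) ∧
        (∀ x ∈ H.I, Φγ (lam : ℂ) x = H.uGamma (Θ (lam : ℂ)) γ x) ∧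
        -- the discreteness hypothesis holds again
        (H.doubleCommutation (Θ (lam : ℂ)) γ).DiscreteNearA ∧
        -- the singular Weyl function is defined off the real line and off the spectrum
        (∀ z : ℂ, z.im ≠ 0 → z ∈ (H.doubleCommutation (Θ (lam : ℂ)) γ).weylDomain Φγ Θγ) ∧
        (∀ z : ℂ, z ∉ (H.doubleCommutation (Θ (lam : ℂ)) γ).spec →
          z ∈ (H.doubleCommutation (Θ (lam : ℂ)) γ).weylDomain Φγ Θγ) ∧
        -- the Weyl solutions at `b` and the singular Weyl function
        ∀ z : ℂ, z ≠ lam →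
          (z ∈ (H.doubleCommutation (Θ (lam : ℂ)) γ).weylDomain Φγ Θγ ↔
            z ∈ H.weylDomain Φ Θ) ∧
          (z ∈ H.weylDomain Φ Θ →
            ∃ Ψ Ψγ : ℝ → Spinor, ∃ Mγ : ℂ,
              (∀ x, Ψ x = Θ z x + H.singularWeyl Φ Θ z • Φ z x) ∧
              (∀ x, Ψγ x = (1 / (z - lam)) • (Ψ x + (1 / (z - lam)) •
                (wronskian (Θ (lam : ℂ)) Ψ x • H.uGamma (Θ (lam : ℂ)) γ x))) ∧
              Mγ = (H.singularWeyl Φ Θ z + Wb * (z - lam)) / (z - lam) ^ 2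
                - ((γ⁻¹.toReal : ℝ) : ℂ) / (z - lam) ∧
              (H.doubleCommutation (Θ (lam : ℂ)) γ).IsWeylSolutionB z Ψγ ∧
              (∀ x ∈ H.I, Ψγ x = Θγ z x + Mγ • Φγ z x) ∧
              (H.doubleCommutation (Θ (lam : ℂ)) γ).singularWeyl Φγ Θγ z = Mγ) := by
  obtain ⟨Wb, h1, h2, h3⟩ := DiracOperator.exists_boundary_wronskian hH hsys hb γ
  have h : H.IsCommutationData Φ Θ lam γ Wb := ⟨hH, hsys, hb, hnot, h2, h3⟩
  exact ⟨Wb, h1, h.adm_gamma, H.phiGamma Φ (Θ lam) lam γ, H.thetaGamma Φ Θ lam γ Wb,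
    h.isFundamentalSystem,
    fun z hz x _ => DiracOperator.IsCommutationData.phiGamma_eq hz,
    fun z hz x hx => h.thetaGamma_eq hx hz,
    fun x hx => DiracOperator.phiGamma_lam hsys hx,
    h.isFundamentalSystem.discreteNearA h.adm_gamma,
    fun z hz => DiracOperator.mem_weylDomain_of_im_ne_zero h.adm_gamma h.isFundamentalSystem hz,
    fun z hz => DiracOperator.mem_weylDomain_of_notMem_spec h.adm_gamma h.isFundamentalSystem hz,
    fun z hz => ⟨h.mem_weylDomain_iff hz, h.weyl_transform hz⟩⟩
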